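/- **Theorem.** Let $R$ be a commutative ring with unit and let $\Sigma$ be a smooth oriented surface, possibly with boundary. *Loops.* A loop is a (piecewise smooth) immersion $\alpha:S^1\to\Sigma\setminus\partial\Sigma$ whose only self-crossings are finitely many transversal double points; finitely many corners away from the crossings are allowed. A pointed loop is a loop with a base point on it that is not a crossing. (Pointed) loops are considered up to isotopy, i.e. ambient isotopy (a continuous family of homeomorphisms of $\Sigma$ starting at the identity) and orientation preserving reparametrization, base points being carried along. Let $\mathcal L$ be the free $R$-module on the isotopy classes of pointed loops, and $S(\mathcal L)$ its symmetric algebra. For a pointed loop $\alpha$ and a crossing $p$, let $p_1,p_2\in S^1$ be the two preimages of $p$ in the order in which they are met when one moves counterclockwise from the base point, let $e_p$ be the chord of the unit disk with endpoints $p_1,p_2$, and let $\varepsilon_p=+1$ if the tangent vectors of $\alpha$ at $p_1,p_2$ form a positive pair, $\varepsilon_p=-1$ otherwise. A cut of $\alpha$ is a set $H$ of crossings whose chords are pairwise disjoint; put $\varepsilon_H=\prod_{p\in H}\varepsilon_p$. The chords of $H$ split the disk into $H$-faces: the root face $v(H)$, whose boundary contains the preimage of the base point, and, for each $p\in H$,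 the face $v(H,p)$ adjacent to $e_p$ on the side of $e_p$ opposite to $v(H)$. For an $H$-face $v$, following $\alpha$ along $\partial v\cap S^1$ gives a loop $\alpha_v$, pointed at the base point of $\alpha$ if $v=v(H)$ and at $p$ if $v=v(H,p)$. The cut $H$ is simple if all its chords are adjacent to $v(H)$. Let $\Delta:S(\mathcal L)\to S(\mathcal L)\otimes S(\mathcal L)$ be the algebra homomorphism with $$\Delta(\alpha)=\alpha\otimes 1+\sum_{H\text{ simple cut of }\alpha}\varepsilon_H\prod_{p\in H}\alpha_{v(H,p)}\otimes\alpha_{v(H)} .$$ *Trees.* Let $\mathcal T(\Phi)$ be the free $R$-module on the homeomorphism classes of finite planar rooted trees whose edges are labeled with signs $\pm1$ and whose vertices are labeled with isotopy classes of non-pointed loops on $\Sigma$. Here a planar structure is a cyclic order of the edges at each vertex. A simple cut of a tree $T$ is a set $c$ of edges such that each embedded path starting at the root meets at most one element of $c$; removing $c$ leaves the subtree $T_0$ containing the root and, for each $e\in c$, a subtree $T_e$ attached to $T_0$ by $e$ and rooted at the corresponding end of $e$. Let $\nabla:S(\mathcal T(\Phi))\to S(\mathcal T(\Phi))\otimes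 S(\mathcal T(\Phi))$ be the Connes–Kreimer comultiplication, i.e. the algebra homomorphism with $$\nabla(T)=T\otimes1+\sum_{c\text{ simple cut of }T}\ \prod_{e\in c}T_e\otimes T_0 .$$ *The map $\eta$.* For a cut $H$ of $\alpha$ let $T_H$ be the planar rooted tree dual to the splitting of the disk into $H$-faces: its vertices are the $H$-faces, each labeled with its loop $\alpha_v$ (base point forgotten), its root is $v(H)$, and its edges are the elements of $H$, labeled with $\varepsilon_p$. Let $\eta:\mathcal L\to\mathcal T(\Phi)$ be the linear map with $\eta(\alpha)=\sum_{H}\varepsilon_H T_H$, the sum being over all cuts $H$ of $\alpha$, and extend it to an algebra homomorphism $\eta:S(\mathcal L)\to S(\mathcal T(\Phi))$. Then all these data are well defined: the loops $\alpha_v$ exist and are unique up to isotopy, and the formulas for $\Delta$, $\nabla$ and $\eta$ do not depend on the chosen representatives. Moreover $S(\mathcal L)$ with $\Delta$ and $S(\mathcal T(\Phi))$ with $\nabla$, with the augmentations as counits, are Hopf algebras, and $\eta$ is a Hopf algebra homomorphism, i.e. an algebra homomorphism compatible with the comultiplications, the counits and the antipodes. -/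

import Mathlib

open Set Manifold TensorProduct
open scoped ContDiff

noncomputable section

namespace LoopTree

/-! ### Oriented surfaces -/

/-- A smooth oriented surface, possibly with boundary: a smooth `2`-manifold modelled on the closed
half-plane, whose orientation is given by an atlas all of whose transition maps have positive
Jacobian determinant. (Hausdorffness and second countability are separate assumptions.) -/
class OrientedSurface (M : Type*) [TopologicalSpace M] [ChartedSpace (EuclideanHalfSpace 2) M] :
    Prop extends IsManifold (𝓡∂ 2) ∞ M where
  jacobian_pos : ∀ e ∈ atlas (EuclideanHalfSpace 2) M, ∀ e' ∈ atlas (EuclideanHalfSpace 2) M,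
    ∀ x ∈ e.source ∩ e'.source,
      0 < (fderivWithin ℝ (e'.extend (𝓡∂ 2) ∘ (e.extend (𝓡∂ 2)).symm) (range (𝓡∂ 2))
        (e.extend (𝓡∂ 2) x)).det

/-- The circle `ℝ / ℤ`, with the counterclockwise cyclic order provided by Mathlib (`btw`, `sbtw`).
The parameter `u : ℝ / ℤ` stands for the point `exp (2 π i u)`. -/
abbrev S1 : Type := UnitAddCircle

/-- The length in `[0, 1)` of the arc that leads from `b` to `x` in the counterclockwise
direction. -/
def pos (b x : S1) : ℝ := (AddCircle.equivIco (1 : ℝ) 0 (x - b) : ℝ)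

/-! ### Generic loops -/

section Loops

variable {M : Type*} [TopologicalSpace M]

/-- The path `u ↦ α (x + u)` which follows `α` and is at `α x` at time `0`. -/
def pathAt (α : S1 → M) (x : S1) (u : ℝ) : M := α (x + (u : S1))

variable [ChartedSpace (EuclideanHalfSpace 2) M]

/-- The forward tangent vector of `α` at the parameter `x`, in the preferred chart at `α x`. -/
def tangentRight (α : S1 → M) (x : S1) : EuclideanSpace ℝ (Fin 2) :=
  mfderivWithin 𝓘(ℝ, ℝ) (𝓡∂ 2) (pathAt α x) (Ici 0) 0 (1 : ℝ)

/-- The backward one-sided derivative of `α` at the parameter `x`, i.e. the (positively directed)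
tangent vector with which `α` arrives at `α x`, in the preferred chart at `α x`. -/
def tangentLeft (α : S1 → M) (x : S1) : EuclideanSpace ℝ (Fin 2) :=
  mfderivWithin 𝓘(ℝ, ℝ) (𝓡∂ 2) (pathAt α x) (Iic 0) 0 (1 : ℝ)

/-- The positive tangent vector of `α` at a parameter `x` where `α` is smooth. -/
def tangent (α : S1 → M) (x : S1) : EuclideanSpace ℝ (Fin 2) :=
  mfderiv 𝓘(ℝ, ℝ) (𝓡∂ 2) (pathAt α x) 0 (1 : ℝ)

/-- The determinant of two plane vectors. -/
def det2 (v w : EuclideanSpace ℝ (Fin 2)) : ℝ := v 0 * w 1 - v 1 * w 0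

/-- `α : S¹ → M` is a generic loop: a piecewise smooth immersion into the interior of the surface,
whose only non-smooth points are corners (no cusps) distinct from the crossings, and which has only
finitely many self-crossings, all of them transversal double points. -/
structure IsGeneric (α : S1 → M) : Prop where
  continuous : Continuous α
  interior : ∀ x, α x ∈ (𝓡∂ 2).interior M
  /-- Each parameter is followed by an interval on which `α` is smooth up to the endpoints. -/
  smooth_right : ∀ x, ∃ δ > 0, ContMDiffOn 𝓘(ℝ, ℝ) (𝓡∂ 2) ∞ (pathAt α x) (Icc 0 δ)
  /-- Each parameter is preceded by an interval on which `α` is smooth up to the endpoints. -/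
  smooth_left : ∀ x, ∃ δ > 0, ContMDiffOn 𝓘(ℝ, ℝ) (𝓡∂ 2) ∞ (pathAt α x) (Icc (-δ) 0)
  /-- One-sided tangent vectors do not vanish and the direction is never reversed (`SameRay` holds
  if one of the vectors is zero). -/
  immersed : ∀ x, ¬ SameRay ℝ (tangentLeft α x) (-tangentRight α x)
  smooth_crossing : ∀ x y, x ≠ y → α x = α y →
    ContMDiffAt 𝓘(ℝ, ℝ) (𝓡∂ 2) ∞ (pathAt α x) 0
  transversal : ∀ x y, x ≠ y → α x = α y → det2 (tangent α x) (tangent α y) ≠ 0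
  double : ∀ x y z, α x = α y → α y = α z → x = y ∨ y = z ∨ x = z
  finite : {p : S1 × S1 | p.1 ≠ p.2 ∧ α p.1 = α p.2}.Finite

end Loops

/-- An ambient isotopy of `M`: a continuous family of homeomorphisms starting at the identity. -/
structure AmbientIsotopy (M : Type*) [TopologicalSpace M] where
  homeo : unitInterval → M ≃ₜ M
  continuous : Continuous fun q : unitInterval × M => homeo q.1 q.2
  zero : homeo 0 = Homeomorph.refl M

section Isotopies

variable {M : Type*} [TopologicalSpace M]

/-- The constant isotopy. -/
def AmbientIsotopy.refl (M : Type*) [TopologicalSpace M] : AmbientIsotopy M where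
  homeo _ := Homeomorph.refl M
  continuous := continuous_snd
  zero := rfl

/-- The isotopy `t ↦ h₁₋ₜ ∘ h₁⁻¹`, which ends at `h₁⁻¹`. -/
def AmbientIsotopy.symm (h : AmbientIsotopy M) : AmbientIsotopy M where
  homeo t := (h.homeo 1).symm.trans (h.homeo (unitInterval.symm t))
  continuous := h.continuous.comp
    ((unitInterval.continuous_symm.comp continuous_fst).prodMk
      ((h.homeo 1).symm.continuous.comp continuous_snd))
  zero := by ext x; simp

theorem AmbientIsotopy.symm_one (h : AmbientIsotopy M) (x : M) :
    h.symm.homeo 1 x = (h.homeo 1).symm x := by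
  simp [AmbientIsotopy.symm, h.zero]

/-- Composition of isotopies: `t ↦ k_t ∘ h_t`. -/
def AmbientIsotopy.trans (h k : AmbientIsotopy M) : AmbientIsotopy M where
  homeo t := (h.homeo t).trans (k.homeo t)
  continuous := k.continuous.comp (continuous_fst.prodMk h.continuous)
  zero := by ext x; simp [h.zero, k.zero]

end Isotopies

variable (M : Type*) [TopologicalSpace M] [ChartedSpace (EuclideanHalfSpace 2) M]

/-- A generic (non-pointed) loop. -/
structure Loop where
  toFun : S1 → M
  generic : IsGeneric toFun

/-- A pointed loop: a generic loop together with a base point on it which is not a self-crossing.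
The base point is recorded through its unique parameter `base`. -/
structure PointedLoop extends Loop M where
  base : S1
  base_simple : ∀ x, toFun x = toFun base → x = base

/-- An orientation preserving homeomorphism of the circle. -/
structure Reparam where
  homeo : S1 ≃ₜ S1
  mono : ∀ x y z, sbtw x y z → sbtw (homeo x) (homeo y) (homeo z)

variable {M}

/-- Isotopy of non-pointed loops: ambient isotopy combined with reparametrization. -/
def Loop.Isotopic (α β : Loop M) : Prop :=
  ∃ (h : AmbientIsotopy M) (f : Reparam), ∀ x, β.toFun x = h.homeo 1 (α.toFun (f.homeo x))

/-- Isotopy of pointed loops: ambient isotopy combined with reparametrization, carrying the base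
point to the base point. -/
def PointedLoop.Isotopic (α β : PointedLoop M) : Prop :=
  ∃ (h : AmbientIsotopy M) (f : Reparam),
    (∀ x, β.toFun x = h.homeo 1 (α.toFun (f.homeo x))) ∧ f.homeo β.base = α.base

section Equivalence

/-- The identity reparametrization. -/
def Reparam.refl : Reparam := ⟨Homeomorph.refl _, fun _ _ _ h => h⟩

/-- The inverse reparametrization. -/
def Reparam.symm (f : Reparam) : Reparam where
  homeo := f.homeo.symm
  mono x y z h := by
    rw [sbtw_iff_not_btw]
    intro h'
    rcases eq_or_ne (f.homeo.symm z) (f.homeo.symm y) with e | e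
    · exact sbtw_irrefl_right (f.homeo.symm.injective e ▸ h)
    rcases eq_or_ne (f.homeo.symm y) (f.homeo.symm x) with e' | e'
    · exact sbtw_irrefl_left (f.homeo.symm.injective e' ▸ h)
    rcases eq_or_ne (f.homeo.symm x) (f.homeo.symm z) with e'' | e''
    · exact sbtw_irrefl_left_right (f.homeo.symm.injective e'' ▸ h)
    have hs : sbtw (f.homeo.symm z) (f.homeo.symm y) (f.homeo.symm x) := by
      refine sbtw_of_btw_not_btw h' fun h'' => ?_
      rcases h'.antisymm h'' with a | a | a
      exacts [e a, e' a, e'' a]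
    have := f.mono _ _ _ hs
    simp only [Homeomorph.apply_symm_apply] at this
    exact sbtw_asymm h this

/-- Composition of reparametrizations. -/
def Reparam.trans (f g : Reparam) : Reparam :=
  ⟨f.homeo.trans g.homeo, fun _ _ _ h => g.mono _ _ _ (f.mono _ _ _ h)⟩

variable (M) in
/-- Isotopy is an equivalence relation on non-pointed loops. -/
instance loopSetoid : Setoid (Loop M) where
  r := Loop.Isotopic
  iseqv :=
    { refl := fun _ => ⟨.refl M, .refl, fun _ => rfl⟩
      symm := by
        rintro α β ⟨h, f, hf⟩
        exact ⟨h.symm, f.symm, fun x => by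
          rw [h.symm_one, hf]; simp [Reparam.symm]⟩
      trans := by
        rintro α β γ ⟨h, f, hf⟩ ⟨k, g, hg⟩
        exact ⟨h.trans k, g.trans f, fun x => by
          rw [hg, hf]; simp [Reparam.trans, AmbientIsotopy.trans]⟩ }

variable (M) in
/-- Isotopy is an equivalence relation on pointed loops. -/
instance pointedSetoid : Setoid (PointedLoop M) where
  r := PointedLoop.Isotopic
  iseqv :=
    { refl := fun _ => ⟨.refl M, .refl, fun _ => rfl, rfl⟩
      symm := by
        rintro α β ⟨h, f, hf, hb⟩
        exact ⟨h.symm, f.symm, fun x => by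
          rw [h.symm_one, hf]; simp [Reparam.symm], by rw [← hb]; simp [Reparam.symm]⟩
      trans := by
        rintro α β γ ⟨h, f, hf, hb⟩ ⟨k, g, hg, hc⟩
        exact ⟨h.trans k, g.trans f, fun x => by
          rw [hg, hf]; simp [Reparam.trans, AmbientIsotopy.trans],
          by simp [Reparam.trans, hb, hc]⟩ }

end Equivalence

variable (M) in
/-- Isotopy classes of non-pointed loops. -/
abbrev LoopClass := Quotient (loopSetoid M)

variable (M) in
/-- Isotopy classes of pointed loops. -/
abbrev PointedClass := Quotient (pointedSetoid M)

/-- Forgetting the base point. -/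
def forgetBase : PointedClass M → LoopClass M :=
  Quotient.map PointedLoop.toLoop fun _ _ ⟨h, f, hf, _⟩ => ⟨h, f, hf⟩

/-! ### Crossings, cuts, faces -/

/-- A self-crossing of a pointed loop, recorded through its two preimages `p₁, p₂` on the circle,
numbered in the order in which they are met when one starts at the base point and moves
counterclockwise. -/
def Crossing (α : PointedLoop M) : Type :=
  {p : S1 × S1 // pos α.base p.1 < pos α.base p.2 ∧ α.toFun p.1 = α.toFun p.2}

namespace Crossing

variable {α : PointedLoop M}

/-- The time at which a crossing is met first. -/
def fst (p : Crossing α) : ℝ := pos α.base p.1.1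

/-- The time at which a crossing is met for the second time. -/
def snd (p : Crossing α) : ℝ := pos α.base p.1.2

instance : Finite (Crossing α) :=
  Set.Finite.to_subtype (α.generic.finite.subset fun p hp =>
    ⟨fun e => absurd hp.1 (by rw [e]; exact lt_irrefl _), hp.2⟩)

/-- The sign of a crossing: `+1` if the positive tangent vectors at `p₁` and `p₂`, in this order,
form a positive basis with respect to the orientation of the surface, and `-1` otherwise. -/
def sign (p : Crossing α) : ℤˣ :=
  open Classical in
  if 0 < det2 (tangent α.toFun p.1.1) (tangent α.toFun p.1.2) then 1 else -1

/-- The chord `e_p` with endpoints `p₁, p₂` lies beyond the chord `e_q`, as seen from the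
base point: the open arc from `q₁` to `q₂` contains both `p₁` and `p₂`. -/
def Inside (p q : Crossing α) : Prop := q.fst < p.fst ∧ p.snd < q.snd

/-- Two crossings are linked if their chords meet inside the disk, that is, if the endpoints of the
chords alternate on the circle. -/
def Linked (p q : Crossing α) : Prop :=
  (p.fst < q.fst ∧ q.fst < p.snd ∧ p.snd < q.snd) ∨
    (q.fst < p.fst ∧ p.fst < q.snd ∧ q.snd < p.snd)

theorem fst_lt_snd (p : Crossing α) : p.fst < p.snd := p.2.1

/-- Crossings ordered by `Inside`: larger chords are closer to the base point. -/
instance : PartialOrder (Crossing α) where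
  le p q := p = q ∨ Inside p q
  le_refl p := Or.inl rfl
  le_trans := by
    rintro p q r (rfl | h) (rfl | h')
    · exact Or.inl rfl
    · exact Or.inr h'
    · exact Or.inr h
    · exact Or.inr ⟨h'.1.trans h.1, h.2.trans h'.2⟩
  le_antisymm := by
    rintro p q (rfl | h) (h' | h')
    · rfl
    · rfl
    · exact h'.symm
    · exact absurd (h.1.trans h'.1) (lt_irrefl _)

theorem le_iff {p q : Crossing α} : p ≤ q ↔ p = q ∨ Inside p q := Iff.rfl

theorem pos_injective (b : S1) : Function.Injective (pos b) := fun x y h => by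
  have := (AddCircle.equivIco (1 : ℝ) 0).injective (Subtype.ext h)
  simpa using this

theorem eq_of_fst_eq {p q : Crossing α} (h : p.fst = q.fst) : p = q := by
  have h1 : p.1.1 = q.1.1 := pos_injective _ h
  have hp := p.2
  have hq := q.2
  have h2 : p.1.2 = q.1.2 := by
    rcases α.generic.double p.1.2 p.1.1 q.1.2 hp.2.symm (by rw [h1]; exact hq.2) with e | e | e
    · rw [e] at hp; exact absurd hp.1 (lt_irrefl _)
    · rw [h1] at e; rw [← e] at hq; exact absurd hq.1 (lt_irrefl _)
    · exact e
  exact Subtype.ext (Prod.ext h1 h2)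

theorem eq_of_snd_eq {p q : Crossing α} (h : p.snd = q.snd) : p = q := by
  have h1 : p.1.2 = q.1.2 := pos_injective _ h
  have hp := p.2
  have hq := q.2
  have h2 : p.1.1 = q.1.1 := by
    rcases α.generic.double p.1.1 p.1.2 q.1.1 hp.2 (by rw [h1]; exact hq.2.symm) with e | e | e
    · rw [e] at hp; exact absurd hp.1 (lt_irrefl _)
    · rw [h1] at e; rw [← e] at hq; exact absurd hq.1 (lt_irrefl _)
    · exact e
  exact Subtype.ext (Prod.ext h2 h1)

end Crossing

section Cuts

variable {α : PointedLoop M}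

/-- A cut of a loop: a set of pairwise unlinked crossings. -/
def IsCut (H : Finset (Crossing α)) : Prop :=
  ∀ p ∈ H, ∀ q ∈ H, p ≠ q → ¬ Crossing.Linked p q

/-- The sign of a cut. -/
def cutSign (H : Finset (Crossing α)) : ℤˣ := ∏ p ∈ H, p.sign

/-- The part on the circle of the boundary of an `H`-face. The `H`-faces are indexed as follows:
`none` is the root face, which has the parameter of the base point on its boundary, and, for
`p ∈ H`, `some p` is the face adjacent to the chord `e_p` on the side of `e_p` opposite to the root
face. -/
def faceArcs (H : Finset (Crossing α)) : Option (Crossing α) → Set S1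
  | none => {x | ∀ q ∈ H, ¬ (q.fst < pos α.base x ∧ pos α.base x < q.snd)}
  | some p => {x | (p.fst ≤ pos α.base x ∧ pos α.base x ≤ p.snd) ∧
      ∀ q ∈ H, Crossing.Inside q p → ¬ (q.fst < pos α.base x ∧ pos α.base x < q.snd)}

/-- The parameter of the base point of the loop associated with an `H`-face: the old base point for
the root face, and the crossing `p` for the face `some p`. -/
def faceBase (α : PointedLoop M) : Option (Crossing α) → S1
  | none => α.base
  | some p => p.1.1

/-- A cut is simple if all its chords are adjacent to the root face. -/
def IsSimpleCut (H : Finset (Crossing α)) : Prop :=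
  IsCut H ∧ ∀ p ∈ H, p.1.1 ∈ faceArcs H none ∧ p.1.2 ∈ faceArcs H none

end Cuts

/-- `g` collapses the circle along a closed set `A`: it is continuous, onto, weakly preserves the
cyclic order, and its only identifications are that the closure of each gap (component of the
complement) of `A` is shrunk to a point. -/
structure IsCollapse (A : Set S1) (g : S1 → S1) : Prop where
  continuous : Continuous g
  surjective : Function.Surjective g
  mono : ∀ x y z, btw x y z → btw (g x) (g y) (g z)
  fiber : ∀ x y, g x = g y ↔ x = y ∨ Disjoint (cIoo x y) A ∨ Disjoint (cIoo y x) A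

/-- `β` is the pointed loop associated with the face `v`: up to parametrization, it follows `α` along
the arcs of the circle which lie on the boundary of the face, skipping the rest of the circle (`α`
takes the same value at the two ends of each skipped arc). -/
def IsFaceLoop (α : PointedLoop M) (H : Finset (Crossing α)) (v : Option (Crossing α))
    (β : PointedLoop M) : Prop :=
  ∃ g : S1 → S1, IsCollapse (faceArcs H v) g ∧
    (∀ x ∈ faceArcs H v, β.toFun (g x) = α.toFun x) ∧ β.base = g (faceBase α v)

/-- The isotopy class `α_v` of the pointed loop associated with the face `v`. For a face of a cut
such a loop exists and is unique up to reparametrization; the value in the `else` branch is never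
used. -/
def faceClass (α : PointedLoop M) (H : Finset (Crossing α)) (v : Option (Crossing α)) :
    PointedClass M :=
  open Classical in
  if h : ∃ β, IsFaceLoop α H v β then ⟦h.choose⟧ else ⟦α⟧

/-! ### Planar rooted trees with labels -/

/-- `C` is a (strict) cyclic order on the set `s`. -/
structure IsCyclicOrderOn {E : Type*} (s : Set E) (C : E → E → E → Prop) : Prop where
  rotate : ∀ a ∈ s, ∀ b ∈ s, ∀ c ∈ s, C a b c → C b c a
  asymm : ∀ a ∈ s, ∀ b ∈ s, ∀ c ∈ s, C a b c → ¬ C c b a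
  trans : ∀ a ∈ s, ∀ b ∈ s, ∀ c ∈ s, ∀ d ∈ s, C a b c → C a c d → C a b d
  total : ∀ a ∈ s, ∀ b ∈ s, ∀ c ∈ s, a ≠ b → b ≠ c → a ≠ c → C a b c ∨ C c b a

/-- A rooted tree is encoded by its set `E` of edges, ordered by `e ≤ f` if every path from the root
through `e` passes through `f`. Its vertices are the elements of `Option E`: `none` is the root, and
`some e` is the end of the edge `e` remote from the root. This is the set of edges incident to a
vertex: the maximal edges for the root; for `some e`, the edge `e` and the edges just below it. -/
def incident {E : Type*} [PartialOrder E] : Option E → Set E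
  | none => {e | IsMax e}
  | some f => {e | e = f ∨ e ⋖ f}

/-- A finite planar rooted tree whose edges are labeled with signs and whose vertices are labeled
with elements of `Λ`. The planar structure is a cyclic (counterclockwise) order of the edges at each
vertex. -/
structure PlanarTree (Λ : Type*) where
  Edge : Type
  [finite : Finite Edge]
  [order : PartialOrder Edge]
  chain : ∀ e f g : Edge, e ≤ f → e ≤ g → f ≤ g ∨ g ≤ f
  sign : Edge → ℤˣ
  label : Option Edge → Λ
  cyc : Option Edge → Edge → Edge → Edge → Prop
  isCyclicOrder : ∀ v, IsCyclicOrderOn (incident v) (cyc v)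

attribute [instance] PlanarTree.finite PlanarTree.order

namespace PlanarTree

variable {Λ : Type*}

/-- Homeomorphic planar rooted labeled trees. -/
def Homeo (T T' : PlanarTree Λ) : Prop :=
  ∃ σ : T.Edge ≃o T'.Edge, (∀ e, T'.sign (σ e) = T.sign e) ∧
    (∀ v, T'.label (v.map σ) = T.label v) ∧
    ∀ v, ∀ a ∈ incident v, ∀ b ∈ incident v, ∀ c ∈ incident v,
      T'.cyc (v.map σ) (σ a) (σ b) (σ c) ↔ T.cyc v a b c

theorem map_mem_incident {E E' : Type*} [PartialOrder E] [PartialOrder E'] (σ : E ≃o E')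
    (v : Option E) (a : E) : σ a ∈ incident (v.map σ) ↔ a ∈ incident v := by
  cases v with
  | none => exact ⟨fun h b hb => by simpa using h (b := σ b) (by simpa using hb),
      fun h b hb => by
        simpa [OrderIso.symm_apply_le, OrderIso.le_symm_apply] using
          h (b := σ.symm b) (by simpa [OrderIso.le_symm_apply] using hb)⟩
  | some f => simp [incident]

variable (Λ) in
/-- Homeomorphism is an equivalence relation. -/
instance setoid : Setoid (PlanarTree Λ) where
  r := Homeo
  iseqv :=
    { refl := fun T => ⟨OrderIso.refl _, by simp, by simp, by simp⟩
      symm := by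
        rintro T T' ⟨σ, hs, hl, hc⟩
        refine ⟨σ.symm, fun e => ?_, fun v => ?_, fun v a ha b hb c hc' => ?_⟩
        · rw [← hs]; simp
        · rw [← hl]; simp [Function.comp_def]
        · rw [← hc _ _ ((map_mem_incident σ.symm v a).2 ha) _
            ((map_mem_incident σ.symm v b).2 hb) _ ((map_mem_incident σ.symm v c).2 hc')]
          simp [Function.comp_def]
      trans := by
        rintro T T' T'' ⟨σ, hs, hl, hc⟩ ⟨τ, ks, kl, kc⟩
        refine ⟨σ.trans τ, fun e => ?_, fun v => ?_, fun v a ha b hb c hc' => ?_⟩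
        · rw [← hs, ← ks]; rfl
        · rw [← hl, ← kl]; simp [Function.comp_def]
        · rw [← hc v a ha b hb c hc', ← kc _ _ ((map_mem_incident σ v a).2 ha) _
            ((map_mem_incident σ v b).2 hb) _ ((map_mem_incident σ v c).2 hc')]
          simp [Function.comp_def] }

/-- The vertex of `T` which corresponds to a vertex of the subtree with edge set `s` and
root `r`. -/
def liftVertex {E : Type*} {s : Set E} (r : Option E) (v : Option s) : Option E :=
  v.elim r fun e => some e.1

/-- The subtree of `T` with edge set `s` and root `r`, with the restricted structure. -/
def restrict (T : PlanarTree Λ) (s : Set T.Edge) (r : Option T.Edge)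
    (h : ∀ v : Option s, ∀ a ∈ incident v, a.1 ∈ incident (liftVertex r v)) : PlanarTree Λ where
  Edge := s
  chain e f g := T.chain e f g
  sign e := T.sign e
  label v := T.label (liftVertex r v)
  cyc v a b c := T.cyc (liftVertex r v) a b c
  isCyclicOrder v :=
    { rotate := fun a ha b hb c hc =>
        (T.isCyclicOrder _).rotate a (h v a ha) b (h v b hb) c (h v c hc)
      asymm := fun a ha b hb c hc =>
        (T.isCyclicOrder _).asymm a (h v a ha) b (h v b hb) c (h v c hc)
      trans := fun a ha b hb c hc d hd =>
        (T.isCyclicOrder _).trans a (h v a ha) b (h v b hb) c (h v c hc) d (h v d hd)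
      total := fun a ha b hb c hc hab hbc hac =>
        (T.isCyclicOrder _).total a (h v a ha) b (h v b hb) c (h v c hc)
          (fun e => hab (Subtype.ext e)) (fun e => hbc (Subtype.ext e))
          (fun e => hac (Subtype.ext e)) }

/-- The subtree `T_e` which is separated from the root by the edge `e`; its root is the end of `e`
remote from the root of `T`. -/
def branch (T : PlanarTree Λ) (e : T.Edge) : PlanarTree Λ :=
  T.restrict {f | f < e} (some e) <| by
    rintro (_ | f) a ha
    · refine Or.inr ⟨a.2, fun c hac hce => ?_⟩
      exact absurd (ha (b := ⟨c, hce⟩) hac.le) (fun h => absurd hac (not_lt_of_ge h))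
    · rcases ha with rfl | ha
      · exact Or.inl rfl
      · refine Or.inr ⟨ha.lt, fun c hac hcf => ?_⟩
        exact ha.2 (c := ⟨c, hcf.trans f.2⟩) hac hcf

/-- The subtree `T_0` which contains the root of `T` after the removal of the edges in `c`. -/
def trunk (T : PlanarTree Λ) (c : Finset T.Edge) : PlanarTree Λ :=
  T.restrict {f | ∀ e ∈ c, ¬ f ≤ e} none <| by
    rintro (_ | f) a ha
    · intro b hab
      exact ha (b := ⟨b, fun e he hbe => a.2 e he (hab.trans hbe)⟩) hab
    · rcases ha with rfl | ha
      · exact Or.inl rfl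
      · refine Or.inr ⟨ha.lt, fun b hab hbf => ?_⟩
        exact ha.2 (c := ⟨b, fun e he hbe => a.2 e he (hab.le.trans hbe)⟩) hab hbf

/-- A simple cut of a rooted tree: a set of edges such that the path from the root to any vertex
`some f` (which consists of the edges `e ≥ f`) meets at most one of them. -/
def IsSimpleCut (T : PlanarTree Λ) (c : Finset T.Edge) : Prop :=
  ∀ f : T.Edge, ∀ e ∈ c, ∀ e' ∈ c, f ≤ e → f ≤ e' → e = e'

end PlanarTree

/-- Homeomorphism classes of planar rooted labeled trees. -/
abbrev TreeClass (Λ : Type*) := Quotient (PlanarTree.setoid Λ)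

/-! ### The symmetric algebras and their comultiplications -/

/-- The symmetric algebra of the free `R`-module with basis `X`. -/
abbrev FreeSym (R : Type*) [CommRing R] (X : Type*) := SymmetricAlgebra R (X →₀ R)

/-- The generator of the symmetric algebra which corresponds to a basis element. -/
def gen (R : Type*) [CommRing R] {X : Type*} (x : X) : FreeSym R X :=
  SymmetricAlgebra.ι R (X →₀ R) (Finsupp.single x 1)

/-- The algebra homomorphism which extends a map given on generators. -/
def extendAlg (R : Type*) [CommRing R] {X : Type*} {A : Type*} [CommRing A] [Algebra R A]
    (φ : X → A) : FreeSym R X →ₐ[R] A :=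
  SymmetricAlgebra.lift (Finsupp.linearCombination R φ)

/-- The augmentation of the symmetric algebra: the projection to the degree `0` part. -/
def augmentation (R : Type*) [CommRing R] (X : Type*) : FreeSym R X →ₐ[R] R :=
  SymmetricAlgebra.algebraMapInv

section Comultiplications

variable (R : Type*) [CommRing R]

open Classical in
/-- The value of `Δ` on a pointed loop: the sum of `α ⊗ 1` and of
`ε_H ∏_{p ∈ H} α_{v(H,p)} ⊗ α_{v(H)}` over all simple cuts `H` of `α`. -/
def loopCoproduct (α : PointedLoop M) :
    FreeSym R (PointedClass M) ⊗[R] FreeSym R (PointedClass M) :=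
  letI := Fintype.ofFinite {H : Finset (Crossing α) // IsSimpleCut H}
  gen R (⟦α⟧ : PointedClass M) ⊗ₜ[R] 1 +
    ∑ H : {H : Finset (Crossing α) // IsSimpleCut H},
      ((cutSign H.1 : ℤ) : R) •
        ((∏ p ∈ H.1, gen R (faceClass α H.1 (some p))) ⊗ₜ[R] gen R (faceClass α H.1 none))

variable (M) in
/-- The comultiplication `Δ` of the algebra of pointed loops. -/
def loopComul : FreeSym R (PointedClass M) →ₐ[R]
    FreeSym R (PointedClass M) ⊗[R] FreeSym R (PointedClass M) :=
  extendAlg R fun a => loopCoproduct R a.out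

open Classical in
/-- The value of the Connes-Kreimer comultiplication on a tree: the sum of `T ⊗ 1` and of
`∏_{e ∈ c} T_e ⊗ T_0` over all simple cuts `c` of `T`. -/
def treeCoproduct {Λ : Type*} (T : PlanarTree Λ) :
    FreeSym R (TreeClass Λ) ⊗[R] FreeSym R (TreeClass Λ) :=
  letI := Fintype.ofFinite {c : Finset T.Edge // T.IsSimpleCut c}
  gen R (⟦T⟧ : TreeClass Λ) ⊗ₜ[R] 1 +
    ∑ c : {c : Finset T.Edge // T.IsSimpleCut c},
      (∏ e ∈ c.1, gen R (⟦T.branch e⟧ : TreeClass Λ)) ⊗ₜ[R] gen R (⟦T.trunk c.1⟧ : TreeClass Λ)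

/-- The Connes-Kreimer comultiplication. -/
def treeComul (Λ : Type*) : FreeSym R (TreeClass Λ) →ₐ[R]
    FreeSym R (TreeClass Λ) ⊗[R] FreeSym R (TreeClass Λ) :=
  extendAlg R fun t => treeCoproduct R t.out

end Comultiplications

/-! ### From loops to trees -/

/-- The tree `T_H` of a cut `H`: it is dual to the splitting of the disk into `H`-faces. Its edges
are the elements of `H`, labeled with their signs; the vertex `some p` is the face `some p`, the root
is the root face, and each vertex is labeled with the non-pointed loop associated with the face. The
cyclic order of the edges at a vertex is the cyclic order of the corresponding chords on the boundary
of the face, which is that of their first endpoints on the circle. -/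
def cutTree (α : PointedLoop M) (H : Finset (Crossing α)) (hH : IsCut H) :
    PlanarTree (LoopClass M) where
  Edge := {p // p ∈ H}
  chain := by
    rintro ⟨e, he⟩ ⟨f, hf⟩ ⟨g, hg⟩ hef heg
    simp only [Subtype.mk_le_mk] at hef heg ⊢
    rcases hef with rfl | hef
    · exact Or.inl heg
    rcases heg with rfl | heg
    · exact Or.inr (Or.inr hef)
    by_cases hfg : f = g
    · exact Or.inl (Or.inl hfg)
    have hl := hH f hf g hg hfg
    have h1 : f.fst ≠ g.fst := fun h => hfg (Crossing.eq_of_fst_eq h)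
    have h2 : f.snd ≠ g.snd := fun h => hfg (Crossing.eq_of_snd_eq h)
    have h3 := e.fst_lt_snd
    simp only [Crossing.le_iff, Crossing.Inside, Crossing.Linked, not_or, not_and, not_lt]
      at hl hef heg ⊢
    rcases lt_or_gt_of_ne h1 with h | h
    · exact Or.inr (Or.inr ⟨h, lt_of_le_of_ne (hl.1 h (by linarith)) (Ne.symm h2)⟩)
    · exact Or.inl (Or.inr ⟨h, lt_of_le_of_ne (hl.2 h (by linarith)) h2⟩)
  sign p := p.1.sign
  label v := forgetBase (faceClass α H (v.map Subtype.val))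
  cyc _ a b c := sbtw a.1.1.1 b.1.1.1 c.1.1.1
  isCyclicOrder _ :=
    { rotate := fun a _ b _ c _ h => sbtw_cyclic_left h
      asymm := fun a _ b _ c _ h => sbtw_asymm h
      trans := fun a _ b _ c _ d _ h h' => sbtw_trans_right h h'
      total := fun a _ b _ c _ hab hbc hac => by
        have key : ∀ {p q : {p // p ∈ H}}, p.1.1.1 = q.1.1.1 → p = q := fun {p q} h =>
          Subtype.ext (Crossing.eq_of_fst_eq (congrArg (pos α.base) h))
        by_contra hn
        rw [not_or, ← btw_iff_not_sbtw, ← btw_iff_not_sbtw] at hn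
        rcases hn.2.antisymm hn.1 with e | e | e
        · exact hab (key e)
        · exact hbc (key e)
        · exact hac (key e).symm }

section Eta

variable (R : Type*) [CommRing R]

open Classical in
/-- The value of `η` on a pointed loop: the sum of `ε_H T_H` over all cuts `H` of `α`. -/
def etaLoop (α : PointedLoop M) : TreeClass (LoopClass M) →₀ R :=
  letI := Fintype.ofFinite {H : Finset (Crossing α) // IsCut H}
  ∑ H : {H : Finset (Crossing α) // IsCut H},
    ((cutSign H.1 : ℤ) : R) • Finsupp.single (⟦cutTree α H.1 H.2⟧ : TreeClass (LoopClass M)) 1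

variable (M) in
/-- The linear map `η` from the module of pointed loops to the module of trees. -/
def etaLin : (PointedClass M →₀ R) →ₗ[R] (TreeClass (LoopClass M) →₀ R) :=
  Finsupp.linearCombination R fun a => etaLoop R a.out

variable (M) in
/-- The multiplicative extension of `η` to the symmetric algebras. -/
def eta : FreeSym R (PointedClass M) →ₐ[R] FreeSym R (TreeClass (LoopClass M)) :=
  SymmetricAlgebra.lift (SymmetricAlgebra.ι R _ ∘ₗ etaLin M R)

end Eta

/-! ### Hopf algebras -/

section Hopf

variable {R : Type*} [CommRing R] {A B : Type*} [CommRing A] [Algebra R A] [CommRing B]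
  [Algebra R B]

/-- The commutative algebra `A` is a Hopf algebra with comultiplication `Δ`, counit `ε` and
antipode `s`. (Explicit structure maps are used because symmetric algebras already carry another
bialgebra structure in Mathlib.) -/
structure IsHopfAlgebra (Δ : A →ₐ[R] A ⊗[R] A) (ε : A →ₐ[R] R) (s : A →ₗ[R] A) : Prop where
  coassoc : (Algebra.TensorProduct.assoc R R R A A A).toAlgHom.comp
      ((Algebra.TensorProduct.map Δ (.id R A)).comp Δ) =
    (Algebra.TensorProduct.map (.id R A) Δ).comp Δ
  counit_left : (Algebra.TensorProduct.map ε (.id R A)).comp Δ =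
    (Algebra.TensorProduct.lid R A).symm
  counit_right : (Algebra.TensorProduct.map (.id R A) ε).comp Δ =
    (Algebra.TensorProduct.rid R R A).symm
  antipode_left : LinearMap.mul' R A ∘ₗ s.rTensor A ∘ₗ Δ.toLinearMap =
    Algebra.linearMap R A ∘ₗ ε.toLinearMap
  antipode_right : LinearMap.mul' R A ∘ₗ s.lTensor A ∘ₗ Δ.toLinearMap =
    Algebra.linearMap R A ∘ₗ ε.toLinearMap

/-- The algebra homomorphism `f` is compatible with comultiplications, counits and antipodes. -/
structure IsHopfHom (Δ : A →ₐ[R] A ⊗[R] A) (ε : A →ₐ[R] R) (s : A →ₗ[R] A)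
    (Δ' : B →ₐ[R] B ⊗[R] B) (ε' : B →ₐ[R] R) (s' : B →ₗ[R] B) (f : A →ₐ[R] B) : Prop where
  comul : (Algebra.TensorProduct.map f f).comp Δ = Δ'.comp f
  counit : ε'.comp f = ε
  antipode : f.toLinearMap ∘ₗ s = s' ∘ₗ f.toLinearMap

end Hopf

end LoopTree

end

/-!
The formulas for `Δ` and `η` sum over the cuts of a loop and involve its face loops, so everything
rests on comparing the crossings of a loop with those of the loops that follow parts of it.

*Signs of crossings.* Ambient isotopies are only continuous, so the invariance of the sign of a
crossing is not a matter of derivatives. Near a crossing the difference of the two branches, read in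
an oriented chart and as a function of the two parameters, has an isolated zero, and the tangent
vectors form a negative pair exactly when the local degree of this zero is one. Degree one is
expressed by a continuous logarithm: after division by `z`, the map has one on small circles
(`HasLog`, `IsDegreeOne`, `SameDegree`). It is invariant under homotopies that keep the zero
isolated, hence under ambient isotopies (`IsGeneric.det2_tangent_pos_iff`).

*Face loops.* A face loop of `α` follows `α` along an arc set, up to an isotopy and a monotone
parametrization that collapses the complementary arcs; the relation `Follows` records this. A loop
following a part of `α` has as crossings those crossings of `α` that are double points of this part,
with the same signs, the same order and the same faces. Two loops following the same part differ by
a reparametrization of the circle (`IsCollapse.exists_reparam`), which gives uniqueness. For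
existence it suffices to close up a single arc between the two preimages of a crossing, with a
corner at the crossing (`IsGeneric.arc`), and to split off the chords of a cut one after another
(`exists_isFaceLoop`).

*Comultiplications.* A simple cut of the trunk of a simple cut, or simple cuts of its branches,
amount to a pair of nested simple cuts of the tree; expanding products of sums over subsets
(`prod_sum_subsets`, `sum_antichains_comm`) gives the coassociativity of `∇` (`treeComul_coassoc`).
For any labels `φ` of the classes of pointed loops, the expansion `α ↦ ∑ ε_H T_H` into trees of
faces labeled through `φ` intertwines `Δ` and `∇` (`map_expansion_loopCoproduct`): both sides are
the sum over the pairs of a cut and a simple cut contained in it, because a cut that contains a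
simple cut `c` is a family of cuts of the face loops of `c`. With `φ` the identity the expansion has
a left inverse, which retains the trees with one vertex (`vertexProjection`). Therefore `Δ` is well
defined on isotopy classes (`loopComul_gen`) and inherits coassociativity from `∇`
(`coassoc_of_retract`). With `φ` forgetting the base point the expansion is `η` (`eta_eq`).

*Antipodes.* Both bialgebras are connected with respect to the rank given by the number of crossings
or of edges, so the antipode is found by recursion (`IsConnected.exists_isHopfAlgebra`), and a
morphism of bialgebras respects antipodes, as these are convolution inverses
(`isHopfHom_of_bialgHom`).
-/

noncomputable section

namespace LoopTree

/-! ### Antipodes of connected bialgebras -/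

section Convolution

variable {R : Type*} [CommRing R] {A B : Type*} [CommRing A] [Algebra R A] [CommRing B]
  [Algebra R B]

/-- In the convolution monoid of algebra homomorphisms from a commutative bialgebra to a commutative
algebra, a left inverse of `f` and a right inverse of `f` coincide. -/
theorem eq_of_convolution_inverses {Δ : A →ₐ[R] A ⊗[R] A} {ε : A →ₐ[R] R}
    (coassoc : (Algebra.TensorProduct.assoc R R R A A A).toAlgHom.comp
      ((Algebra.TensorProduct.map Δ (.id R A)).comp Δ) =
      (Algebra.TensorProduct.map (.id R A) Δ).comp Δ)
    (counit_left : (Algebra.TensorProduct.map ε (.id R A)).comp Δ =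
      (Algebra.TensorProduct.lid R A).symm)
    (counit_right : (Algebra.TensorProduct.map (.id R A) ε).comp Δ =
      (Algebra.TensorProduct.rid R R A).symm)
    {f s t : A →ₐ[R] B}
    (hs : (Algebra.TensorProduct.lmul' R).comp ((Algebra.TensorProduct.map s f).comp Δ) =
      (Algebra.ofId R B).comp ε)
    (ht : (Algebra.TensorProduct.lmul' R).comp ((Algebra.TensorProduct.map f t).comp Δ) =
      (Algebra.ofId R B).comp ε) : s = t := by
  let _ : Bialgebra R A := Bialgebra.ofAlgHom Δ ε coassoc counit_left counit_right
  have h1 : WithConv.toConv s * WithConv.toConv f = 1 := congrArg WithConv.toConv hs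
  have h2 : WithConv.toConv f * WithConv.toConv t = 1 := congrArg WithConv.toConv ht
  exact congrArg WithConv.ofConv (left_inv_eq_right_inv h1 h2)

/-- A commutative bialgebra whose identity has a left and a right convolution inverse among the
algebra endomorphisms is a Hopf algebra. -/
theorem isHopfAlgebra_of_convolution_inverses {Δ : A →ₐ[R] A ⊗[R] A} {ε : A →ₐ[R] R}
    (coassoc : (Algebra.TensorProduct.assoc R R R A A A).toAlgHom.comp
      ((Algebra.TensorProduct.map Δ (.id R A)).comp Δ) =
      (Algebra.TensorProduct.map (.id R A) Δ).comp Δ)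
    (counit_left : (Algebra.TensorProduct.map ε (.id R A)).comp Δ =
      (Algebra.TensorProduct.lid R A).symm)
    (counit_right : (Algebra.TensorProduct.map (.id R A) ε).comp Δ =
      (Algebra.TensorProduct.rid R R A).symm)
    {s t : A →ₐ[R] A}
    (hs : (Algebra.TensorProduct.lmul' R).comp ((Algebra.TensorProduct.map s (.id R A)).comp Δ) =
      (Algebra.ofId R A).comp ε)
    (ht : (Algebra.TensorProduct.lmul' R).comp ((Algebra.TensorProduct.map (.id R A) t).comp Δ) =
      (Algebra.ofId R A).comp ε) : IsHopfAlgebra Δ ε s.toLinearMap := by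
  obtain rfl := eq_of_convolution_inverses coassoc counit_left counit_right hs ht
  refine ⟨coassoc, counit_left, counit_right, ?_, ?_⟩
  · exact congrArg AlgHom.toLinearMap hs
  · exact congrArg AlgHom.toLinearMap ht

/-- A bialgebra homomorphism between commutative Hopf algebras respects the antipodes. -/
theorem isHopfHom_of_bialgHom {Δ : A →ₐ[R] A ⊗[R] A} {ε : A →ₐ[R] R} {s : A →ₐ[R] A}
    {Δ' : B →ₐ[R] B ⊗[R] B} {ε' : B →ₐ[R] R} {s' : B →ₐ[R] B} {f : A →ₐ[R] B}
    (hA : IsHopfAlgebra Δ ε s.toLinearMap) (hB : IsHopfAlgebra Δ' ε' s'.toLinearMap)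
    (comul : (Algebra.TensorProduct.map f f).comp Δ = Δ'.comp f) (counit : ε'.comp f = ε) :
    IsHopfHom Δ ε s.toLinearMap Δ' ε' s'.toLinearMap f := by
  refine ⟨comul, counit, ?_⟩
  have hs : (Algebra.TensorProduct.lmul' R).comp ((Algebra.TensorProduct.map s (.id R A)).comp Δ) =
      (Algebra.ofId R A).comp ε := AlgHom.toLinearMap_injective hA.antipode_left
  have ht : (Algebra.TensorProduct.lmul' R).comp
      ((Algebra.TensorProduct.map (.id R B) s').comp Δ') =
      (Algebra.ofId R B).comp ε' := AlgHom.toLinearMap_injective hB.antipode_right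
  -- both are convolution inverses of `f`
  have key : f.comp s = s'.comp f := by
    refine eq_of_convolution_inverses (f := f) hA.coassoc hA.counit_left hA.counit_right ?_ ?_
    · have h1 : (Algebra.TensorProduct.lmul' R).comp (Algebra.TensorProduct.map (f.comp s) f) =
          f.comp ((Algebra.TensorProduct.lmul' R).comp
            (Algebra.TensorProduct.map s (.id R A))) := by
        ext <;> simp
      rw [← AlgHom.comp_assoc, h1, AlgHom.comp_assoc, AlgHom.comp_assoc, hs]
      ext x; simp [Algebra.ofId_apply]
    · have h1 : (Algebra.TensorProduct.lmul' R).comp (Algebra.TensorProduct.map f (s'.comp f)) =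
          ((Algebra.TensorProduct.lmul' R).comp
            (Algebra.TensorProduct.map (.id R B) s')).comp (Algebra.TensorProduct.map f f) := by
        ext <;> simp
      rw [← AlgHom.comp_assoc, h1, AlgHom.comp_assoc, comul, ← AlgHom.comp_assoc,
        AlgHom.comp_assoc _ _ Δ', ht, AlgHom.comp_assoc, counit]
  exact congrArg AlgHom.toLinearMap key

end Convolution

section FreeSym

variable {R : Type*} [CommRing R] {X : Type*} {A : Type*} [CommRing A] [Algebra R A]

theorem freeSym_algHom_ext {f g : FreeSym R X →ₐ[R] A} (h : ∀ x, f (gen R x) = g (gen R x)) :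
    f = g := by
  apply SymmetricAlgebra.algHom_ext
  apply Finsupp.lhom_ext'
  intro x
  ext
  exact h x

@[simp]
theorem extendAlg_gen (φ : X → A) (x : X) : extendAlg R φ (gen R x) = φ x := by
  simp [extendAlg, gen]

@[simp]
theorem augmentation_gen (x : X) : augmentation R X (gen R x) = 0 := by
  exact SymmetricAlgebra.algebraMapInv_ι _

/-- The product of the generators in a multiset. -/
def genProd (R : Type*) [CommRing R] {X : Type*} (m : Multiset X) : FreeSym R X :=
  (m.map (gen R)).prod

theorem algHom_genProd (f : FreeSym R X →ₐ[R] A) (m : Multiset X) :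
    f (genProd R m) = (m.map fun x => f (gen R x)).prod := by
  simp [genProd, map_multiset_prod]

theorem augmentation_genProd {m : Multiset X} (hm : m ≠ 0) :
    augmentation R X (genProd R m) = 0 := by
  obtain ⟨x, hx⟩ := Multiset.exists_mem_of_ne_zero hm
  rw [algHom_genProd]
  exact Multiset.prod_eq_zero (Multiset.mem_map.2 ⟨x, hx, augmentation_gen x⟩)

/-- Functions satisfying a recursion along a rank function exist. -/
theorem exists_recursion {Y : Type*} [Nonempty Y] (d : X → ℕ) (G : (X → Y) → X → Y)
    (hG : ∀ σ τ x, (∀ z, d z < d x → σ z = τ z) → G σ x = G τ x) :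
    ∃ σ : X → Y, ∀ x, σ x = G σ x := by
  obtain ⟨y⟩ := ‹Nonempty Y›
  set F : ℕ → X → Y := fun n => G^[n] fun _ => y with hF
  have hsucc : ∀ n, F (n + 1) = G (F n) := fun n => Function.iterate_succ_apply' G n _
  have key : ∀ k x, d x = k → ∀ n, k < n → F n x = F (k + 1) x := by
    intro k
    induction k using Nat.strong_induction_on with
    | _ k ih =>
      intro x hx n hn
      obtain ⟨n, rfl⟩ := Nat.exists_eq_succ_of_ne_zero (Nat.ne_zero_of_lt hn)
      rw [Nat.succ_eq_add_one, hsucc, hsucc]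
      refine hG _ _ _ fun z hz => ?_
      rw [ih (d z) (hx ▸ hz) z rfl n (by omega), ih (d z) (hx ▸ hz) z rfl k (by omega)]
  refine ⟨fun x => F (d x + 1) x, fun x => ?_⟩
  change F (d x + 1) x = _
  rw [hsucc]
  exact hG _ _ _ fun z hz => key (d z) z rfl _ hz

/-- `Δ` is a connected comultiplication on the free commutative algebra on `X` with respect to the
rank function `d`: on a generator it differs from the primitive comultiplication by terms which
involve generators of lower rank only, and whose left factor has no constant term. -/
def IsConnected (d : X → ℕ) (Δ : FreeSym R X →ₐ[R] FreeSym R X ⊗[R] FreeSym R X) : Prop :=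
  ∀ x, ∃ (ι : Type) (_ : Fintype ι) (c : ι → R) (m : ι → Multiset X) (y : ι → X),
    Δ (gen R x) = gen R x ⊗ₜ[R] 1 + 1 ⊗ₜ[R] gen R x +
      ∑ i, c i • (genProd R (m i) ⊗ₜ[R] gen R (y i)) ∧
    ∀ i, m i ≠ 0 ∧ (∀ z ∈ m i, d z < d x) ∧ d (y i) < d x

variable {d : X → ℕ} {Δ : FreeSym R X →ₐ[R] FreeSym R X ⊗[R] FreeSym R X}

/-- The antipode of a connected comultiplication is constructed by recursion on the rank. -/
theorem IsConnected.exists_isHopfAlgebra (h : IsConnected d Δ)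
    (coassoc : (Algebra.TensorProduct.assoc R R R _ _ _).toAlgHom.comp
      ((Algebra.TensorProduct.map Δ (.id R _)).comp Δ) =
      (Algebra.TensorProduct.map (.id R _) Δ).comp Δ) :
    ∃ s : FreeSym R X →ₐ[R] FreeSym R X,
      IsHopfAlgebra Δ (augmentation R X) s.toLinearMap := by
  choose ι hι c m y hΔ hr using h
  have hl : (Algebra.TensorProduct.map (augmentation R X) (.id R _)).comp Δ =
      (Algebra.TensorProduct.lid R (FreeSym R X)).symm := by
    refine freeSym_algHom_ext fun x => ?_
    simp [hΔ, augmentation_genProd (hr x _).1]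
  have hr' : (Algebra.TensorProduct.map (.id R _) (augmentation R X)).comp Δ =
      (Algebra.TensorProduct.rid R R (FreeSym R X)).symm := by
    refine freeSym_algHom_ext fun x => ?_
    simp [hΔ]
  -- `σ` and `τ` solve the equations of a left and of a right inverse of the identity on generators
  obtain ⟨σ, hσ⟩ := exists_recursion d
    (fun (σ : X → FreeSym R X) x =>
      -gen R x - ∑ i, c x i • (((m x i).map σ).prod * gen R (y x i))) <| by
    intro σ τ x hx
    congr 1
    refine Finset.sum_congr rfl fun i _ => ?_
    rw [Multiset.map_congr rfl fun z hz => hx z ((hr x i).2.1 z hz)]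
  obtain ⟨τ, hτ⟩ := exists_recursion d
    (fun (τ : X → FreeSym R X) x =>
      -gen R x - ∑ i, c x i • (genProd R (m x i) * τ (y x i))) <| by
    intro σ τ x hx
    congr 1
    refine Finset.sum_congr rfl fun i _ => ?_
    rw [hx _ (hr x i).2.2]
  refine ⟨extendAlg R σ, isHopfAlgebra_of_convolution_inverses (t := extendAlg R τ)
    coassoc hl hr' ?_ ?_⟩
  · refine freeSym_algHom_ext fun x => ?_
    simp [hΔ, algHom_genProd, map_sum]
    rw [hσ x]
    ring
  · refine freeSym_algHom_ext fun x => ?_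
    simp [hΔ, map_sum]
    rw [hτ x]
    ring

end FreeSym

/-! ### Positions and the cyclic order of the circle -/

section Circle

theorem pos_nonneg (b x : S1) : 0 ≤ pos b x := (AddCircle.equivIco (1 : ℝ) 0 (x - b)).2.1

theorem pos_lt_one (b x : S1) : pos b x < 1 :=
  (AddCircle.equivIco (1 : ℝ) 0 (x - b)).2.2.trans_eq (zero_add 1)

@[simp]
theorem add_pos_coe (b x : S1) : b + (pos b x : S1) = x := by
  have : ((pos b x : ℝ) : S1) = x - b := AddCircle.coe_equivIco
  rw [this]; abel

theorem pos_add_coe (b : S1) {t : ℝ} (h0 : 0 ≤ t) (h1 : t < 1) : pos b (b + (t : S1)) = t := by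
  rw [pos, add_sub_cancel_left]
  exact AddCircle.equivIco_coe_of_mem (by simpa using ⟨h0, h1⟩)

theorem pos_eq_of_add_eq {b x : S1} {t : ℝ} (h0 : 0 ≤ t) (h1 : t < 1) (h : b + (t : S1) = x) :
    pos b x = t := by rw [← h, pos_add_coe b h0 h1]

@[simp]
theorem pos_self (b : S1) : pos b b = 0 := pos_eq_of_add_eq le_rfl one_pos (by simp)

theorem pos_inj {b x y : S1} : pos b x = pos b y ↔ x = y :=
  ⟨fun h => Crossing.pos_injective b h, fun h => h ▸ rfl⟩

theorem pos_eq_zero_iff {b x : S1} : pos b x = 0 ↔ x = b := by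
  rw [← pos_self b, pos_inj]

theorem pos_pos_iff {b x : S1} : 0 < pos b x ↔ x ≠ b := by
  rw [(pos_nonneg b x).lt_iff_ne', Ne, pos_eq_zero_iff]

theorem pos_rebase_of_le {a b x : S1} (h : pos a b ≤ pos a x) : pos b x = pos a x - pos a b := by
  refine pos_eq_of_add_eq (by linarith) (by linarith [pos_lt_one a x, pos_nonneg a b]) ?_
  conv_lhs => rw [← add_pos_coe a b]
  rw [add_assoc, ← AddCircle.coe_add]
  simp

theorem pos_rebase_of_lt {a b x : S1} (h : pos a x < pos a b) :
    pos b x = pos a x - pos a b + 1 := by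
  refine pos_eq_of_add_eq (by linarith [pos_lt_one a b, pos_nonneg a x]) (by linarith) ?_
  have h1 : ((1 : ℝ) : S1) = 0 := AddCircle.coe_period 1
  have h2 : pos a b + (pos a x - pos a b + 1) = pos a x + 1 := by ring
  nth_rewrite 1 [← add_pos_coe a b]
  rw [add_assoc, ← AddCircle.coe_add, h2, AddCircle.coe_add, h1]
  simp

theorem btw_iff_pos {a b c : S1} : btw a b c ↔ c = a ∨ pos a b ≤ pos a c := by
  obtain ⟨s, hs⟩ : ∃ s : ℝ, (s : S1) = a := QuotientAddGroup.mk_surjective a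
  have hb : ((s + pos a b : ℝ) : S1) = b := by rw [AddCircle.coe_add, hs]; simp
  have hc : ((s + pos a c : ℝ) : S1) = c := by rw [AddCircle.coe_add, hs]; simp
  have key : btw ((s : ℝ) : S1) ((s + pos a b : ℝ) : S1) ((s + pos a c : ℝ) : S1) ↔ _ :=
    QuotientAddGroup.btw_coe_iff
  rw [hs, hb, hc] at key
  rw [key, (toIcoMod_eq_self _).2 ⟨by linarith [pos_nonneg a b], by linarith [pos_lt_one a b]⟩]
  rcases eq_or_ne c a with rfl | hca
  · rw [pos_self, add_zero, toIocMod_apply_left]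
    exact ⟨fun _ => Or.inl rfl, fun _ => by linarith [pos_lt_one c b]⟩
  · have h0 := pos_pos_iff.2 hca
    rw [(toIocMod_eq_self _).2 ⟨by linarith, by linarith [pos_lt_one a c]⟩]
    simp [hca]

theorem sbtw_iff_pos {a b c : S1} : sbtw a b c ↔ b ≠ a ∧ pos a b < pos a c := by
  rw [sbtw_iff_not_btw, btw_cyclic, btw_iff_pos, not_or, not_le]

/-- The cyclic order, read off from the positions with respect to an arbitrary base point. -/
theorem sbtw_iff_pos_base (o : S1) {a b c : S1} : sbtw a b c ↔
    (pos o a < pos o b ∧ pos o b < pos o c) ∨ (pos o b < pos o c ∧ pos o c < pos o a) ∨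
      (pos o c < pos o a ∧ pos o a < pos o b) := by
  rw [sbtw_iff_pos]
  -- the positions with respect to `a` are those with respect to `o`, rotated
  rcases lt_trichotomy (pos o a) (pos o b) with hab | hab | hab
  · have hne : b ≠ a := fun h => by simp [h] at hab
    rw [pos_rebase_of_le hab.le]
    rcases le_or_gt (pos o a) (pos o c) with hac | hac
    · rw [pos_rebase_of_le hac]
      constructor
      · rintro ⟨-, h⟩; left; constructor <;> linarith
      · rintro (h | h | h)
        · exact ⟨hne, by linarith⟩
        · linarith
        · linarith
    · rw [pos_rebase_of_lt hac]
      constructor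
      · intro _; right; right; exact ⟨hac, hab⟩
      · intro _; exact ⟨hne, by linarith [pos_lt_one o b, pos_nonneg o c]⟩
  · have : b = a := (pos_inj.1 hab).symm
    subst this
    simp only [ne_eq, not_true_eq_false, false_and, lt_irrefl, and_false, or_false, false_iff,
      not_and, not_lt, false_or]
    intro h; exact h.le
  · have hne : b ≠ a := fun h => by simp [h] at hab
    rw [pos_rebase_of_lt hab]
    rcases le_or_gt (pos o a) (pos o c) with hac | hac
    · rw [pos_rebase_of_le hac]
      constructor
      · rintro ⟨-, h⟩; linarith [pos_lt_one o c, pos_nonneg o b]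
      · rintro (h | h | h) <;> linarith
    · rw [pos_rebase_of_lt hac]
      constructor
      · rintro ⟨-, h⟩; right; left; exact ⟨by linarith, hac⟩
      · rintro (h | h | h)
        · linarith
        · exact ⟨hne, by linarith⟩
        · linarith

theorem continuousAt_pos {b x : S1} (h : x ≠ b) : ContinuousAt (pos b) x := by
  have h1 : ContinuousAt (AddCircle.equivIco (1 : ℝ) 0) (x - b) :=
    AddCircle.continuousAt_equivIco 1 0 (by simpa [sub_eq_zero] using h)
  exact continuous_subtype_val.continuousAt.comp
    (h1.comp (f := fun y => y - b) (continuous_id.sub continuous_const).continuousAt)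

theorem mem_cIoo_iff_pos {a b x : S1} : x ∈ cIoo a b ↔ x ≠ a ∧ pos a x < pos a b := sbtw_iff_pos

theorem isOpen_cIoo (a b : S1) : IsOpen (cIoo a b) := by
  rw [isOpen_iff_mem_nhds]
  intro x hx
  rw [mem_cIoo_iff_pos] at hx
  filter_upwards [isOpen_ne.mem_nhds hx.1,
    (continuousAt_pos hx.1).eventually_lt continuousAt_const hx.2] with y hy hy'
  exact mem_cIoo_iff_pos.2 ⟨hy, hy'⟩

theorem continuous_add_coe (x : S1) : Continuous fun t : ℝ => x + (t : S1) :=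
  continuous_const.add (AddCircle.continuous_mk' 1)

theorem tendsto_add_coe (x : S1) :
    Filter.Tendsto (fun t : ℝ => x + (t : S1)) (nhds 0) (nhds x) := by
  simpa using (continuous_add_coe x).tendsto 0

/-- Points just after `x` lie between `x` and `y`. -/
theorem eventually_add_mem_cIoo {x y : S1} (h : x ≠ y) :
    ∀ᶠ t : ℝ in nhdsWithin 0 (Ioi 0), x + (t : S1) ∈ cIoo x y := by
  have h0 : 0 < pos x y := pos_pos_iff.2 h.symm
  filter_upwards [Ioo_mem_nhdsGT h0] with t ht
  have := pos_add_coe x ht.1.le (ht.2.trans (pos_lt_one x y))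
  exact mem_cIoo_iff_pos.2 ⟨by rw [← pos_pos_iff, this]; exact ht.1, by rw [this]; exact ht.2⟩

/-- Points just before `x` lie between `y` and `x`. -/
theorem eventually_add_neg_mem_cIoo {x y : S1} (h : x ≠ y) :
    ∀ᶠ t : ℝ in nhdsWithin 0 (Ioi 0), x + ((-t : ℝ) : S1) ∈ cIoo y x := by
  have h0 : 0 < pos y x := pos_pos_iff.2 h
  have h2 : pos y x < 1 := pos_lt_one y x
  filter_upwards [Ioo_mem_nhdsGT h0] with t ht
  have : pos y (x + ((-t : ℝ) : S1)) = pos y x - t := by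
    refine pos_eq_of_add_eq (by linarith [ht.2]) (by linarith [ht.1]) ?_
    rw [sub_eq_add_neg, AddCircle.coe_add, ← add_assoc, add_pos_coe]
  exact mem_cIoo_iff_pos.2 ⟨by rw [← pos_pos_iff, this]; linarith [ht.2],
    by rw [this]; linarith [ht.1]⟩

theorem exists_mem_cIoo_of_mem_nhds {A : Set S1} {x y : S1} (hA : A ∈ nhds x) (h : x ≠ y) :
    ∃ z ∈ cIoo x y, z ∈ A := by
  have h1 := ((tendsto_add_coe x).mono_left (nhdsWithin_le_nhds (s := Ioi 0))).eventually hA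
  obtain ⟨t, ht⟩ := ((eventually_add_mem_cIoo h).and h1).exists
  exact ⟨_, ht⟩

theorem exists_mem_cIoo_of_mem_nhds' {A : Set S1} {x y : S1} (hA : A ∈ nhds x) (h : x ≠ y) :
    ∃ z ∈ cIoo y x, z ∈ A := by
  have h0 : Filter.Tendsto (fun t : ℝ => -t) (nhdsWithin 0 (Ioi 0)) (nhds 0) := by
    have := (continuous_neg (G := ℝ)).tendsto 0
    rw [neg_zero] at this
    exact this.mono_left nhdsWithin_le_nhds
  have h1 := ((tendsto_add_coe x).comp h0).eventually hA
  obtain ⟨t, ht⟩ := ((eventually_add_neg_mem_cIoo h).and h1).exists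
  exact ⟨_, ht⟩

end Circle

/-! ### Collapsing the circle -/

namespace IsCollapse

variable {A B : Set S1} {g g' : S1 → S1}

theorem sbtw_of_sbtw_map (hg : IsCollapse A g) {x y z : S1} (h : sbtw (g x) (g y) (g z)) :
    sbtw x y z := by
  rw [sbtw_iff_not_btw] at h ⊢
  exact fun h' => h (hg.mono _ _ _ h')

theorem sbtw_map (hg : IsCollapse A g) {x y z : S1} (h : sbtw x y z) (h1 : g x ≠ g y)
    (h2 : g y ≠ g z) (h3 : g z ≠ g x) : sbtw (g x) (g y) (g z) := by
  rw [sbtw_iff_not_btw]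
  intro h'
  rcases (hg.mono _ _ _ h.btw).antisymm h' with e | e | e
  exacts [h1 e, h2 e, h3 e]

theorem ne_of_mem_nhds (hg : IsCollapse A g) {x y : S1} (hA : A ∈ nhds x) (h : x ≠ y) :
    g x ≠ g y := by
  intro he
  rcases (hg.fiber x y).1 he with e | e | e
  · exact h e
  · obtain ⟨z, hz, hz'⟩ := exists_mem_cIoo_of_mem_nhds hA h
    exact disjoint_left.1 e hz hz'
  · obtain ⟨z, hz, hz'⟩ := exists_mem_cIoo_of_mem_nhds' hA h
    exact disjoint_left.1 e hz hz'

theorem sbtw_map_iff (hg : IsCollapse A g) {x y z : S1} (hx : A ∈ nhds x) (hz : A ∈ nhds z) :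
    sbtw (g x) (g y) (g z) ↔ sbtw x y z := by
  refine ⟨hg.sbtw_of_sbtw_map, fun h => hg.sbtw_map h ?_ ?_ ?_⟩
  · exact hg.ne_of_mem_nhds hx (fun e => by subst e; exact sbtw_irrefl_left h)
  · exact (hg.ne_of_mem_nhds hz (fun e => by subst e; exact sbtw_irrefl_right h)).symm
  · exact hg.ne_of_mem_nhds hz (fun e => by subst e; exact sbtw_irrefl_left_right h)

/-- Every point of the collapsed circle comes from a point of `A`: if `z ∉ A`, the first point of
`A` after `z` has the same image. -/
theorem exists_mem_eq (hg : IsCollapse A g) (hA : IsClosed A) (hne : A.Nonempty) (y : S1) :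
    ∃ x ∈ A, g x = y := by
  obtain ⟨z, rfl⟩ := hg.surjective y
  by_cases hz : z ∈ A
  · exact ⟨z, hz, rfl⟩
  obtain ⟨x, hx, hmin⟩ := hA.isCompact.exists_isMinOn hne (f := pos z) fun w hw =>
    (continuousAt_pos (ne_of_mem_of_not_mem hw hz)).continuousWithinAt
  refine ⟨x, hx, ((hg.fiber z x).2 (Or.inr (Or.inl ?_))).symm⟩
  rw [disjoint_left]
  intro w hw hwA
  exact absurd (mem_cIoo_iff_pos.1 hw).2 (not_lt.2 (hmin hwA))

/-- Two collapses along the same set differ by a reparametrization. -/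
theorem exists_reparam (hg : IsCollapse A g) (hg' : IsCollapse A g') :
    ∃ f : Reparam, ∀ x, f.homeo (g' x) = g x := by
  have hff : ∀ x y, g' x = g' y ↔ g x = g y := fun x y => by rw [hg.fiber, hg'.fiber]
  set s := Function.surjInv hg'.surjective with hs
  have hs' : ∀ y, g' (s y) = y := Function.surjInv_eq hg'.surjective
  have hcomp : ∀ x, g (s (g' x)) = g x := fun x => (hff _ _).1 (hs' _)
  have hbij : Function.Bijective fun y => g (s y) := by
    constructor
    · intro y z h
      have := (hff _ _).2 h
      rwa [hs', hs'] at this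
    · intro y
      obtain ⟨x, rfl⟩ := hg.surjective y
      exact ⟨g' x, hcomp x⟩
  -- `g'` is a quotient map, hence `g` factors continuously through it
  have hq : Topology.IsQuotientMap g' :=
    hg'.continuous.isClosedMap.isQuotientMap hg'.continuous hg'.surjective
  have hcont : Continuous fun y => g (s y) := by
    rw [hq.continuous_iff]
    convert hg.continuous using 1
    exact funext hcomp
  refine ⟨⟨Continuous.homeoOfEquivCompactToT2 (f := Equiv.ofBijective _ hbij) hcont, ?_⟩, hcomp⟩
  intro x y z h
  change sbtw (g (s x)) (g (s y)) (g (s z))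
  have h' : sbtw (s x) (s y) (s z) := by
    apply hg'.sbtw_of_sbtw_map; rwa [hs', hs', hs']
  refine hg.sbtw_map h' (hbij.1.ne ?_) (hbij.1.ne ?_) (hbij.1.ne ?_)
  · rintro rfl; exact sbtw_irrefl_left h
  · rintro rfl; exact sbtw_irrefl_right h
  · rintro rfl; exact sbtw_irrefl_left_right h

/-- Collapses can be composed, provided that the points to which gaps are collapsed first are not
end points of the gaps which are collapsed later. -/
theorem comp (hg : IsCollapse A g) (hg' : IsCollapse B g') (hA : ∀ y, ∃ x ∈ A, g x = y)
    (hB : ∀ x x', x ≠ x' → g x = g x' → g x ∈ B → B ∈ nhds (g x)) :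
    IsCollapse (A ∩ g ⁻¹' B) (g' ∘ g) where
  continuous := hg'.continuous.comp hg.continuous
  surjective := hg'.surjective.comp hg.surjective
  mono x y z h := hg'.mono _ _ _ (hg.mono _ _ _ h)
  fiber := by
    have key : ∀ x y, g x ≠ g y →
        (Disjoint (cIoo (g x) (g y)) B ↔ Disjoint (cIoo x y) (A ∩ g ⁻¹' B)) := by
      intro x y hxy
      constructor
      · intro h
        rw [disjoint_left]
        rintro z hz ⟨hzA, hzB⟩
        -- if `z` is collapsed to an end of the arc, a nearby point of `B` lies inside the arc
        by_cases h1 : g x = g z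
        · have hB' : B ∈ nhds (g x) :=
            hB x z (fun e => by subst e; exact sbtw_irrefl_left (mem_cIoo.1 hz)) h1 (h1 ▸ hzB)
          obtain ⟨w, hw, hw'⟩ := exists_mem_cIoo_of_mem_nhds hB' hxy
          exact disjoint_left.1 h hw hw'
        by_cases h2 : g y = g z
        · have hB' : B ∈ nhds (g y) :=
            hB y z (fun e => by subst e; exact sbtw_irrefl_right (mem_cIoo.1 hz)) h2 (h2 ▸ hzB)
          obtain ⟨w, hw, hw'⟩ := exists_mem_cIoo_of_mem_nhds' hB' hxy.symm
          exact disjoint_left.1 h hw hw'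
        exact disjoint_left.1 h (hg.sbtw_map hz h1 (Ne.symm h2) (Ne.symm hxy)) hzB
      · intro h
        rw [disjoint_left]
        intro w hw hwB
        obtain ⟨z, hz, rfl⟩ := hA w
        exact disjoint_left.1 h (hg.sbtw_of_sbtw_map hw) ⟨hz, hwB⟩
    intro x y
    by_cases hxy : g x = g y
    · simp only [Function.comp_apply, hxy, true_iff]
      rcases (hg.fiber x y).1 hxy with h | h | h
      · exact Or.inl h
      · exact Or.inr (Or.inl (h.mono_right inter_subset_left))
      · exact Or.inr (Or.inr (h.mono_right inter_subset_left))
    · rw [Function.comp_apply, Function.comp_apply, hg'.fiber, key x y hxy, key y x (Ne.symm hxy)]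
      have : x ≠ y := fun e => hxy (e ▸ rfl)
      simp [hxy, this]

/-- A reparametrization collapses nothing. -/
theorem of_reparam (f : Reparam) : IsCollapse univ f.homeo where
  continuous := f.homeo.continuous
  surjective := f.homeo.surjective
  mono x y z h := by
    rw [← not_not (a := btw _ _ _), ← sbtw_iff_not_btw]
    intro h'
    have := f.symm.mono _ _ _ h'
    simp only [Reparam.symm, Homeomorph.symm_apply_apply] at this
    exact (sbtw_iff_not_btw.1 this) h
  fiber x y := by
    constructor
    · intro h; exact Or.inl (f.homeo.injective h)
    · rintro (h | h | h)
      · rw [h]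
      · by_contra hne
        obtain ⟨z, hz, -⟩ := exists_mem_cIoo_of_mem_nhds (A := univ) Filter.univ_mem
          (fun e : x = y => hne (e ▸ rfl))
        exact disjoint_left.1 h hz trivial
      · by_contra hne
        obtain ⟨z, hz, -⟩ := exists_mem_cIoo_of_mem_nhds (A := univ) Filter.univ_mem
          (fun e : y = x => hne (e ▸ rfl))
        exact disjoint_left.1 h hz trivial

end IsCollapse

/-! ### Maps of degree one from the circle to the punctured plane -/

section Degree

open Complex ComplexConjugate

/-- `F : S¹ → ℂ` has a continuous logarithm. -/
def HasLog (F : Circle → ℂ) : Prop := ∃ g : C(Circle, ℂ), ∀ z, F z = exp (g z)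

theorem continuous_circle_coe : Continuous fun z : Circle => (z : ℂ) := by fun_prop

theorem HasLog.of_homotopy {H : unitInterval × Circle → ℂ} (hc : Continuous H)
    (h0 : ∀ q, H q ≠ 0) (h : HasLog fun z => H (0, z)) : HasLog fun z => H (1, z) := by
  obtain ⟨g, hg⟩ := h
  let K : C(unitInterval × Circle, {z : ℂ // z ≠ 0}) := ⟨fun q => ⟨H q, h0 q⟩, hc.subtype_mk _⟩
  have hK : ∀ z, K (0, z) = (⟨_, (g z).exp_ne_zero⟩ : {z : ℂ // z ≠ 0}) :=
    fun z => Subtype.ext (hg z)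
  let L := isCoveringMap_exp.liftHomotopy K g hK
  refine ⟨L.comp ((ContinuousMap.const _ 1).prodMk (ContinuousMap.id _)), fun z => ?_⟩
  have := congrFun (isCoveringMap_exp.liftHomotopy_lifts K g hK) (1, z)
  exact (congrArg Subtype.val this).symm

theorem hasLog_iff_of_homotopy {H : unitInterval × Circle → ℂ} (hc : Continuous H)
    (h0 : ∀ q, H q ≠ 0) : (HasLog fun z => H (0, z)) ↔ HasLog fun z => H (1, z) := by
  refine ⟨HasLog.of_homotopy hc h0, fun h => ?_⟩
  have := HasLog.of_homotopy (H := fun q => H (unitInterval.symm q.1, q.2))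
    (hc.comp ((unitInterval.continuous_symm.comp continuous_fst).prodMk continuous_snd))
    (fun q => h0 _) (by simpa using h)
  simpa using this

theorem hasLog_const {a : ℂ} (ha : a ≠ 0) : HasLog fun _ => a :=
  ⟨ContinuousMap.const _ (log a), fun _ => by simp [exp_log ha]⟩

theorem hasLog_const_mul {a : ℂ} (ha : a ≠ 0) {F : Circle → ℂ} :
    (HasLog fun z => a * F z) ↔ HasLog F := by
  constructor
  · rintro ⟨g, hg⟩
    refine ⟨g - ContinuousMap.const _ (log a), fun z => ?_⟩
    simp [exp_sub, exp_log ha, ← hg z, ha]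
  · rintro ⟨g, hg⟩
    refine ⟨g + ContinuousMap.const _ (log a), fun z => ?_⟩
    simp [exp_add, exp_log ha, hg z, mul_comm]

/-- The map `z ↦ z⁻²` has no continuous logarithm on the circle. -/
theorem not_hasLog_conj_mul_conj : ¬ HasLog fun z => conj (z : ℂ) * conj (z : ℂ) := by
  rintro ⟨g, hg⟩
  let e : ℝ → Circle := Circle.exp
  let g₁ : ℝ → ℂ := fun t => g (e t)
  let g₂ : ℝ → ℂ := fun t => g (e 0) - 2 * t * I
  have h1 : Continuous g₁ := g.continuous.comp Circle.exp.continuous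
  have h2 : Continuous g₂ := by fun_prop
  have hexp : ∀ t : ℝ, exp (g (e t)) = exp (-(2 * t * I)) := by
    intro t
    rw [← hg]
    change conj ((Circle.exp t : Circle) : ℂ) * conj ((Circle.exp t : Circle) : ℂ) = _
    rw [Circle.coe_exp, ← exp_conj, ← exp_add]
    congr 1
    simp
    ring
  have h12 : (fun z : ℂ ↦ (⟨_, z.exp_ne_zero⟩ : {z : ℂ // z ≠ 0})) ∘ g₁ =
      (fun z : ℂ ↦ (⟨_, z.exp_ne_zero⟩ : {z : ℂ // z ≠ 0})) ∘ g₂ := by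
    funext t
    apply Subtype.ext
    simp only [Function.comp_apply, g₁, g₂]
    rw [sub_eq_add_neg, exp_add, hexp t, hexp 0]
    simp
  -- two lifts along `exp` that agree at `0` agree everywhere; compare the values at `0` and `2π`
  have := congrFun (isCoveringMap_exp.eq_of_comp_eq h1 h2 h12 0 (by simp [g₁, g₂])) (2 * Real.pi)
  have h3 : e (2 * Real.pi) = e 0 := by simp [e]
  simp only [g₁, g₂, h3, left_eq_add, sub_eq_add_neg, neg_eq_zero, mul_eq_zero] at this
  have hpi := Real.pi_ne_zero
  simp [I_ne_zero, hpi] at this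

/-- A nowhere vanishing map from the circle to `ℂ` has degree one if its quotient by the inclusion
has a continuous logarithm. -/
def IsDegreeOne (F : Circle → ℂ) : Prop := HasLog fun z => F z * conj (z : ℂ)

theorem conj_circle_ne_zero (z : Circle) : conj (z : ℂ) ≠ 0 := by simp

theorem isDegreeOne_iff_of_homotopy {H : unitInterval × Circle → ℂ} (hc : Continuous H)
    (h0 : ∀ q, H q ≠ 0) :
    (IsDegreeOne fun z => H (0, z)) ↔ IsDegreeOne fun z => H (1, z) :=
  hasLog_iff_of_homotopy (H := fun q => H q * conj (q.2 : ℂ))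
    (hc.mul (continuous_conj.comp (continuous_circle_coe.comp continuous_snd)))
    (fun q => mul_ne_zero (h0 q) (conj_circle_ne_zero _))

theorem norm_mul_conj_lt_norm_mul {a b w : ℂ} {t : unitInterval} (hab : ‖b‖ < ‖a‖)
    (hw : w ≠ 0) : ‖(t : ℝ) * (b * conj w)‖ < ‖a * w‖ := by
  have hw' := norm_pos_iff.2 hw
  rw [norm_mul, norm_mul, norm_mul, norm_conj, norm_real, Real.norm_of_nonneg t.2.1]
  calc (t : ℝ) * (‖b‖ * ‖w‖) ≤ 1 * (‖b‖ * ‖w‖) := by gcongr; exact t.2.2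
    _ < ‖a‖ * ‖w‖ := by rw [one_mul]; gcongr

/-- Composition with an orientation preserving linear automorphism of the plane, written as
`w ↦ a w + b w̄` with `|b| < |a|`, does not affect the degree. -/
theorem isDegreeOne_linear_comp_iff {a b : ℂ} (hab : ‖b‖ < ‖a‖) {F : Circle → ℂ}
    (hF : Continuous F) (h0 : ∀ z, F z ≠ 0) :
    (IsDegreeOne fun z => a * F z + b * conj (F z)) ↔ IsDegreeOne F := by
  have ha : a ≠ 0 := norm_pos_iff.1 ((norm_nonneg b).trans_lt hab)
  have h := isDegreeOne_iff_of_homotopy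
    (H := fun q : unitInterval × Circle => a * F q.2 + ((q.1 : ℝ) : ℂ) * (b * conj (F q.2)))
    (by
      have h1 : Continuous fun q : unitInterval × Circle => F q.2 := hF.comp continuous_snd
      have h2 : Continuous fun q : unitInterval × Circle => ((q.1 : ℝ) : ℂ) :=
        continuous_ofReal.comp (continuous_subtype_val.comp continuous_fst)
      exact (continuous_const.mul h1).add
        (h2.mul (continuous_const.mul (continuous_conj.comp h1))))
    (fun q hq => by
      have := norm_mul_conj_lt_norm_mul (t := q.1) hab (h0 q.2)
      rw [eq_neg_of_add_eq_zero_left hq, norm_neg] at this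
      exact lt_irrefl _ this)
  simp only [Icc.coe_zero, Icc.coe_one, ofReal_zero, ofReal_one, zero_mul,
    one_mul, add_zero] at h
  rw [← h]
  simp only [IsDegreeOne, mul_assoc]
  exact hasLog_const_mul ha

theorem isDegreeOne_coe : IsDegreeOne fun z => (z : ℂ) := by
  have : (fun z : Circle => (z : ℂ) * conj (z : ℂ)) = fun _ => (1 : ℂ) := by
    funext z; rw [mul_conj]; simp
  rw [IsDegreeOne, this]
  exact hasLog_const one_ne_zero

/-- The restriction to the circle of a linear automorphism of the plane has degree one if and only
if the automorphism preserves the orientation. -/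
theorem isDegreeOne_linear_iff {a b : ℂ} (hab : ‖a‖ ≠ ‖b‖) :
    (IsDegreeOne fun z => a * z + b * conj (z : ℂ)) ↔ ‖b‖ < ‖a‖ := by
  rcases lt_or_gt_of_ne hab with h | h
  · refine iff_of_false (fun h1 => ?_) (not_lt.2 h.le)
    have hb : b ≠ 0 := norm_pos_iff.1 ((norm_nonneg a).trans_lt h)
    -- shrink `a` to zero; the end of the homotopy `b z̄` does not have degree one
    have h2 := isDegreeOne_iff_of_homotopy
      (H := fun q : unitInterval × Circle =>
        b * conj (q.2 : ℂ) + ((q.1 : ℝ) : ℂ) * (a * conj (conj (q.2 : ℂ))))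
      (by
        have h1 : Continuous fun q : unitInterval × Circle => (q.2 : ℂ) :=
          continuous_circle_coe.comp continuous_snd
        have h2 : Continuous fun q : unitInterval × Circle => ((q.1 : ℝ) : ℂ) :=
          continuous_ofReal.comp (continuous_subtype_val.comp continuous_fst)
        have h3 := continuous_conj.comp h1
        exact (continuous_const.mul h3).add
          (h2.mul (continuous_const.mul (continuous_conj.comp h3))))
      (fun q hq => by
        have := norm_mul_conj_lt_norm_mul (t := q.1) h (conj_circle_ne_zero q.2)
        rw [eq_neg_of_add_eq_zero_left hq, norm_neg] at this
        exact lt_irrefl _ this)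
    simp only [Icc.coe_zero, Icc.coe_one, ofReal_zero, ofReal_one, zero_mul,
      one_mul, zero_add, conj_conj, add_comm (b * _)] at h2
    have h3 := h2.2 h1
    simp only [IsDegreeOne, mul_assoc] at h3
    exact not_hasLog_conj_mul_conj ((hasLog_const_mul hb).1 h3)
  · refine iff_of_true ?_ h
    exact (isDegreeOne_linear_comp_iff h continuous_circle_coe fun z => by simp).2 isDegreeOne_coe

/-! ### Germs of maps with an isolated zero -/

/-- The restriction of `F : ℝ² → ℂ` to the circle of radius `r` around the origin. -/
def onCircle (F : ℝ × ℝ → ℂ) (r : ℝ) (z : Circle) : ℂ := F (r * (z : ℂ).re, r * (z : ℂ).im)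

/-- `F` and `G` have the same degree on small circles around the origin, as far as degree one is
concerned. -/
def SameDegree (F G : ℝ × ℝ → ℂ) : Prop :=
  ∀ᶠ r in nhdsWithin (0 : ℝ) (Ioi 0), IsDegreeOne (onCircle F r) ↔ IsDegreeOne (onCircle G r)

theorem SameDegree.symm {F G : ℝ × ℝ → ℂ} (h : SameDegree F G) : SameDegree G F :=
  h.mono fun _ h => h.symm

theorem SameDegree.trans {F G K : ℝ × ℝ → ℂ} (h : SameDegree F G) (h' : SameDegree G K) :
    SameDegree F K := by
  filter_upwards [h, h'] with r h h' using h.trans h'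

theorem eventually_onCircle {p : ℝ × ℝ → Prop} (h : ∀ᶠ q in nhds (0 : ℝ × ℝ), p q) :
    ∀ᶠ r in nhdsWithin (0 : ℝ) (Ioi 0), ∀ z : Circle,
      p (r * (z : ℂ).re, r * (z : ℂ).im) ∧
        (r * (z : ℂ).re, r * (z : ℂ).im) ≠ (0 : ℝ × ℝ) := by
  obtain ⟨δ, hδ, h⟩ := Metric.eventually_nhds_iff.1 h
  filter_upwards [Ioo_mem_nhdsGT hδ] with r hr z
  have hz : ‖(z : ℂ)‖ = 1 := Circle.norm_coe z
  refine ⟨h ?_, fun h0 => ?_⟩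
  · rw [dist_zero_right, Prod.norm_def, max_lt_iff]
    simp only [norm_mul, Real.norm_eq_abs, abs_of_pos hr.1]
    have h1 := abs_re_le_norm (z : ℂ)
    have h2 := abs_im_le_norm (z : ℂ)
    rw [hz] at h1 h2
    constructor <;> nlinarith [hr.1, hr.2]
  · have h1 := congrArg Prod.fst h0
    have h2 := congrArg Prod.snd h0
    simp only [Prod.fst_zero, Prod.snd_zero, mul_eq_zero, hr.1.ne', false_or] at h1 h2
    have : (z : ℂ) = 0 := Complex.ext h1 h2
    simp at this

theorem sameDegree_of_homotopy {H : unitInterval × (ℝ × ℝ) → ℂ}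
    (h : ∀ᶠ q in nhds (0 : ℝ × ℝ), ∀ t, ContinuousAt H (t, q) ∧ (q ≠ 0 → H (t, q) ≠ 0)) :
    SameDegree (fun q => H (0, q)) fun q => H (1, q) := by
  filter_upwards [eventually_onCircle h] with r hr
  refine isDegreeOne_iff_of_homotopy
    (H := fun q => H (q.1, (r * (q.2 : ℂ).re, r * (q.2 : ℂ).im))) ?_ fun q => ?_
  · rw [continuous_iff_continuousAt]
    intro q
    refine ContinuousAt.comp (g := H)
      (f := fun q : unitInterval × Circle => (q.1, (r * (q.2 : ℂ).re, r * (q.2 : ℂ).im)))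
      ((hr q.2).1 q.1).1 ?_
    have h1 : Continuous fun q : unitInterval × Circle => (q.2 : ℂ) :=
      continuous_circle_coe.comp continuous_snd
    exact (continuous_fst.prodMk ((continuous_const.mul (continuous_re.comp h1)).prodMk
      (continuous_const.mul (continuous_im.comp h1)))).continuousAt
  · exact ((hr q.2).1 q.1).2 (hr q.2).2

/-- The straight line homotopy. -/
theorem sameDegree_of_norm_sub_lt {F G : ℝ × ℝ → ℂ}
    (hF : ∀ᶠ q in nhds (0 : ℝ × ℝ), ContinuousAt F q)
    (hG : ∀ᶠ q in nhds (0 : ℝ × ℝ), ContinuousAt G q)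
    (h : ∀ᶠ q in nhds (0 : ℝ × ℝ), q ≠ 0 → ‖F q - G q‖ < ‖G q‖) : SameDegree F G := by
  have := sameDegree_of_homotopy
    (H := fun p => G p.2 + ((1 - (p.1 : ℝ) : ℝ) : ℂ) * (F p.2 - G p.2)) <| by
    filter_upwards [hF, hG, h] with q hF hG h t
    constructor
    · have h1 : ContinuousAt (fun p : unitInterval × (ℝ × ℝ) => F p.2) (t, q) :=
        ContinuousAt.comp (g := F) (f := Prod.snd) hF continuousAt_snd
      have h2 : ContinuousAt (fun p : unitInterval × (ℝ × ℝ) => G p.2) (t, q) :=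
        ContinuousAt.comp (g := G) (f := Prod.snd) hG continuousAt_snd
      have h3 : Continuous fun p : unitInterval × (ℝ × ℝ) => ((1 - (p.1 : ℝ) : ℝ) : ℂ) := by
        fun_prop
      exact h2.add (h3.continuousAt.mul (h1.sub h2))
    · intro hq hz
      have h1 := h hq
      have h3 : ‖G q‖ = ‖1 - (t : ℝ)‖ * ‖F q - G q‖ := by
        rw [← norm_real, ← norm_mul, ← norm_neg (_ * _), ← eq_neg_of_add_eq_zero_left hz]
      have h2 : ‖1 - (t : ℝ)‖ ≤ 1 := by
        rw [Real.norm_eq_abs, abs_le]; constructor <;> linarith [t.2.1, t.2.2]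
      nlinarith [norm_nonneg (F q - G q)]
  simpa using this

end Degree

/-! ### Local intersection numbers of curves on a surface -/

section Plane

open Complex ComplexConjugate

/-- The identification of the Euclidean plane with `ℂ`. -/
def toComplex : EuclideanSpace ℝ (Fin 2) ≃ₗᵢ[ℝ] ℂ := orthonormalBasisOneI.repr.symm

theorem toComplex_apply (v : EuclideanSpace ℝ (Fin 2)) : toComplex v = v 0 + v 1 * I :=
  orthonormalBasisOneI_repr_symm_apply v

/-- In complex notation a linear endomorphism of the plane has the form `w ↦ a w + b w̄`, and its
determinant is `|a|² - |b|²`. -/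
theorem exists_toComplex_linear (D : EuclideanSpace ℝ (Fin 2) →L[ℝ] EuclideanSpace ℝ (Fin 2)) :
    ∃ a b : ℂ, (∀ v, toComplex (D v) = a * toComplex v + b * conj (toComplex v)) ∧
      ‖a‖ ^ 2 - ‖b‖ ^ 2 = D.det := by
  set B := EuclideanSpace.basisFun (Fin 2) ℝ with hB
  set p := D (B 0) 0
  set q := D (B 1) 0
  set r := D (B 0) 1
  set s := D (B 1) 1
  -- `a` and `b` are the complex linear and the antilinear part
  refine ⟨⟨(p + s) / 2, (r - q) / 2⟩, ⟨(p - s) / 2, (r + q) / 2⟩, fun v => ?_, ?_⟩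
  · have hv : v = v 0 • B 0 + v 1 • B 1 := by
      ext i; fin_cases i <;> simp [hB]
    have h0 : D v 0 = v 0 * p + v 1 * q := by
      conv_lhs => rw [hv]
      simp [p, q]
    have h1 : D v 1 = v 0 * r + v 1 * s := by
      conv_lhs => rw [hv]
      simp [r, s]
    rw [toComplex_apply, toComplex_apply, h0, h1]
    apply Complex.ext
    · simp; ring
    · simp; ring
  · rw [← normSq_eq_norm_sq, ← normSq_eq_norm_sq, normSq_mk, normSq_mk,
      ContinuousLinearMap.det, ← LinearMap.det_toMatrix B.toBasis, Matrix.det_fin_two]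
    simp only [LinearMap.toMatrix_apply, OrthonormalBasis.coe_toBasis,
      OrthonormalBasis.coe_toBasis_repr_apply, ContinuousLinearMap.coe_coe, hB,
      EuclideanSpace.basisFun_repr]
    ring

end Plane

/-- A map which is differentiable within a convex set near a point, with continuous derivative, is
strictly differentiable within this set. -/
theorem ContDiffWithinAt.eventually_norm_sub_sub_le {E F : Type*} [NormedAddCommGroup E]
    [NormedSpace ℝ E] [NormedAddCommGroup F] [NormedSpace ℝ F] {f : E → F} {s : Set E} {x : E}
    (hf : ContDiffWithinAt ℝ ∞ f s x) (hs : Convex ℝ s) (hu : UniqueDiffOn ℝ s) (hx : x ∈ s)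
    {ε : ℝ} (hε : 0 < ε) : ∃ t ∈ nhdsWithin x s, ∀ y ∈ t, ∀ z ∈ t,
      ‖f y - f z - fderivWithin ℝ f s x (y - z)‖ ≤ ε * ‖y - z‖ := by
  have h1 : ∀ᶠ y in nhdsWithin x s, DifferentiableWithinAt ℝ f s y := by
    obtain ⟨u, hu, h⟩ := (hf.of_le (show ((1 : ℕ) : WithTop ℕ∞) ≤ ∞ from by
      exact_mod_cast le_top)).contDiffOn le_rfl (by simp)
    rw [insert_eq_of_mem hx] at hu h
    filter_upwards [eventually_eventually_nhdsWithin.2 hu, self_mem_nhdsWithin] with y hy hys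
    exact ((h.2.differentiableOn (by simp)) y (mem_of_mem_nhdsWithin hys hy)).mono_of_mem_nhdsWithin
      hy
  have h2 : ContinuousWithinAt (fderivWithin ℝ f s) s x :=
    (hf.fderivWithin_right hu (m := 0) (by simp) hx).continuousWithinAt
  obtain ⟨t, ht, hL⟩ := hs.exists_nhdsWithin_lipschitzOnWith_of_hasFDerivWithinAt_of_nnnorm_lt
    (f := fun y => f y - fderivWithin ℝ f s x y)
    (f' := fun y => fderivWithin ℝ f s y - fderivWithin ℝ f s x)
    (h1.mono fun y hy => hy.hasFDerivWithinAt.sub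
      (fderivWithin ℝ f s x).hasFDerivWithinAt) (h2.sub continuousWithinAt_const)
    ⟨ε, hε.le⟩ (by rw [sub_self, nnnorm_zero]; exact hε)
  refine ⟨t, ht, fun y hy z hz => ?_⟩
  have := hL.dist_le_mul y hy z hz
  rw [dist_eq_norm, dist_eq_norm] at this
  rw [map_sub, sub_sub_sub_comm]
  exact this

section Separation

variable {M : Type*} [TopologicalSpace M]

/-- The curves `a` and `b` meet at time `(0, 0)`, and not at other times close to it. -/
structure MeetOnce (a b : ℝ → M) : Prop where
  continuous_left : ∀ᶠ s in nhds (0 : ℝ), ContinuousAt a s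
  continuous_right : ∀ᶠ s in nhds (0 : ℝ), ContinuousAt b s
  eq : a 0 = b 0
  ne : ∀ᶠ q in nhds (0 : ℝ × ℝ), q ≠ 0 → a q.1 ≠ b q.2

/-- The difference vector of two curves in a chart. Its degree around the origin is the negative of
the local intersection number of the two curves. -/
def separation (e : OpenPartialHomeomorph M (EuclideanHalfSpace 2)) (a b : ℝ → M)
    (q : ℝ × ℝ) : ℂ :=
  toComplex (e.extend (𝓡∂ 2) (a q.1) - e.extend (𝓡∂ 2) (b q.2))

variable {e e' : OpenPartialHomeomorph M (EuclideanHalfSpace 2)} {a b : ℝ → M}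

theorem tendsto_fst_zero : Filter.Tendsto (Prod.fst : ℝ × ℝ → ℝ) (nhds 0) (nhds 0) :=
  continuous_fst.tendsto 0

theorem tendsto_snd_zero : Filter.Tendsto (Prod.snd : ℝ × ℝ → ℝ) (nhds 0) (nhds 0) :=
  continuous_snd.tendsto 0

theorem MeetOnce.eventually_mem (h : MeetOnce a b) (he : a 0 ∈ e.source) :
    ∀ᶠ q in nhds (0 : ℝ × ℝ), a q.1 ∈ e.source ∧ b q.2 ∈ e.source := by
  have h1 : ∀ᶠ s in nhds (0 : ℝ), a s ∈ e.source :=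
    h.continuous_left.self_of_nhds (e.open_source.mem_nhds he)
  have h2 : ∀ᶠ s in nhds (0 : ℝ), b s ∈ e.source :=
    h.continuous_right.self_of_nhds (e.open_source.mem_nhds (h.eq ▸ he))
  exact (tendsto_fst_zero.eventually h1).and (tendsto_snd_zero.eventually h2)

theorem MeetOnce.eventually_continuousAt (h : MeetOnce a b) (he : a 0 ∈ e.source) :
    ∀ᶠ q in nhds (0 : ℝ × ℝ), ContinuousAt (separation e a b) q := by
  filter_upwards [h.eventually_mem he, tendsto_fst_zero.eventually h.continuous_left,
    tendsto_snd_zero.eventually h.continuous_right] with q hq h1 h2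
  have h3 : ContinuousAt (fun q : ℝ × ℝ => a q.1) q :=
    ContinuousAt.comp (g := a) (f := Prod.fst) h1 continuousAt_fst
  have h4 : ContinuousAt (fun q : ℝ × ℝ => b q.2) q :=
    ContinuousAt.comp (g := b) (f := Prod.snd) h2 continuousAt_snd
  exact toComplex.continuous.continuousAt.comp
    ((ContinuousAt.comp (g := e.extend (𝓡∂ 2)) (f := fun q : ℝ × ℝ => a q.1)
      (e.continuousAt_extend hq.1) h3).sub
      (ContinuousAt.comp (g := e.extend (𝓡∂ 2)) (f := fun q : ℝ × ℝ => b q.2)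
        (e.continuousAt_extend hq.2) h4))

theorem separation_ne_zero {q : ℝ × ℝ} (h1 : a q.1 ∈ e.source) (h2 : b q.2 ∈ e.source)
    (h : a q.1 ≠ b q.2) : separation e a b q ≠ 0 := by
  rw [separation, Ne, LinearIsometryEquiv.map_eq_zero_iff, sub_eq_zero]
  exact fun h3 => h ((e.extend (𝓡∂ 2)).injOn (by rwa [e.extend_source])
    (by rwa [e.extend_source]) h3)

variable [ChartedSpace (EuclideanHalfSpace 2) M]

/-- The local degree does not depend on the chart: a change of charts is strictly differentiable
with orientation preserving derivative. -/
theorem MeetOnce.sameDegree_of_charts [OrientedSurface M] (h : MeetOnce a b)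
    (hea : e ∈ atlas (EuclideanHalfSpace 2) M) (hea' : e' ∈ atlas (EuclideanHalfSpace 2) M)
    (he : a 0 ∈ e.source) (he' : a 0 ∈ e'.source) :
    SameDegree (separation e' a b) (separation e a b) := by
  set τ := e'.extend (𝓡∂ 2) ∘ (e.extend (𝓡∂ 2)).symm with hτ
  set x := e.extend (𝓡∂ 2) (a 0) with hx
  set D := fderivWithin ℝ τ (range (𝓡∂ 2)) x with hD
  have hdet : 0 < D.det := OrientedSurface.jacobian_pos e hea e' hea' (a 0) ⟨he, he'⟩
  obtain ⟨A, B, hAB, hAB'⟩ := exists_toComplex_linear D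
  have hlt : ‖B‖ < ‖A‖ := by
    refine lt_of_pow_lt_pow_left₀ 2 (norm_nonneg _) ?_
    linarith
  have hsmooth : ContDiffWithinAt ℝ ∞ τ (range (𝓡∂ 2)) x :=
    ModelWithCorners.contDiffWithinAt_extendCoordChange' (I := 𝓡∂ 2)
      (IsManifold.subset_maximalAtlas hea) (IsManifold.subset_maximalAtlas hea') he he'
  -- the error has to stay below the lower bound `(|A| - |B|)|u|` for the linear part
  have hε : 0 < (‖A‖ - ‖B‖) / 2 := by linarith
  obtain ⟨t, ht, hstrict⟩ := ContDiffWithinAt.eventually_norm_sub_sub_le hsmooth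
    (𝓡∂ 2).convex_range (𝓡∂ 2).uniqueDiffOn (mem_range_self _) hε
  have hmem : ∀ {c : ℝ → M}, ContinuousAt c 0 → c 0 = a 0 →
      ∀ᶠ s in nhds (0 : ℝ), e.extend (𝓡∂ 2) (c s) ∈ t := by
    intro c hc h0
    have h1 : Filter.Tendsto (fun s => e.extend (𝓡∂ 2) (c s)) (nhds 0)
        (nhdsWithin x (range (𝓡∂ 2))) := by
      refine tendsto_nhdsWithin_iff.2 ⟨?_, Filter.Eventually.of_forall fun s => mem_range_self _⟩
      have h2 : ContinuousAt (fun s => e.extend (𝓡∂ 2) (c s)) 0 :=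
        ContinuousAt.comp (g := e.extend (𝓡∂ 2)) (e.continuousAt_extend (h0 ▸ he)) hc
      have h3 := h2.tendsto
      rwa [h0] at h3
    exact h1 ht
  have hma := tendsto_fst_zero.eventually (hmem h.continuous_left.self_of_nhds rfl)
  have hmb := tendsto_snd_zero.eventually (hmem h.continuous_right.self_of_nhds h.eq.symm)
  -- applying the derivative of the change of charts does not change the degree
  open ComplexConjugate in
  have hlin : SameDegree
      (fun q => A * separation e a b q + B * conj (separation e a b q)) (separation e a b) := by
    filter_upwards [eventually_onCircle ((h.eventually_mem he).and
      ((h.eventually_continuousAt he).and h.ne))] with r hr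
    refine isDegreeOne_linear_comp_iff hlt (F := onCircle (separation e a b) r) ?_ ?_
    · rw [continuous_iff_continuousAt]
      intro z
      refine ContinuousAt.comp (g := separation e a b)
        (f := fun z : Circle => (r * (z : ℂ).re, r * (z : ℂ).im)) (hr z).1.2.1 ?_
      exact ((continuous_const.mul (Complex.continuous_re.comp continuous_circle_coe)).prodMk
        (continuous_const.mul
          (Complex.continuous_im.comp continuous_circle_coe))).continuousAt
    · intro z
      exact separation_ne_zero (hr z).1.1.1 (hr z).1.1.2 ((hr z).1.2.2 (hr z).2)
  -- the change of charts is close to its derivative, by strict differentiability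
  refine SameDegree.trans (sameDegree_of_norm_sub_lt (h.eventually_continuousAt he') ?_ ?_) hlin
  · filter_upwards [h.eventually_continuousAt he] with q hq
    exact (continuousAt_const.mul hq).add
      (continuousAt_const.mul (Complex.continuous_conj.continuousAt.comp hq))
  · filter_upwards [hma, hmb, h.eventually_mem he, h.ne] with q h1 h2 h3 h4 hq
    set u := e.extend (𝓡∂ 2) (a q.1) - e.extend (𝓡∂ 2) (b q.2) with hu
    have hsep : separation e a b q = toComplex u := rfl
    have hu0 : 0 < ‖u‖ := by
      rw [← toComplex.norm_map, norm_pos_iff]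
      exact separation_ne_zero h3.1 h3.2 (h4 hq)
    have h5 := hstrict _ h1 _ h2
    have h6 : ∀ y ∈ e.source, τ (e.extend (𝓡∂ 2) y) = e'.extend (𝓡∂ 2) y := fun y hy => by
      rw [hτ, Function.comp_apply, e.extend_left_inv hy]
    rw [h6 _ h3.1, h6 _ h3.2, ← hu, ← toComplex.norm_map, map_sub] at h5
    rw [hsep, ← hAB]
    refine h5.trans_lt ?_
    rw [hAB]
    have h7 : ‖A‖ * ‖u‖ - ‖B‖ * ‖u‖ ≤
        ‖A * toComplex u + B * (starRingEnd ℂ) (toComplex u)‖ := by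
      have := norm_sub_norm_le (A * toComplex u) (-(B * (starRingEnd ℂ) (toComplex u)))
      rwa [sub_neg_eq_add, norm_neg, norm_mul, norm_mul, Complex.norm_conj,
        toComplex.norm_map] at this
    nlinarith

end Separation

/-! ### Invariance of the local intersection numbers -/

section Invariance

variable {M : Type*} [TopologicalSpace M] {a b : ℝ → M}

theorem MeetOnce.homeomorph_comp (h : MeetOnce a b) (φ : M ≃ₜ M) : MeetOnce (φ ∘ a) (φ ∘ b) where
  continuous_left := h.continuous_left.mono fun _ hs => φ.continuous.continuousAt.comp hs
  continuous_right := h.continuous_right.mono fun _ hs => φ.continuous.continuousAt.comp hs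
  eq := congrArg φ h.eq
  ne := h.ne.mono fun _ hq hq0 => φ.injective.ne (hq hq0)

/-- The homeomorphisms of an isotopy, with the time parameter extended to the real line. -/
def AmbientIsotopy.at (h : AmbientIsotopy M) (t : ℝ) : M ≃ₜ M :=
  h.homeo (projIcc 0 1 zero_le_one t)

theorem AmbientIsotopy.continuous_at (h : AmbientIsotopy M) :
    Continuous fun p : ℝ × M => h.at p.1 p.2 :=
  h.continuous.comp (f := fun p : ℝ × M => (projIcc (0 : ℝ) 1 zero_le_one p.1, p.2))
    ((continuous_projIcc.comp continuous_fst).prodMk continuous_snd)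

theorem AmbientIsotopy.at_zero (h : AmbientIsotopy M) : h.at 0 = Homeomorph.refl M := by
  rw [AmbientIsotopy.at, projIcc_left]; exact h.zero

theorem AmbientIsotopy.at_one (h : AmbientIsotopy M) : h.at 1 = h.homeo 1 := by
  rw [AmbientIsotopy.at, projIcc_right]; rfl

/-- In a fixed chart, the local degree is constant for a short time during an isotopy. -/
theorem MeetOnce.eventually_sameDegree (hab : MeetOnce a b) (h : AmbientIsotopy M) (t₀ : ℝ)
    {e : OpenPartialHomeomorph M (EuclideanHalfSpace 2)} (he : h.at t₀ (a 0) ∈ e.source) :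
    ∀ᶠ t in nhds t₀, h.at t (a 0) ∈ e.source ∧
      SameDegree (separation e (h.at t₀ ∘ a) (h.at t₀ ∘ b))
        (separation e (h.at t ∘ a) (h.at t ∘ b)) := by
  have hca : ∀ {c : ℝ → M}, ∀ t s, ContinuousAt c s →
      ContinuousAt (fun p : ℝ × ℝ => h.at p.1 (c p.2)) (t, s) := fun {c} t s hc =>
    ContinuousAt.comp (g := fun p : ℝ × M => h.at p.1 p.2) (f := fun p : ℝ × ℝ => (p.1, c p.2))
      h.continuous_at.continuousAt (continuousAt_fst.prodMk
        (ContinuousAt.comp (g := c) (f := Prod.snd) hc continuousAt_snd))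
  have hm : ∀ {c : ℝ → M}, ContinuousAt c 0 → c 0 = a 0 →
      ∀ᶠ p in nhds ((t₀, 0) : ℝ × ℝ), h.at p.1 (c p.2) ∈ e.source := fun {c} hc h0 =>
    (hca t₀ 0 hc) (e.open_source.mem_nhds (by simpa [h0] using he))
  have hma := hm hab.continuous_left.self_of_nhds rfl
  have hmb := hm hab.continuous_right.self_of_nhds hab.eq.symm
  rw [nhds_prod_eq] at hma hmb
  obtain ⟨T₁, hT₁, S₁, hS₁, h₁⟩ := Filter.eventually_prod_iff.1 hma
  obtain ⟨T₂, hT₂, S₂, hS₂, h₂⟩ := Filter.eventually_prod_iff.1 hmb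
  obtain ⟨ε, hε, hT⟩ := Metric.eventually_nhds_iff_ball.1 (hT₁.and hT₂)
  filter_upwards [Metric.ball_mem_nhds t₀ hε] with t ht
  refine ⟨h₁ (hT t ht).1 hS₁.self_of_nhds, ?_⟩
  -- the isotopy between the times `t₀` and `t` is a homotopy of the separation vectors
  have key := sameDegree_of_homotopy (H := fun p : unitInterval × (ℝ × ℝ) =>
    separation e (h.at (t₀ + p.1 * (t - t₀)) ∘ a) (h.at (t₀ + p.1 * (t - t₀)) ∘ b) p.2) <| by
    filter_upwards [hab.ne, tendsto_fst_zero.eventually (hS₁.and hab.continuous_left),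
      tendsto_snd_zero.eventually (hS₂.and hab.continuous_right)] with q h0 ha hb τ
    have hτ : t₀ + τ * (t - t₀) ∈ Metric.ball t₀ ε := by
      rw [Metric.mem_ball, Real.dist_eq] at ht ⊢
      rw [add_sub_cancel_left, abs_mul, abs_of_nonneg τ.2.1]
      exact (mul_le_of_le_one_left (abs_nonneg _) τ.2.2).trans_lt ht
    have h3 := h₁ (hT _ hτ).1 ha.1
    have h4 := h₂ (hT _ hτ).2 hb.1
    refine ⟨?_, fun hq => separation_ne_zero h3 h4 ((h.at _).injective.ne (h0 hq))⟩
    have hc1 : Continuous fun p : unitInterval × (ℝ × ℝ) =>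
      ((t₀ + p.1 * (t - t₀), p.2.1) : ℝ × ℝ) := by fun_prop
    have hc2 : Continuous fun p : unitInterval × (ℝ × ℝ) =>
      ((t₀ + p.1 * (t - t₀), p.2.2) : ℝ × ℝ) := by fun_prop
    have h5 := ContinuousAt.comp (x := (τ, q)) (hca _ _ ha.2) hc1.continuousAt
    have h6 := ContinuousAt.comp (x := (τ, q)) (hca _ _ hb.2) hc2.continuousAt
    have h7 := ContinuousAt.comp (x := (τ, q)) (e.continuousAt_extend (I := 𝓡∂ 2) h3) h5
    have h8 := ContinuousAt.comp (x := (τ, q)) (e.continuousAt_extend (I := 𝓡∂ 2) h4) h6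
    exact toComplex.continuous.continuousAt.comp (h7.sub h8)
  simpa using key

variable [ChartedSpace (EuclideanHalfSpace 2) M]

/-- The local degree is invariant under ambient isotopy. The times for which it has a given value
form an open set, since the degree does not depend on the chart. -/
theorem MeetOnce.sameDegree_of_isotopy [OrientedSurface M] (hab : MeetOnce a b)
    (h : AmbientIsotopy M) : SameDegree (separation (chartAt _ (a 0)) a b)
      (separation (chartAt _ (h.homeo 1 (a 0))) (h.homeo 1 ∘ a) (h.homeo 1 ∘ b)) := by
  let F : ℝ → ℝ × ℝ → ℂ := fun t =>
    separation (chartAt _ (h.at t (a 0))) (h.at t ∘ a) (h.at t ∘ b)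
  let c : ℝ → Filter.Germ (nhdsWithin (0 : ℝ) (Ioi 0)) Prop := fun t =>
    ((fun r => IsDegreeOne (onCircle (F t) r) : ℝ → Prop) : Filter.Germ _ Prop)
  have hc : ∀ s t, SameDegree (F s) (F t) ↔ c s = c t := fun s t => by
    refine (Iff.trans ?_ Filter.Germ.coe_eq.symm)
    exact Filter.eventually_congr (Filter.Eventually.of_forall fun r => eq_iff_iff.symm)
  have hloc : IsLocallyConstant c := by
    rw [IsLocallyConstant.iff_eventually_eq]
    intro t₀
    filter_upwards [hab.eventually_sameDegree h t₀ (mem_chart_source _ (h.at t₀ (a 0)))]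
      with t ht
    rw [← hc]
    exact ((hab.homeomorph_comp (h.at t)).sameDegree_of_charts (chart_mem_atlas _ _)
      (chart_mem_atlas _ _) ht.1 (mem_chart_source _ _)).trans ht.2.symm
  have := (hc 0 1).2 (hloc.apply_eq_of_preconnectedSpace 0 1)
  simp only [F, h.at_zero, h.at_one] at this
  exact this

end Invariance

section Reparametrization

variable {M : Type*} [TopologicalSpace M] {a b a' b' : ℝ → M} {κ μ : ℝ → ℝ}

/-- `κ` is an orientation preserving change of parameter near `0`. -/
structure IsPositiveGerm (κ : ℝ → ℝ) : Prop where
  continuous : ∀ᶠ s in nhds (0 : ℝ), ContinuousAt κ s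
  zero : κ 0 = 0
  pos : ∀ᶠ s in nhds (0 : ℝ), 0 < s → 0 < κ s
  neg : ∀ᶠ s in nhds (0 : ℝ), s < 0 → κ s < 0

theorem IsPositiveGerm.eventually_ne_zero (h : IsPositiveGerm κ) :
    ∀ᶠ s in nhds (0 : ℝ), s ≠ 0 → ∀ τ : unitInterval, (1 - (τ : ℝ)) * s + τ * κ s ≠ 0 := by
  filter_upwards [h.pos, h.neg] with s hp hn hs τ
  have h0 := τ.2.1
  have h1 := τ.2.2
  rcases lt_or_gt_of_ne hs with hs | hs
  · have := hn hs
    rcases eq_or_lt_of_le h0 with h0 | h0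
    · simp only [← h0]; linarith
    · nlinarith
  · have := hp hs
    rcases eq_or_lt_of_le h0 with h0 | h0
    · simp only [← h0]; linarith
    · nlinarith

/-- The local degree is invariant under orientation preserving changes of the parameters. -/
theorem MeetOnce.sameDegree_of_reparam (hab : MeetOnce a b)
    {e : OpenPartialHomeomorph M (EuclideanHalfSpace 2)} (he : a 0 ∈ e.source)
    (hκ : IsPositiveGerm κ) (hμ : IsPositiveGerm μ)
    (ha : ∀ᶠ s in nhds (0 : ℝ), a (κ s) = a' s) (hb : ∀ᶠ s in nhds (0 : ℝ), b (μ s) = b' s) :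
    SameDegree (separation e a b) (separation e a' b') := by
  -- the convex combinations of the parameters tend to zero uniformly in the homotopy parameter
  have htend : Filter.Tendsto (fun p : unitInterval × (ℝ × ℝ) =>
      (((1 - (p.1 : ℝ)) * p.2.1 + p.1 * κ p.2.1, (1 - (p.1 : ℝ)) * p.2.2 + p.1 * μ p.2.2) :
        ℝ × ℝ)) (⊤ ×ˢ nhds 0) (nhds 0) := by
    have aux : ∀ {κ : ℝ → ℝ}, IsPositiveGerm κ → ∀ {f : ℝ × ℝ → ℝ},
        Filter.Tendsto f (nhds 0) (nhds 0) →
        Filter.Tendsto (fun p : unitInterval × (ℝ × ℝ) =>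
          (1 - (p.1 : ℝ)) * f p.2 + p.1 * κ (f p.2)) (⊤ ×ˢ nhds 0) (nhds 0) := by
      intro κ hκ f hf
      have h1 : Filter.Tendsto (fun p : unitInterval × (ℝ × ℝ) => |f p.2| + |κ (f p.2)|)
          (⊤ ×ˢ nhds 0) (nhds 0) := by
        have h2 := hf.abs
        have h3 := (hκ.continuous.self_of_nhds.tendsto.comp hf).abs
        rw [hκ.zero] at h3
        have := (h2.add h3).comp (Filter.tendsto_snd (f := (⊤ : Filter unitInterval)))
        rw [abs_zero, add_zero] at this
        exact this
      refine squeeze_zero_norm (fun p => ?_) h1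
      have h0 := p.1.2.1
      have h1 := p.1.2.2
      rw [Real.norm_eq_abs]
      refine (abs_add_le _ _).trans ?_
      rw [abs_mul, abs_mul, abs_of_nonneg h0, abs_of_nonneg (sub_nonneg.2 h1)]
      gcongr
      · exact mul_le_of_le_one_left (abs_nonneg _) (by linarith)
      · exact mul_le_of_le_one_left (abs_nonneg _) h1
    have := (aux hκ tendsto_fst_zero).prodMk_nhds (aux hμ tendsto_snd_zero)
    exact this
  have h1 := htend.eventually ((hab.eventually_mem he).and ((hab.eventually_continuousAt he).and
    hab.ne))
  rw [Filter.eventually_prod_iff] at h1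
  obtain ⟨T, hT, S, hS, h1⟩ := h1
  have key := sameDegree_of_homotopy (H := fun p : unitInterval × (ℝ × ℝ) =>
    separation e a b ((1 - (p.1 : ℝ)) * p.2.1 + p.1 * κ p.2.1,
      (1 - (p.1 : ℝ)) * p.2.2 + p.1 * μ p.2.2)) <| by
    filter_upwards [hS, tendsto_fst_zero.eventually (hκ.continuous.and hκ.eventually_ne_zero),
      tendsto_snd_zero.eventually (hμ.continuous.and hμ.eventually_ne_zero)] with q hq hk hm τ
    have h2 := h1 (Filter.eventually_top.1 hT τ) hq
    constructor
    · refine ContinuousAt.comp (g := separation e a b) (x := (τ, q)) h2.2.1 ?_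
      have hf : ContinuousAt (fun p : unitInterval × (ℝ × ℝ) => κ p.2.1) (τ, q) :=
        ContinuousAt.comp (g := κ) (f := fun p : unitInterval × (ℝ × ℝ) => p.2.1) hk.1
          (continuous_fst.comp continuous_snd).continuousAt
      have hg : ContinuousAt (fun p : unitInterval × (ℝ × ℝ) => μ p.2.2) (τ, q) :=
        ContinuousAt.comp (g := μ) (f := fun p : unitInterval × (ℝ × ℝ) => p.2.2) hm.1
          (continuous_snd.comp continuous_snd).continuousAt
      have hτ : ContinuousAt (fun p : unitInterval × (ℝ × ℝ) => (p.1 : ℝ)) (τ, q) :=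
        (continuous_subtype_val.comp continuous_fst).continuousAt
      have h3 : ContinuousAt (fun p : unitInterval × (ℝ × ℝ) => p.2.1) (τ, q) := by fun_prop
      have h4 : ContinuousAt (fun p : unitInterval × (ℝ × ℝ) => p.2.2) (τ, q) := by fun_prop
      exact (((continuousAt_const.sub hτ).mul h3).add (hτ.mul hf)).prodMk
        (((continuousAt_const.sub hτ).mul h4).add (hτ.mul hg))
    · -- the zero stays isolated, since `κ` and `μ` have the sign of their argument
      intro hq0
      refine separation_ne_zero h2.1.1 h2.1.2 (h2.2.2 fun h0 => hq0 ?_)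
      have h3 := congrArg Prod.fst h0
      have h4 := congrArg Prod.snd h0
      refine Prod.ext ?_ ?_
      · by_contra hne; exact hk.2 hne τ h3
      · by_contra hne; exact hm.2 hne τ h4
  refine SameDegree.trans (by simpa using key) ?_
  filter_upwards [eventually_onCircle ((tendsto_fst_zero.eventually ha).and
    (tendsto_snd_zero.eventually hb))] with r hr
  have : onCircle (fun q => separation e a b (κ q.1, μ q.2)) r =
      onCircle (separation e a' b') r := by
    funext z
    simp only [onCircle, separation]
    rw [← (hr z).1.1, ← (hr z).1.2]
  rw [← this]

end Reparametrization

/-! ### Invariance of the signs of crossings -/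

section Signs

open Complex ComplexConjugate

@[simp]
theorem pathAt_zero {M : Type*} (α : S1 → M) (x : S1) : pathAt α x 0 = α x := by simp [pathAt]

variable {M : Type*} [TopologicalSpace M]

/-- For smooth curves the degree of the separation vector is read off from the tangent vectors. -/
theorem MeetOnce.isDegreeOne_iff {a b : ℝ → M} (hab : MeetOnce a b)
    {e : OpenPartialHomeomorph M (EuclideanHalfSpace 2)} (he : a 0 ∈ e.source)
    {v w : EuclideanSpace ℝ (Fin 2)}
    (hv : HasDerivAt (fun t => e.extend (𝓡∂ 2) (a t)) v 0)
    (hw : HasDerivAt (fun t => e.extend (𝓡∂ 2) (b t)) w 0) (hdet : det2 v w ≠ 0) :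
    ∀ᶠ r in nhdsWithin (0 : ℝ) (Ioi 0),
      IsDegreeOne (onCircle (separation e a b) r) ↔ det2 v w < 0 := by
  -- `(s, t) ↦ s v - t w` in complex notation is `z ↦ A z + B z̄`; its determinant is `-det2 v w`
  set A : ℂ := ⟨(v 0 - w 1) / 2, (v 1 + w 0) / 2⟩ with hA
  set B : ℂ := ⟨(v 0 + w 1) / 2, (v 1 - w 0) / 2⟩ with hB
  have hAB : ‖A‖ ^ 2 - ‖B‖ ^ 2 = -det2 v w := by
    rw [← normSq_eq_norm_sq, ← normSq_eq_norm_sq, normSq_mk, normSq_mk, det2]; ring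
  have hne : ‖A‖ ≠ ‖B‖ := fun h => hdet (by rw [h, sub_self] at hAB; linarith)
  have hlt : ‖B‖ < ‖A‖ ↔ det2 v w < 0 := by
    rw [← pow_lt_pow_iff_left₀ (norm_nonneg B) (norm_nonneg A) two_ne_zero]
    constructor <;> intro h <;> linarith
  set G : ℝ × ℝ → ℂ := fun q => A * ⟨q.1, q.2⟩ + B * conj ⟨q.1, q.2⟩ with hG
  have hG' : ∀ q, G q = toComplex (q.1 • v - q.2 • w) := fun q => by
    simp only [hG, hA, hB, toComplex_apply]
    apply Complex.ext
    · simp; ring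
    · simp; ring
  have hc : 0 < |‖A‖ - ‖B‖| := abs_pos.2 (sub_ne_zero.2 hne)
  have hGnorm : ∀ q : ℝ × ℝ, |‖A‖ - ‖B‖| * ‖q‖ ≤ ‖G q‖ := fun q => by
    have h1 := abs_norm_sub_norm_le (A * ⟨q.1, q.2⟩) (-(B * conj (⟨q.1, q.2⟩ : ℂ)))
    rw [sub_neg_eq_add, norm_neg, norm_mul, norm_mul, norm_conj, ← sub_mul, abs_mul,
      abs_of_nonneg (norm_nonneg (⟨q.1, q.2⟩ : ℂ))] at h1
    refine le_trans ?_ h1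
    gcongr
    rw [Prod.norm_def]
    exact max_le (abs_re_le_norm ⟨q.1, q.2⟩) (abs_im_le_norm ⟨q.1, q.2⟩)
  -- the separation vector is close to its linear part `G`
  have hsame : SameDegree (separation e a b) G := by
    refine sameDegree_of_norm_sub_lt (hab.eventually_continuousAt he)
      (Filter.Eventually.of_forall fun q => ?_) ?_
    · have : Continuous G := by
        have h1 : G = fun q => toComplex (q.1 • v - q.2 • w) := funext hG'
        rw [h1]
        exact toComplex.continuous.comp (by fun_prop)
      exact this.continuousAt
    · have hε : 0 < |‖A‖ - ‖B‖| / 4 := by positivity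
      have h1 := tendsto_fst_zero.eventually ((hasDerivAt_iff_isLittleO.1 hv).def hε)
      have h2 := tendsto_snd_zero.eventually ((hasDerivAt_iff_isLittleO.1 hw).def hε)
      filter_upwards [h1, h2] with q h1 h2 hq
      have hq' : 0 < ‖q‖ := norm_pos_iff.2 hq
      refine lt_of_lt_of_le ?_ (hGnorm q)
      rw [hG', separation, ← map_sub, toComplex.norm_map]
      have h3 : e.extend (𝓡∂ 2) (a q.1) - e.extend (𝓡∂ 2) (b q.2) - (q.1 • v - q.2 • w) =
          (e.extend (𝓡∂ 2) (a q.1) - e.extend (𝓡∂ 2) (a 0) - (q.1 - 0) • v) -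
          (e.extend (𝓡∂ 2) (b q.2) - e.extend (𝓡∂ 2) (b 0) - (q.2 - 0) • w) := by
        rw [hab.eq, sub_zero, sub_zero]; abel
      rw [h3]
      refine (norm_sub_le _ _).trans_lt ?_
      rw [sub_zero] at h1 h2
      have h4 : ‖q.1‖ ≤ ‖q‖ := norm_fst_le q
      have h5 : ‖q.2‖ ≤ ‖q‖ := norm_snd_le q
      rw [sub_zero, sub_zero]
      nlinarith
  filter_upwards [hsame, self_mem_nhdsWithin] with r hr hr0
  rw [hr, ← hlt]
  have hr0' : (r : ℂ) ≠ 0 := by exact_mod_cast (ne_of_gt hr0)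
  have h1 : onCircle G r = fun z : Circle => (r * A) * z + (r * B) * conj (z : ℂ) := by
    funext z
    have h2 : (⟨r * (z : ℂ).re, r * (z : ℂ).im⟩ : ℂ) = r * z := by
      apply Complex.ext <;> simp
    simp only [onCircle, hG, h2, map_mul, conj_ofReal]
    ring
  rw [h1, isDegreeOne_linear_iff, norm_mul, norm_mul]
  · exact mul_lt_mul_iff_right₀ (norm_pos_iff.2 hr0')
  · rw [norm_mul, norm_mul]
    exact fun h => hne (mul_left_cancel₀ (norm_pos_iff.2 hr0').ne' h)

theorem continuous_pathAt {α : S1 → M} (hα : Continuous α) (x : S1) : Continuous (pathAt α x) :=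
  hα.comp (continuous_add_coe x)

variable [ChartedSpace (EuclideanHalfSpace 2) M]

theorem hasDerivAt_extChartAt {f : ℝ → M} {t : ℝ}
    (hf : MDifferentiableAt 𝓘(ℝ, ℝ) (𝓡∂ 2) f t) :
    HasDerivAt (fun s => (chartAt (EuclideanHalfSpace 2) (f t)).extend (𝓡∂ 2) (f s))
      (mfderiv 𝓘(ℝ, ℝ) (𝓡∂ 2) f t (1 : ℝ) : EuclideanSpace ℝ (Fin 2)) t := by
  have h := hf.hasMFDerivAt.2
  simp only [writtenInExtChartAt, mfld_simps] at h
  have h2 : HasFDerivAt (fun s => (chartAt (EuclideanHalfSpace 2) (f t)).extend (𝓡∂ 2) (f s))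
      (show ℝ →L[ℝ] EuclideanSpace ℝ (Fin 2) from mfderiv 𝓘(ℝ, ℝ) (𝓡∂ 2) f t) t :=
    h.hasFDerivAt Filter.univ_mem
  exact h2.hasDerivAt

variable {α β : S1 → M}

theorem IsGeneric.hasDerivAt (hα : IsGeneric α) {x y : S1} (hxy : x ≠ y) (h : α x = α y) :
    HasDerivAt (fun t => (chartAt (EuclideanHalfSpace 2) (α x)).extend (𝓡∂ 2) (pathAt α x t))
      (tangent α x) 0 := by
  have := hasDerivAt_extChartAt ((hα.smooth_crossing x y hxy h).mdifferentiableAt (by simp))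
  rw [pathAt_zero] at this
  exact this

/-- The set of parameters of crossings is discrete. -/
theorem IsGeneric.meetOnce (hα : IsGeneric α) {x y : S1} (hxy : x ≠ y) (h : α x = α y) :
    MeetOnce (pathAt α x) (pathAt α y) where
  continuous_left := Filter.Eventually.of_forall fun s =>
    (continuous_pathAt hα.continuous x).continuousAt
  continuous_right := Filter.Eventually.of_forall fun s =>
    (continuous_pathAt hα.continuous y).continuousAt
  eq := by simpa using h
  ne := by
    have hcl : IsClosed ({p : S1 × S1 | p.1 ≠ p.2 ∧ α p.1 = α p.2} \ {(x, y)}) :=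
      (hα.finite.subset sdiff_subset).isClosed
    have hopen : IsOpen {p : S1 × S1 | p.1 ≠ p.2} := isOpen_ne_fun continuous_fst continuous_snd
    have ht : Filter.Tendsto (fun q : ℝ × ℝ => (x + (q.1 : S1), y + (q.2 : S1))) (nhds 0)
        (nhds (x, y)) :=
      ((tendsto_add_coe x).comp tendsto_fst_zero).prodMk_nhds
        ((tendsto_add_coe y).comp tendsto_snd_zero)
    filter_upwards [ht.eventually (hcl.isOpen_compl.mem_nhds (x := (x, y)) (by simp)),
      ht.eventually (hopen.mem_nhds hxy), Metric.ball_mem_nhds (0 : ℝ × ℝ) one_pos]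
      with q h1 h2 h3 hq heq
    have h4 : (x + (q.1 : S1), y + (q.2 : S1)) = (x, y) := by
      by_contra hne
      exact h1 ⟨⟨h2, heq⟩, hne⟩
    -- parameters of absolute value less than one represent zero only if they vanish
    have hz : ∀ {x : S1} {s : ℝ}, x + (s : S1) = x → |s| < 1 → s = 0 := by
      intro x s hs h1
      have hs' : ((s : ℝ) : S1) = 0 := by simpa using hs
      obtain ⟨n, hn⟩ := (AddCircle.coe_eq_zero_iff 1).1 hs'
      simp only [zsmul_eq_mul, mul_one] at hn
      rw [← hn] at h1 ⊢
      have : |n| < 1 := by exact_mod_cast h1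
      rw [Int.abs_lt_one_iff] at this
      simp [this]
    rw [Metric.mem_ball, dist_zero_right, Prod.norm_def, max_lt_iff] at h3
    exact hq (Prod.ext (hz (congrArg Prod.fst h4) h3.1) (hz (congrArg Prod.snd h4) h3.2))

/-- Where a collapse of the circle is injective, it is given in local coordinates by an orientation
preserving change of parameter. -/
theorem IsCollapse.exists_isPositiveGerm {A : Set S1} {g : S1 → S1} (hg : IsCollapse A g) {x : S1}
    (hx : A ∈ nhds x) :
    ∃ κ : ℝ → ℝ, IsPositiveGerm κ ∧ ∀ s : ℝ, g x + (κ s : S1) = g (x + (s : S1)) := by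
  let κ : ℝ → ℝ := fun s => (AddCircle.equivIco (1 : ℝ) (-(1 / 2)) (g (x + (s : S1)) - g x) : ℝ)
  have hκ : ∀ s : ℝ, g x + (κ s : S1) = g (x + (s : S1)) := fun s => by
    have : ((κ s : ℝ) : S1) = g (x + (s : S1)) - g x := AddCircle.coe_equivIco
    rw [this]; abel
  have hcont : Continuous fun s : ℝ => g (x + (s : S1)) - g x :=
    (hg.continuous.comp (continuous_add_coe x)).sub continuous_const
  have hzero : κ 0 = 0 := by
    simp only [κ]
    rw [QuotientAddGroup.mk_zero, add_zero, sub_self, ← QuotientAddGroup.mk_zero]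
    exact AddCircle.equivIco_coe_of_mem (by norm_num)
  have hev : ∀ᶠ s in nhds (0 : ℝ), ContinuousAt κ s := by
    have hne : (fun s : ℝ => g (x + (s : S1)) - g x) 0 ≠ (((-(1 / 2) : ℝ)) : S1) := by
      intro h
      have : κ 0 = -(1 / 2) := by
        have h' : g (x + ((0 : ℝ) : S1)) - g x = ((-(1 / 2) : ℝ) : S1) := h
        simp only [κ]
        rw [h']
        exact AddCircle.equivIco_coe_of_mem (by norm_num)
      rw [hzero] at this
      norm_num at this
    filter_upwards [hcont.continuousAt.eventually_ne hne] with s hs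
    exact continuous_subtype_val.continuousAt.comp
      (ContinuousAt.comp (f := fun s : ℝ => g (x + (s : S1)) - g x)
        (AddCircle.continuousAt_equivIco (1 : ℝ) (-(1 / 2)) hs) hcont.continuousAt)
  have hpos : ∀ s, 0 ≤ κ s → pos (g x) (g (x + (s : S1))) = κ s := fun s hs => by
    have := (AddCircle.equivIco (1 : ℝ) (-(1 / 2)) (g (x + (s : S1)) - g x)).2.2
    exact pos_eq_of_add_eq hs (by linarith) (hκ s)
  have hneg : ∀ s, κ s < 0 → pos (g x) (g (x + (s : S1))) = 1 + κ s := fun s hs => by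
    have := (AddCircle.equivIco (1 : ℝ) (-(1 / 2)) (g (x + (s : S1)) - g x)).2.1
    refine pos_eq_of_add_eq (by linarith) (by linarith) ?_
    have h1 : ((1 : ℝ) : S1) = 0 := AddCircle.coe_period 1
    rw [AddCircle.coe_add, h1, zero_add, hκ]
  have htend : Filter.Tendsto κ (nhds 0) (nhds 0) := by
    have := hev.self_of_nhds.tendsto; rwa [hzero] at this
  -- a fixed reference point on the circle, at which the collapse takes another value than at `x`
  have hy : ∃ y, y ≠ x := ⟨x + ((1 / 2 : ℝ) : S1), fun h => by
    have h1 := pos_add_coe x (t := 1 / 2) (by norm_num) (by norm_num)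
    rw [h, pos_self] at h1; norm_num at h1⟩
  obtain ⟨y, hy⟩ := hy
  have hyx : g x ≠ g y := hg.ne_of_mem_nhds hx hy.symm
  have hP0 : 0 < pos (g x) (g y) := pos_pos_iff.2 hyx.symm
  have hP1 : pos (g x) (g y) < 1 := pos_lt_one _ _
  have hball : ∀ᶠ s in nhds (0 : ℝ), |κ s| < min (pos (g x) (g y)) (1 - pos (g x) (g y)) := by
    have := htend (Metric.ball_mem_nhds 0 (lt_min hP0 (sub_pos.2 hP1)))
    filter_upwards [this] with s hs
    simpa using hs
  have hright := (eventually_nhdsWithin_iff.1 (eventually_add_mem_cIoo hy.symm))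
  have hleft := (eventually_nhdsWithin_iff.1 (eventually_add_neg_mem_cIoo hy.symm))
  have hleft' : ∀ᶠ s : ℝ in nhds 0, s < 0 → x + (s : S1) ∈ cIoo y x := by
    have h0 : Filter.Tendsto (fun t : ℝ => -t) (nhds 0) (nhds 0) := by
      simpa using (continuous_neg (G := ℝ)).tendsto 0
    filter_upwards [h0.eventually hleft] with s hs h
    rw [neg_neg] at hs
    exact hs (neg_pos.2 h)
  have hAnhds : ∀ᶠ s : ℝ in nhds 0, g (x + (s : S1)) ≠ g y := by
    refine ContinuousAt.eventually_ne (hg.continuous.comp (continuous_add_coe x)).continuousAt ?_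
    simpa using hyx
  refine ⟨κ, ⟨hev, hzero, ?_, ?_⟩, hκ⟩
  · filter_upwards [hball, hright, hAnhds] with s hs hr hn h0
    by_contra hle
    have hmem := hr h0
    have hne : g x ≠ g (x + (s : S1)) := hg.ne_of_mem_nhds hx fun e => by
      rw [← e] at hmem; exact sbtw_irrefl_left (mem_cIoo.1 hmem)
    have hk0 : κ s ≠ 0 := fun e => hne (by rw [← hκ s, e]; simp)
    have hlt : κ s < 0 := lt_of_le_of_ne (not_lt.1 hle) hk0
    have h1 := hg.sbtw_map (mem_cIoo.1 hmem) hne hn hyx.symm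
    have h2 := (sbtw_iff_pos.1 h1).2
    rw [hneg s hlt] at h2
    have h3 := (abs_lt.1 (hs.trans_le (min_le_right _ _))).1
    linarith
  · filter_upwards [hball, hleft', hAnhds] with s hs hr hn h0
    by_contra hle
    have hmem := hr h0
    have hne : g x ≠ g (x + (s : S1)) := hg.ne_of_mem_nhds hx fun e => by
      rw [← e] at hmem; exact sbtw_irrefl_right (mem_cIoo.1 hmem)
    have h1 := hg.sbtw_map (mem_cIoo.1 hmem) hn.symm hne.symm hyx
    have h2 := (sbtw_iff_pos.1 (sbtw_cyclic_right h1)).2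
    rw [hpos s (not_lt.1 hle)] at h2
    have h3 := (abs_lt.1 (hs.trans_le (min_le_left _ _))).2
    linarith

/-- If `β` follows `α`, up to an ambient isotopy and a reparametrization, near the two preimages of
a crossing, then the crossing has the same sign on both loops. -/
theorem IsGeneric.det2_tangent_pos_iff [OrientedSurface M] (hα : IsGeneric α) (hβ : IsGeneric β)
    (h : AmbientIsotopy M) {A : Set S1} {g : S1 → S1} (hg : IsCollapse A g)
    (hfollow : ∀ z ∈ A, β (g z) = h.homeo 1 (α z)) {x y : S1} (hx : A ∈ nhds x) (hy : A ∈ nhds y)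
    (hxy : x ≠ y) (he : α x = α y) :
    0 < det2 (tangent β (g x)) (tangent β (g y)) ↔ 0 < det2 (tangent α x) (tangent α y) := by
  have hgxy : g x ≠ g y := hg.ne_of_mem_nhds hx hxy
  have he' : β (g x) = β (g y) := by
    rw [hfollow x (mem_of_mem_nhds hx), hfollow y (mem_of_mem_nhds hy), he]
  have hmα := hα.meetOnce hxy he
  have hmβ := hβ.meetOnce hgxy he'
  obtain ⟨κ, hκ, hκ'⟩ := hg.exists_isPositiveGerm hx
  obtain ⟨μ, hμ, hμ'⟩ := hg.exists_isPositiveGerm hy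
  have hdα := hα.transversal x y hxy he
  have hdβ := hβ.transversal _ _ hgxy he'
  have hpath : ∀ {x : S1}, A ∈ nhds x → ∀ {κ : ℝ → ℝ},
      (∀ s : ℝ, g x + (κ s : S1) = g (x + (s : S1))) →
      ∀ᶠ s in nhds (0 : ℝ), pathAt β (g x) (κ s) = (h.homeo 1 ∘ pathAt α x) s := by
    intro x hx κ hκ
    filter_upwards [(tendsto_add_coe x).eventually hx] with s hs
    rw [pathAt, hκ, hfollow _ hs]
    rfl
  have hbase : h.homeo 1 (pathAt α x 0) = β (g x) := by
    rw [pathAt_zero, hfollow x (mem_of_mem_nhds hx)]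
  -- the degree is carried from `α` to `β` by the isotopy and the change of parameters
  have h1 := hmα.sameDegree_of_isotopy h
  rw [hbase, pathAt_zero] at h1
  have h2 := hmβ.sameDegree_of_reparam (e := chartAt _ (β (g x))) (by simp) hκ hμ
    (hpath hx hκ') (hpath hy hμ')
  have h3 := hmα.isDegreeOne_iff (e := chartAt _ (α x)) (by simp) (hα.hasDerivAt hxy he)
    (by rw [he]; exact hα.hasDerivAt hxy.symm he.symm) hdα
  have h4 := hmβ.isDegreeOne_iff (e := chartAt _ (β (g x))) (by simp) (hβ.hasDerivAt hgxy he')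
    (by rw [he']; exact hβ.hasDerivAt hgxy.symm he'.symm) hdβ
  obtain ⟨r, h1, h2, h3, h4⟩ := (h1.and (h2.and (h3.and h4))).exists
  have : det2 (tangent β (g x)) (tangent β (g y)) < 0 ↔ det2 (tangent α x) (tangent α y) < 0 := by
    rw [← h4, h2, ← h1, h3]
  rw [← not_le, ← not_le, le_iff_lt_or_eq, le_iff_lt_or_eq, this]
  simp [hdα, hdβ]

end Signs

/-! ### Arcs and faces -/

section Arcs

variable {M : Type*} [TopologicalSpace M] [ChartedSpace (EuclideanHalfSpace 2) M]
  {α : PointedLoop M}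

namespace Crossing

/-- The open arc of the circle cut off by the chord of a crossing, on the side opposite to the base
point. -/
def arc (q : Crossing α) : Set S1 := cIoo q.1.1 q.1.2

theorem mem_arc_iff {q : Crossing α} {x : S1} :
    x ∈ q.arc ↔ q.fst < pos α.base x ∧ pos α.base x < q.snd := by
  have h := q.fst_lt_snd
  rw [arc, mem_cIoo, sbtw_iff_pos_base α.base]
  constructor
  · rintro (h1 | h1 | h1)
    · exact h1
    · exact absurd (h1.2.trans h) (lt_irrefl _)
    · exact absurd (h1.1.trans h) (lt_irrefl _)
  · exact Or.inl

theorem fst_ne_snd (q : Crossing α) : q.1.1 ≠ q.1.2 := fun h => by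
  have := q.fst_lt_snd
  rw [fst, snd, h] at this
  exact lt_irrefl _ this

theorem apply_eq (q : Crossing α) : α.toFun q.1.1 = α.toFun q.1.2 := q.2.2

theorem isOpen_arc (q : Crossing α) : IsOpen q.arc := isOpen_cIoo _ _

theorem base_notMem_arc (q : Crossing α) : α.base ∉ q.arc := fun h => by
  rw [mem_arc_iff, pos_self] at h
  exact absurd h.1 (not_lt.2 (pos_nonneg _ _))

theorem base_ne_fst (q : Crossing α) : α.base ≠ q.1.1 := fun h => by
  have := α.base_simple q.1.2 (q.apply_eq.symm.trans (congrArg α.toFun h).symm)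
  exact q.fst_ne_snd (h.symm.trans this.symm)

theorem compl_arc_mem_nhds {q : Crossing α} {x : S1} (h : x ∉ q.arc) (h1 : x ≠ q.1.1)
    (h2 : x ≠ q.1.2) : q.arcᶜ ∈ nhds x := by
  have hx : x ∈ cIoo q.1.2 q.1.1 := by
    rw [mem_cIoo, sbtw_iff_not_btw]
    intro h'
    refine h (sbtw_of_btw_not_btw h' fun h'' => ?_)
    rcases h'.antisymm h'' with e | e | e
    exacts [h1 e.symm, h2 e, q.fst_ne_snd e.symm]
  filter_upwards [(isOpen_cIoo _ _).mem_nhds hx] with y hy hy'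
  exact sbtw_asymm (mem_cIoo.1 hy) (mem_cIoo.1 hy')

/-- The closed arc of the circle cut off by the chord of a crossing. -/
def closedArc (q : Crossing α) : Set S1 :=
  {x | q.fst ≤ pos α.base x ∧ pos α.base x ≤ q.snd}

theorem mem_closedArc_iff {q : Crossing α} {x : S1} :
    x ∈ q.closedArc ↔ x = q.1.1 ∨ x = q.1.2 ∨ x ∈ q.arc := by
  rw [mem_arc_iff, ← pos_inj (b := α.base), ← pos_inj (b := α.base) (y := q.1.2)]
  have h := q.fst_lt_snd
  change _ ∧ _ ↔ pos α.base x = q.fst ∨ pos α.base x = q.snd ∨ _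
  constructor
  · rintro ⟨h1, h2⟩
    rcases h1.lt_or_eq with h1 | h1
    · rcases h2.lt_or_eq with h2 | h2
      · exact Or.inr (Or.inr ⟨h1, h2⟩)
      · exact Or.inr (Or.inl h2)
    · exact Or.inl h1.symm
  · rintro (h1 | h1 | h1)
    · rw [h1]; exact ⟨le_rfl, h.le⟩
    · rw [h1]; exact ⟨h.le, le_rfl⟩
    · exact ⟨h1.1.le, h1.2.le⟩

theorem closedArc_eq_compl (q : Crossing α) : q.closedArc = (cIoo q.1.2 q.1.1)ᶜ := by
  ext x
  rw [mem_compl_iff, mem_cIoo, sbtw_iff_not_btw, not_not, mem_closedArc_iff, arc, mem_cIoo]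
  constructor
  · rintro (rfl | rfl | h)
    · exact btw_rfl_left
    · exact btw_rfl_right
    · exact h.btw
  · intro h
    by_contra! hn
    refine hn.2.2 (sbtw_of_btw_not_btw h fun h' => ?_)
    rcases h.antisymm h' with e | e | e
    exacts [hn.1 e.symm, hn.2.1 e, q.fst_ne_snd e.symm]

theorem isClosed_closedArc (q : Crossing α) : IsClosed q.closedArc := by
  rw [closedArc_eq_compl]; exact (isOpen_cIoo _ _).isClosed_compl

/-- The endpoints of the chords of distinct crossings are distinct. -/
theorem eq_of_mem_of_apply_eq {p q : Crossing α} (h : α.toFun p.1.1 = α.toFun q.1.1) : p = q := by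
  rcases α.generic.double p.1.1 q.1.1 q.1.2 h q.apply_eq with e | e | e
  · exact eq_of_fst_eq (congrArg (pos α.base) e)
  · exact absurd e q.fst_ne_snd
  · rcases α.generic.double p.1.2 p.1.1 q.1.1 p.apply_eq.symm h with e' | e' | e'
    · exact absurd e' p.fst_ne_snd.symm
    · exact eq_of_fst_eq (congrArg (pos α.base) e')
    · exfalso
      have h1 : p.fst = q.snd := congrArg (pos α.base) e
      have h2 : p.snd = q.fst := congrArg (pos α.base) e'
      have h3 := p.fst_lt_snd
      have h4 := q.fst_lt_snd
      linarith

theorem fst_ne_of_ne {p q : Crossing α} (h : p ≠ q) : p.1.1 ≠ q.1.1 :=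
  fun e => h (eq_of_mem_of_apply_eq (congrArg _ e))

theorem snd_ne_of_ne {p q : Crossing α} (h : p ≠ q) : p.1.2 ≠ q.1.2 :=
  fun e => h (eq_of_mem_of_apply_eq (by rw [p.apply_eq, q.apply_eq, e]))

theorem fst_ne_snd_of_ne {p q : Crossing α} (h : p ≠ q) : p.1.1 ≠ q.1.2 :=
  fun e => h (eq_of_mem_of_apply_eq (by rw [q.apply_eq, e]))

theorem snd_ne_fst_of_ne {p q : Crossing α} (h : p ≠ q) : p.1.2 ≠ q.1.1 :=
  fun e => h (eq_of_mem_of_apply_eq (by rw [p.apply_eq, e]))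

theorem inside_iff_lt {p q : Crossing α} : Inside p q ↔ p < q := by
  constructor
  · intro h
    refine lt_of_le_of_ne (Or.inr h) ?_
    rintro rfl
    exact lt_irrefl _ h.1
  · intro h
    rcases h.le with e | e
    · exact absurd e h.ne
    · exact e

theorem lt_iff {p q : Crossing α} : p < q ↔ q.fst < p.fst ∧ p.snd < q.snd := inside_iff_lt.symm

theorem arc_subset_of_le {p q : Crossing α} (h : p ≤ q) : p.arc ⊆ q.arc := by
  rcases h with rfl | h
  · exact Subset.rfl
  · intro x hx
    rw [mem_arc_iff] at hx ⊢
    exact ⟨h.1.trans hx.1, hx.2.trans h.2⟩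

theorem closedArc_subset_arc {p q : Crossing α} (h : p < q) : p.closedArc ⊆ q.arc := by
  rw [lt_iff] at h
  intro x hx
  rw [mem_arc_iff]
  exact ⟨h.1.trans_le hx.1, hx.2.trans_lt h.2⟩

theorem fst_mem_closedArc (p : Crossing α) : p.1.1 ∈ p.closedArc := mem_closedArc_iff.2 (Or.inl rfl)

theorem snd_mem_closedArc (p : Crossing α) : p.1.2 ∈ p.closedArc :=
  mem_closedArc_iff.2 (Or.inr (Or.inl rfl))

theorem linked_symm {p q : Crossing α} : Linked p q ↔ Linked q p := or_comm

/-- Unlinked chords are nested or cut off disjoint closed arcs. -/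
theorem disjoint_closedArc {p q : Crossing α} (h : ¬ Linked p q) (h1 : ¬ p ≤ q) (h2 : ¬ q ≤ p) :
    Disjoint p.closedArc q.closedArc := by
  have hne : p ≠ q := fun e => h1 e.le
  have e1 : p.fst ≠ q.fst := fun e => hne (eq_of_fst_eq e)
  have e2 : p.snd ≠ q.snd := fun e => hne (eq_of_snd_eq e)
  have e3 : p.fst ≠ q.snd := fun e => fst_ne_snd_of_ne hne (pos_inj.1 e)
  have e4 : p.snd ≠ q.fst := fun e => snd_ne_fst_of_ne hne (pos_inj.1 e)
  have n1 : ¬ (q.fst < p.fst ∧ p.snd < q.snd) := fun e => h1 (Or.inr e)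
  have n2 : ¬ (p.fst < q.fst ∧ q.snd < p.snd) := fun e => h2 (Or.inr e)
  rw [Linked] at h
  have hp := p.fst_lt_snd
  have hq := q.fst_lt_snd
  rw [disjoint_left]
  rintro x ⟨h3, h4⟩ ⟨h5, h6⟩
  rcases lt_or_gt_of_ne e1 with a | a <;> rcases lt_or_gt_of_ne e2 with b | b
  · exact h (Or.inl ⟨a, lt_of_le_of_ne (h5.trans h4) (Ne.symm e4), b⟩)
  · exact n2 ⟨a, b⟩
  · exact n1 ⟨a, b⟩
  · exact h (Or.inr ⟨a, lt_of_le_of_ne (h3.trans h6) e3, b⟩)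

end Crossing

variable {H : Finset (Crossing α)}

theorem mem_faceArcs_none {x : S1} : x ∈ faceArcs H none ↔ ∀ q ∈ H, x ∉ q.arc := by
  simp only [Crossing.mem_arc_iff]; rfl

theorem mem_faceArcs_some {p : Crossing α} {x : S1} :
    x ∈ faceArcs H (some p) ↔ x ∈ p.closedArc ∧ ∀ q ∈ H, q < p → x ∉ q.arc := by
  simp only [Crossing.mem_arc_iff, ← Crossing.inside_iff_lt]; rfl

theorem isClosed_faceArcs (H : Finset (Crossing α)) (v : Option (Crossing α)) :
    IsClosed (faceArcs H v) := by
  cases v with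
  | none =>
    have : faceArcs H none = ⋂ q ∈ H, q.arcᶜ := by ext x; simp [mem_faceArcs_none]
    rw [this]
    exact isClosed_biInter fun q _ => q.isOpen_arc.isClosed_compl
  | some p =>
    have : faceArcs H (some p) = p.closedArc ∩ ⋂ q ∈ {q | q ∈ H ∧ q < p}, q.arcᶜ := by
      ext x; simp [mem_faceArcs_some]
    rw [this]
    exact p.isClosed_closedArc.inter (isClosed_biInter fun q _ => q.isOpen_arc.isClosed_compl)

theorem faceBase_mem_faceArcs (H : Finset (Crossing α)) (v : Option (Crossing α)) :
    faceBase α v ∈ faceArcs H v := by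
  cases v with
  | none => exact mem_faceArcs_none.2 fun q _ => q.base_notMem_arc
  | some p =>
    refine mem_faceArcs_some.2 ⟨p.fst_mem_closedArc, fun q _ hq h => ?_⟩
    rw [Crossing.mem_arc_iff] at h
    exact absurd h.1 (not_lt.2 (Crossing.lt_iff.1 hq).1.le)

/-- A point on the boundary of a face is an inner point of one of the arcs of the face, unless it is
an endpoint of a chord. -/
theorem faceArcs_mem_nhds {v : Option (Crossing α)} {x : S1} (hx : x ∈ faceArcs H v)
    (hv : ∀ p ∈ v, p ∈ H) (h : ∀ q ∈ H, x ≠ q.1.1 ∧ x ≠ q.1.2) : faceArcs H v ∈ nhds x := by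
  cases v with
  | none =>
    rw [mem_faceArcs_none] at hx
    filter_upwards [(Filter.eventually_all_finset H).2 fun q hq =>
      Crossing.compl_arc_mem_nhds (hx q hq) (h q hq).1 (h q hq).2] with y hy
    exact mem_faceArcs_none.2 hy
  | some p =>
    rw [mem_faceArcs_some, Crossing.mem_closedArc_iff] at hx
    have hp := h p (hv p rfl)
    have hxp : x ∈ p.arc := by
      rcases hx.1 with e | e | e
      exacts [absurd e hp.1, absurd e hp.2, e]
    -- a neighborhood of `x` avoids the arcs of the finitely many chords beyond `p`
    have h1 : ∀ᶠ y in nhds x, ∀ q ∈ H, q < p → y ∉ q.arc := by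
      refine (Filter.eventually_all_finset H).2 fun q hq => ?_
      by_cases hqp : q < p
      · filter_upwards [Crossing.compl_arc_mem_nhds (hx.2 q hq hqp) (h q hq).1 (h q hq).2]
          with y hy _ using hy
      · exact Filter.Eventually.of_forall fun y h => absurd h hqp
    filter_upwards [h1, p.isOpen_arc.mem_nhds hxp] with y hy hyp
    exact mem_faceArcs_some.2 ⟨Crossing.mem_closedArc_iff.2 (Or.inr (Or.inr hyp)), hy⟩

/-- Pointed loops which follow `α` along the same arcs, one of them up to an ambient isotopy, are
isotopic. -/
theorem mk_eq_of_collapse {A : Set S1} {b : S1} {β γ : PointedLoop M} {h : AmbientIsotopy M}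
    {g g' : S1 → S1} (hg : IsCollapse A g) (hg' : IsCollapse A g') (hA : IsClosed A)
    (hbA : b ∈ A) (hβ : ∀ x ∈ A, β.toFun (g x) = α.toFun x)
    (hγ : ∀ x ∈ A, γ.toFun (g' x) = h.homeo 1 (α.toFun x)) (hb : β.base = g b)
    (hb' : γ.base = g' b) : (⟦β⟧ : PointedClass M) = ⟦γ⟧ := by
  obtain ⟨f, hf⟩ := hg.exists_reparam hg'
  refine Quotient.sound ⟨h, f, fun y => ?_, ?_⟩
  · obtain ⟨x, hx, rfl⟩ := hg'.exists_mem_eq hA ⟨b, hbA⟩ y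
    rw [hγ x hx, hf, hβ x hx]
  · rw [hb, hb', hf]

theorem faceClass_eq_mk {v : Option (Crossing α)} {γ : PointedLoop M} {h : AmbientIsotopy M}
    {g : S1 → S1} (hex : ∃ β, IsFaceLoop α H v β) (hg : IsCollapse (faceArcs H v) g)
    (hγ : ∀ x ∈ faceArcs H v, γ.toFun (g x) = h.homeo 1 (α.toFun x))
    (hb : γ.base = g (faceBase α v)) : faceClass α H v = ⟦γ⟧ := by
  rw [faceClass, dif_pos hex]
  obtain ⟨g', hg', hβ, hb'⟩ := hex.choose_spec
  exact mk_eq_of_collapse hg' hg (isClosed_faceArcs H v) (faceBase_mem_faceArcs H v) hβ hγ hb' hb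

/-- The loop of a face is unique up to isotopy. -/
theorem IsFaceLoop.faceClass_eq {v : Option (Crossing α)} {β : PointedLoop M}
    (h : IsFaceLoop α H v β) : faceClass α H v = ⟦β⟧ := by
  obtain ⟨g, hg, hβ, hb⟩ := h
  exact faceClass_eq_mk (h := .refl M) ⟨β, g, hg, hβ, hb⟩ hg hβ hb

end Arcs

/-! ### Loops following a part of another loop -/

section Follows

variable {M : Type*} [TopologicalSpace M] [ChartedSpace (EuclideanHalfSpace 2) M]

/-- Up to the ambient isotopy `h`, the loop `β` follows `α` along the set `A` of parameters, and
skips the gaps of `A`, which are collapsed by `g`; its base point comes from the first point `b` of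
`A`, and at an end of a gap the loop `α` is at a crossing which is met again at another point of `A`
with the same image under `g`. The case `A = univ` is that of isotopic loops. -/
structure Follows (α β : PointedLoop M) (A : Set S1) (b : S1) (h : AmbientIsotopy M)
    (g : S1 → S1) : Prop where
  collapse : IsCollapse A g
  closed : IsClosed A
  follow : ∀ x ∈ A, β.toFun (g x) = h.homeo 1 (α.toFun x)
  base : β.base = g b
  base_mem : b ∈ A
  base_first : ∀ x ∈ A, pos α.base b ≤ pos α.base x
  boundary : ∀ x ∈ A, A ∈ nhds x ∨ ∃ x' ∈ A, x' ≠ x ∧ α.toFun x' = α.toFun x ∧ g x' = g x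

/-- Both preimages of the crossing are inner points of `A`. -/
def Crossing.IsInner {α : PointedLoop M} (A : Set S1) (q : Crossing α) : Prop :=
  A ∈ nhds q.1.1 ∧ A ∈ nhds q.1.2

namespace Follows

variable {α β : PointedLoop M} {A : Set S1} {b : S1} {h : AmbientIsotopy M} {g : S1 → S1}

theorem exists_mem_eq (s : Follows α β A b h g) (y : S1) : ∃ x ∈ A, g x = y :=
  s.collapse.exists_mem_eq s.closed ⟨b, s.base_mem⟩ y

theorem apply_eq_iff (s : Follows α β A b h g) {x y : S1} (hx : x ∈ A) (hy : y ∈ A) :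
    β.toFun (g x) = β.toFun (g y) ↔ α.toFun x = α.toFun y := by
  rw [s.follow x hx, s.follow y hy, (h.homeo 1).injective.eq_iff]

theorem pos_lt_of_lt (s : Follows α β A b h g) {x y : S1} (hx : A ∈ nhds x) (hy : A ∈ nhds y)
    (hlt : pos α.base x < pos α.base y) : pos β.base (g x) < pos β.base (g y) := by
  have hxy : x ≠ y := fun e => by rw [e] at hlt; exact lt_irrefl _ hlt
  rw [s.base]
  rcases (s.base_first x (mem_of_mem_nhds hx)).lt_or_eq with h1 | h1
  · have hbx : x ≠ b := fun e => by rw [e] at h1; exact lt_irrefl _ h1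
    have hby : y ≠ b := fun e => by rw [e] at hlt; exact lt_asymm h1 hlt
    have h2 : sbtw b x y := (sbtw_iff_pos_base α.base).2 (Or.inl ⟨h1, hlt⟩)
    exact (sbtw_iff_pos.1 (s.collapse.sbtw_map h2 (s.collapse.ne_of_mem_nhds hx hbx).symm
      (s.collapse.ne_of_mem_nhds hx hxy) (s.collapse.ne_of_mem_nhds hy hby))).2
  · rw [pos_inj] at h1
    rw [h1, pos_self, pos_pos_iff]
    exact s.collapse.ne_of_mem_nhds hy hxy.symm

theorem pos_lt_iff (s : Follows α β A b h g) {x y : S1} (hx : A ∈ nhds x) (hy : A ∈ nhds y) :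
    pos β.base (g x) < pos β.base (g y) ↔ pos α.base x < pos α.base y := by
  refine ⟨fun hlt => ?_, s.pos_lt_of_lt hx hy⟩
  by_contra hn
  rcases (not_lt.1 hn).lt_or_eq with h1 | h1
  · exact lt_asymm hlt (s.pos_lt_of_lt hy hx h1)
  · rw [pos_inj.1 h1] at hlt; exact lt_irrefl _ hlt

/-- The preimages of a crossing of `β` are images of inner points of `A`, because the ends of the
gaps are glued in pairs. -/
theorem exists_mem_nhds_of_apply_eq (s : Follows α β A b h g) {y y' : S1} (hne : y ≠ y')
    (he : β.toFun y = β.toFun y') : ∃ x, A ∈ nhds x ∧ g x = y := by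
  obtain ⟨x, hx, rfl⟩ := s.exists_mem_eq y
  obtain ⟨x', hx', rfl⟩ := s.exists_mem_eq y'
  refine ⟨x, (s.boundary x hx).resolve_right ?_, rfl⟩
  rintro ⟨z, hz, hzx, hαz, hgz⟩
  rw [s.apply_eq_iff hx hx'] at he
  rcases α.generic.double z x x' hαz he with e | e | e
  · exact hzx e
  · exact hne (by rw [e])
  · exact hne (by rw [← hgz, e])

theorem exists_isInner (s : Follows α β A b h g) (r : Crossing β) :
    ∃ q : Crossing α, q.IsInner A ∧ g q.1.1 = r.1.1 ∧ g q.1.2 = r.1.2 := by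
  obtain ⟨x, hx, hx'⟩ := s.exists_mem_nhds_of_apply_eq r.fst_ne_snd r.apply_eq
  obtain ⟨y, hy, hy'⟩ := s.exists_mem_nhds_of_apply_eq r.fst_ne_snd.symm r.apply_eq.symm
  refine ⟨⟨(x, y), ?_, ?_⟩, ⟨hx, hy⟩, hx', hy'⟩
  · rw [← s.pos_lt_iff hx hy, hx', hy']; exact r.fst_lt_snd
  · rw [← s.apply_eq_iff (mem_of_mem_nhds hx) (mem_of_mem_nhds hy), hx', hy']; exact r.apply_eq

/-- The crossing of `α` which corresponds to a crossing of `β`. -/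
def pull (s : Follows α β A b h g) (r : Crossing β) : Crossing α := (s.exists_isInner r).choose

theorem pull_isInner (s : Follows α β A b h g) (r : Crossing β) : (s.pull r).IsInner A :=
  (s.exists_isInner r).choose_spec.1

theorem map_pull_fst (s : Follows α β A b h g) (r : Crossing β) : g (s.pull r).1.1 = r.1.1 :=
  (s.exists_isInner r).choose_spec.2.1

theorem map_pull_snd (s : Follows α β A b h g) (r : Crossing β) : g (s.pull r).1.2 = r.1.2 :=
  (s.exists_isInner r).choose_spec.2.2

theorem pull_injective (s : Follows α β A b h g) : Function.Injective s.pull := fun r r' e => by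
  apply Crossing.eq_of_fst_eq
  rw [Crossing.fst, Crossing.fst, ← s.map_pull_fst r, e, s.map_pull_fst]

theorem exists_pull_eq (s : Follows α β A b h g) {q : Crossing α} (hq : q.IsInner A) :
    ∃ r, s.pull r = q := by
  have h1 : pos β.base (g q.1.1) < pos β.base (g q.1.2) := s.pos_lt_of_lt hq.1 hq.2 q.fst_lt_snd
  let r : Crossing β := ⟨(g q.1.1, g q.1.2), h1,
    (s.apply_eq_iff (mem_of_mem_nhds hq.1) (mem_of_mem_nhds hq.2)).2 q.apply_eq⟩
  refine ⟨r, Crossing.eq_of_fst_eq (congrArg (pos α.base) (?_ : (s.pull r).1.1 = q.1.1))⟩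
  by_contra hne
  exact s.collapse.ne_of_mem_nhds hq.1 (Ne.symm hne) (s.map_pull_fst r).symm

theorem pull_lt_iff (s : Follows α β A b h g) {r r' : Crossing β} :
    s.pull r < s.pull r' ↔ r < r' := by
  have h1 := s.pos_lt_iff (s.pull_isInner r').1 (s.pull_isInner r).1
  have h2 := s.pos_lt_iff (s.pull_isInner r).2 (s.pull_isInner r').2
  rw [s.map_pull_fst, s.map_pull_fst] at h1
  rw [s.map_pull_snd, s.map_pull_snd] at h2
  rw [Crossing.lt_iff, Crossing.lt_iff]
  exact (and_congr h1 h2).symm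

theorem pull_le_iff (s : Follows α β A b h g) {r r' : Crossing β} :
    s.pull r ≤ s.pull r' ↔ r ≤ r' := by
  rw [le_iff_eq_or_lt, le_iff_eq_or_lt, s.pull_lt_iff, s.pull_injective.eq_iff]

theorem linked_pull_iff (s : Follows α β A b h g) {r r' : Crossing β} :
    Crossing.Linked (s.pull r) (s.pull r') ↔ Crossing.Linked r r' := by
  have h1 : ∀ r r', (s.pull r).fst < (s.pull r').fst ↔ r.fst < r'.fst := fun r r' => by
    have := s.pos_lt_iff (s.pull_isInner r).1 (s.pull_isInner r').1
    rw [s.map_pull_fst, s.map_pull_fst] at this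
    exact this.symm
  have h2 : ∀ r r', (s.pull r).fst < (s.pull r').snd ↔ r.fst < r'.snd := fun r r' => by
    have := s.pos_lt_iff (s.pull_isInner r).1 (s.pull_isInner r').2
    rw [s.map_pull_fst, s.map_pull_snd] at this
    exact this.symm
  have h3 : ∀ r r', (s.pull r).snd < (s.pull r').snd ↔ r.snd < r'.snd := fun r r' => by
    have := s.pos_lt_iff (s.pull_isInner r).2 (s.pull_isInner r').2
    rw [s.map_pull_snd, s.map_pull_snd] at this
    exact this.symm
  simp only [Crossing.Linked, h1, h2, h3]

theorem sbtw_pull_iff (s : Follows α β A b h g) {r r' r'' : Crossing β} :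
    sbtw (s.pull r).1.1 (s.pull r').1.1 (s.pull r'').1.1 ↔ sbtw r.1.1 r'.1.1 r''.1.1 := by
  rw [← s.collapse.sbtw_map_iff (s.pull_isInner r).1 (s.pull_isInner r'').1, s.map_pull_fst,
    s.map_pull_fst, s.map_pull_fst]

theorem sign_pull [OrientedSurface M] (s : Follows α β A b h g) (r : Crossing β) :
    (s.pull r).sign = r.sign := by
  have := α.generic.det2_tangent_pos_iff β.generic h s.collapse s.follow (s.pull_isInner r).1
    (s.pull_isInner r).2 (s.pull r).fst_ne_snd (s.pull r).apply_eq
  rw [s.map_pull_fst, s.map_pull_snd] at this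
  simp only [Crossing.sign, this]

theorem mem_arc_pull_iff (s : Follows α β A b h g) {r : Crossing β} {x : S1} :
    x ∈ (s.pull r).arc ↔ g x ∈ r.arc := by
  rw [Crossing.arc, Crossing.arc, mem_cIoo, mem_cIoo,
    ← s.collapse.sbtw_map_iff (s.pull_isInner r).1 (s.pull_isInner r).2, s.map_pull_fst,
    s.map_pull_snd]

theorem mem_closedArc_pull_iff (s : Follows α β A b h g) {r : Crossing β} {x : S1} :
    x ∈ (s.pull r).closedArc ↔ g x ∈ r.closedArc := by
  rw [Crossing.mem_closedArc_iff, Crossing.mem_closedArc_iff, s.mem_arc_pull_iff]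
  have h1 : x = (s.pull r).1.1 ↔ g x = r.1.1 := by
    rw [← s.map_pull_fst]
    refine ⟨fun e => e ▸ rfl, fun e => ?_⟩
    by_contra hne
    exact s.collapse.ne_of_mem_nhds (s.pull_isInner r).1 (Ne.symm hne) e.symm
  have h2 : x = (s.pull r).1.2 ↔ g x = r.1.2 := by
    rw [← s.map_pull_snd]
    refine ⟨fun e => e ▸ rfl, fun e => ?_⟩
    by_contra hne
    exact s.collapse.ne_of_mem_nhds (s.pull_isInner r).2 (Ne.symm hne) e.symm
  rw [h1, h2]

/-- Correspondence of crossings as an embedding. -/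
def pullEmb (s : Follows α β A b h g) : Crossing β ↪ Crossing α := ⟨s.pull, s.pull_injective⟩

theorem mem_map_pullEmb (s : Follows α β A b h g) {K : Finset (Crossing β)} {r : Crossing β} :
    s.pull r ∈ K.map s.pullEmb ↔ r ∈ K := Finset.mem_map' s.pullEmb

theorem isInner_of_mem_map (s : Follows α β A b h g) {K : Finset (Crossing β)} {q : Crossing α}
    (hq : q ∈ K.map s.pullEmb) : q.IsInner A := by
  obtain ⟨r, -, rfl⟩ := Finset.mem_map.1 hq
  exact s.pull_isInner r

theorem isCut_map_iff (s : Follows α β A b h g) {K : Finset (Crossing β)} :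
    IsCut (K.map s.pullEmb) ↔ IsCut K := by
  constructor
  · intro hK p hp q hq hpq hl
    exact hK _ (s.mem_map_pullEmb.2 hp) _ (s.mem_map_pullEmb.2 hq) (s.pull_injective.ne hpq)
      (s.linked_pull_iff.2 hl)
  · intro hK p hp q hq hpq hl
    obtain ⟨p', hp', rfl⟩ := Finset.mem_map.1 hp
    obtain ⟨q', hq', rfl⟩ := Finset.mem_map.1 hq
    exact hK p' hp' q' hq' (fun e => hpq (e ▸ rfl)) (s.linked_pull_iff.1 hl)

theorem cutSign_map [OrientedSurface M] (s : Follows α β A b h g) (K : Finset (Crossing β)) :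
    cutSign (K.map s.pullEmb) = cutSign K := by
  simp only [cutSign, Finset.prod_map]
  exact Finset.prod_congr rfl fun r _ => s.sign_pull r

theorem exists_map_eq (s : Follows α β A b h g) {G : Finset (Crossing α)}
    (hG : ∀ q ∈ G, q.IsInner A) : ∃ K : Finset (Crossing β), K.map s.pullEmb = G := by
  classical
  refine ⟨Finset.preimage G s.pull s.pull_injective.injOn, ?_⟩
  ext q
  rw [Finset.mem_map]
  constructor
  · rintro ⟨r, hr, rfl⟩
    exact Finset.mem_preimage.1 hr
  · intro hq
    obtain ⟨r, rfl⟩ := s.exists_pull_eq (hG q hq)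
    exact ⟨r, Finset.mem_preimage.2 hq, rfl⟩

/-- A face of a face of a loop is a face of the loop. -/
theorem collapse_comp (s : Follows α β A b h g) {K : Finset (Crossing β)}
    {w : Option (Crossing β)} (hw : ∀ p ∈ w, p ∈ K) {g' : S1 → S1}
    (hg' : IsCollapse (faceArcs K w) g') :
    IsCollapse (A ∩ g ⁻¹' faceArcs K w) (g' ∘ g) := by
  refine s.collapse.comp hg' s.exists_mem_eq fun x x' hne he hx => ?_
  refine faceArcs_mem_nhds hx hw fun r _ => ⟨fun e => ?_, fun e => ?_⟩
  · rw [← s.map_pull_fst] at e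
    have h1 : x = (s.pull r).1.1 := by
      by_contra hn; exact s.collapse.ne_of_mem_nhds (s.pull_isInner r).1 (Ne.symm hn) e.symm
    have h2 : x' = (s.pull r).1.1 := by
      by_contra hn
      exact s.collapse.ne_of_mem_nhds (s.pull_isInner r).1 (Ne.symm hn) (e.symm.trans he)
    exact hne (h1.trans h2.symm)
  · rw [← s.map_pull_snd] at e
    have h1 : x = (s.pull r).1.2 := by
      by_contra hn; exact s.collapse.ne_of_mem_nhds (s.pull_isInner r).2 (Ne.symm hn) e.symm
    have h2 : x' = (s.pull r).1.2 := by
      by_contra hn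
      exact s.collapse.ne_of_mem_nhds (s.pull_isInner r).2 (Ne.symm hn) (e.symm.trans he)
    exact hne (h1.trans h2.symm)

/-- The loop of a face of `β` is the loop of the corresponding face of `α`. -/
theorem faceClass_eq (s : Follows α β A b h g) {K : Finset (Crossing β)}
    {w : Option (Crossing β)} (hw : ∀ p ∈ w, p ∈ K) {G : Finset (Crossing α)}
    {v : Option (Crossing α)} (hface : faceArcs G v = A ∩ g ⁻¹' faceArcs K w)
    (hbase : g (faceBase α v) = faceBase β w) (hexα : ∃ γ, IsFaceLoop α G v γ)
    (hexβ : ∃ γ, IsFaceLoop β K w γ) : faceClass α G v = faceClass β K w := by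
  obtain ⟨γ, hγ⟩ := hexβ
  rw [hγ.faceClass_eq]
  obtain ⟨g', hg', hf, hb⟩ := hγ
  refine faceClass_eq_mk (h := h) (g := g' ∘ g) hexα (hface ▸ s.collapse_comp hw hg') ?_ ?_
  · intro x hx
    rw [hface] at hx
    rw [Function.comp_apply, hf _ hx.2, s.follow x hx.1]
  · rw [hb, Function.comp_apply, hbase]

end Follows

section Instances

variable {α β : PointedLoop M}

/-- Isotopic loops follow each other along the whole circle. -/
theorem exists_follows_of_isotopic (hαβ : PointedLoop.Isotopic α β) :
    ∃ h g, Follows α β univ α.base h g := by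
  obtain ⟨h, f, hf, hb⟩ := hαβ
  refine ⟨h, f.symm.homeo, ⟨.of_reparam f.symm, isClosed_univ, fun x _ => ?_, ?_, trivial,
    fun x _ => ?_, fun x _ => Or.inl Filter.univ_mem⟩⟩
  · rw [hf]; simp [Reparam.symm]
  · rw [← hb]; simp [Reparam.symm]
  · rw [pos_self]; exact pos_nonneg _ _

/-- A simple cut is a cut none of whose chords lies beyond another one. -/
theorem isSimpleCut_iff {c : Finset (Crossing α)} :
    IsSimpleCut c ↔ IsCut c ∧ ∀ p ∈ c, ∀ q ∈ c, ¬ p < q := by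
  refine and_congr_right fun hc => ⟨fun h p hp q hq hpq => ?_, fun h p hp => ?_⟩
  · exact mem_faceArcs_none.1 (h p hp).1 q hq
      (Crossing.closedArc_subset_arc hpq p.fst_mem_closedArc)
  · have key : ∀ q ∈ c, q ≠ p → Disjoint p.closedArc q.closedArc := fun q hq hqp =>
      Crossing.disjoint_closedArc (hc p hp q hq hqp.symm)
        (fun e => h p hp q hq (lt_of_le_of_ne e hqp.symm))
        (fun e => h q hq p hp (lt_of_le_of_ne e hqp))
    constructor
    · refine mem_faceArcs_none.2 fun q hq hx => ?_
      rcases eq_or_ne q p with rfl | hqp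
      · exact lt_irrefl _ (Crossing.mem_arc_iff.1 hx).1
      · exact disjoint_left.1 (key q hq hqp) p.fst_mem_closedArc
          (Crossing.mem_closedArc_iff.2 (Or.inr (Or.inr hx)))
    · refine mem_faceArcs_none.2 fun q hq hx => ?_
      rcases eq_or_ne q p with rfl | hqp
      · exact lt_irrefl _ (Crossing.mem_arc_iff.1 hx).2
      · exact disjoint_left.1 (key q hq hqp) p.snd_mem_closedArc
          (Crossing.mem_closedArc_iff.2 (Or.inr (Or.inr hx)))

variable {c : Finset (Crossing α)} {g : S1 → S1}

/-- The loop obtained by skipping the arcs of a simple cut follows `α` along the root face; the ends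
of this face are crossings of `α` that become corners. -/
theorem follows_root (hc : IsSimpleCut c) (hg : IsCollapse (faceArcs c none) g)
    (hf : ∀ x ∈ faceArcs c none, β.toFun (g x) = α.toFun x) (hb : β.base = g α.base) :
    Follows α β (faceArcs c none) α.base (.refl M) g where
  collapse := hg
  closed := isClosed_faceArcs _ _
  follow := hf
  base := hb
  base_mem := faceBase_mem_faceArcs c none
  base_first x _ := by rw [pos_self]; exact pos_nonneg _ _
  boundary x hx := by
    by_cases h : ∀ q ∈ c, x ≠ q.1.1 ∧ x ≠ q.1.2
    · exact Or.inl (faceArcs_mem_nhds hx (by simp) h)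
    · right
      push Not at h
      obtain ⟨q, hq, hxq⟩ := h
      -- the two ends of a skipped arc have the same image
      have hgq : g q.1.1 = g q.1.2 := by
        refine (hg.fiber _ _).2 (Or.inr (Or.inl (disjoint_left.2 fun z hz hz' => ?_)))
        exact mem_faceArcs_none.1 hz' q hq hz
      by_cases h1 : x = q.1.1
      · exact ⟨q.1.2, (hc.2 q hq).2, by rw [h1]; exact q.fst_ne_snd.symm,
          by rw [h1]; exact q.apply_eq.symm, by rw [h1, hgq]⟩
      · have h2 := hxq h1
        exact ⟨q.1.1, (hc.2 q hq).1, by rw [h2]; exact q.fst_ne_snd,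
          by rw [h2]; exact q.apply_eq, by rw [h2, hgq]⟩

/-- The double points of the root face of `c` are the crossings that do not lie beyond a chord of
`c`. -/
theorem isInner_root_iff {q : Crossing α}
    (hq : ∀ e ∈ c, ¬ Crossing.Linked q e) :
    q.IsInner (faceArcs c none) ↔ ∀ e ∈ c, ¬ q ≤ e := by
  constructor
  · rintro ⟨h1, -⟩ e he hqe
    rcases eq_or_lt_of_le hqe with rfl | hlt
    · obtain ⟨z, hz, hz'⟩ := exists_mem_cIoo_of_mem_nhds h1 q.fst_ne_snd
      exact mem_faceArcs_none.1 hz' q he hz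
    · exact mem_faceArcs_none.1 (mem_of_mem_nhds h1) e he
        (Crossing.closedArc_subset_arc hlt q.fst_mem_closedArc)
  · intro h
    have key : ∀ e ∈ c, q.1.1 ∉ e.arc ∧ q.1.2 ∉ e.arc := by
      intro e he
      by_cases heq : e ≤ q
      · have h1 : ∀ x ∈ e.arc, q.fst < pos α.base x ∧ pos α.base x < q.snd := fun x hx =>
          Crossing.mem_arc_iff.1 (Crossing.arc_subset_of_le heq hx)
        exact ⟨fun hx => lt_irrefl _ (h1 _ hx).1, fun hx => lt_irrefl _ (h1 _ hx).2⟩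
      · have hd := disjoint_left.1 (Crossing.disjoint_closedArc (hq e he) (h e he) heq)
        exact ⟨fun hx => hd q.fst_mem_closedArc (Crossing.mem_closedArc_iff.2 (Or.inr (Or.inr hx))),
          fun hx => hd q.snd_mem_closedArc (Crossing.mem_closedArc_iff.2 (Or.inr (Or.inr hx)))⟩
    have hne : ∀ e ∈ c, q ≠ e := fun e he hqe => h e he hqe.le
    exact ⟨faceArcs_mem_nhds (mem_faceArcs_none.2 fun e he => (key e he).1) (by simp)
        fun e he => ⟨Crossing.fst_ne_of_ne (hne e he), Crossing.fst_ne_snd_of_ne (hne e he)⟩,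
      faceArcs_mem_nhds (mem_faceArcs_none.2 fun e he => (key e he).2) (by simp)
        fun e he => ⟨Crossing.snd_ne_fst_of_ne (hne e he), Crossing.snd_ne_of_ne (hne e he)⟩⟩

theorem faceArcs_some_of_isSimpleCut (hc : IsSimpleCut c) {p : Crossing α} (hp : p ∈ c) :
    faceArcs c (some p) = p.closedArc := by
  ext x
  rw [mem_faceArcs_some, and_iff_left_iff_imp]
  intro _ q hq hqp
  exact absurd hqp ((isSimpleCut_iff.1 hc).2 q hq p hp)

theorem closedArc_mem_nhds {p : Crossing α} {x : S1} (hx : x ∈ p.arc) : p.closedArc ∈ nhds x := by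
  filter_upwards [p.isOpen_arc.mem_nhds hx] with y hy
  exact Crossing.mem_closedArc_iff.2 (Or.inr (Or.inr hy))

/-- A loop along the arc of `p` follows `α`; it is pointed at the corner `p`. -/
theorem follows_closedArc {p : Crossing α} (hg : IsCollapse p.closedArc g)
    (hf : ∀ x ∈ p.closedArc, β.toFun (g x) = α.toFun x) (hb : β.base = g p.1.1) :
    Follows α β p.closedArc p.1.1 (.refl M) g where
  collapse := hg
  closed := p.isClosed_closedArc
  follow := hf
  base := hb
  base_mem := p.fst_mem_closedArc
  base_first x hx := hx.1
  boundary x hx := by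
    have hgp : g p.1.2 = g p.1.1 := by
      refine (hg.fiber _ _).2 (Or.inr (Or.inl (disjoint_left.2 fun z hz hz' => ?_)))
      rw [Crossing.closedArc_eq_compl] at hz'
      exact hz' hz
    rcases Crossing.mem_closedArc_iff.1 hx with h | h | h
    · right
      exact ⟨p.1.2, p.snd_mem_closedArc, by rw [h]; exact p.fst_ne_snd.symm,
        by rw [h]; exact p.apply_eq.symm, by rw [h, hgp]⟩
    · right
      exact ⟨p.1.1, p.fst_mem_closedArc, by rw [h]; exact p.fst_ne_snd,
        by rw [h]; exact p.apply_eq, by rw [h, hgp]⟩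
    · exact Or.inl (closedArc_mem_nhds h)

theorem isInner_closedArc_iff {p q : Crossing α} : q.IsInner p.closedArc ↔ q < p := by
  constructor
  · rintro ⟨h1, h2⟩
    have h3 : ∀ {x}, p.closedArc ∈ nhds x → x ∈ p.arc := by
      intro x hx
      rcases Crossing.mem_closedArc_iff.1 (mem_of_mem_nhds hx) with h | h | h
      · subst h
        obtain ⟨z, hz, hz'⟩ := exists_mem_cIoo_of_mem_nhds' hx p.fst_ne_snd
        rw [Crossing.closedArc_eq_compl] at hz'
        exact absurd hz hz'
      · subst h
        obtain ⟨z, hz, hz'⟩ := exists_mem_cIoo_of_mem_nhds hx p.fst_ne_snd.symm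
        rw [Crossing.closedArc_eq_compl] at hz'
        exact absurd hz hz'
      · exact h
    exact Crossing.lt_iff.2 ⟨(Crossing.mem_arc_iff.1 (h3 h1)).1, (Crossing.mem_arc_iff.1 (h3 h2)).2⟩
  · intro h
    have h1 := Crossing.closedArc_subset_arc h
    exact ⟨closedArc_mem_nhds (h1 q.fst_mem_closedArc), closedArc_mem_nhds (h1 q.snd_mem_closedArc)⟩

end Instances

end Follows

/-! ### The loop along a single arc -/

section ScaledPaths

variable {M : Type*} [TopologicalSpace M] [ChartedSpace (EuclideanHalfSpace 2) M]

theorem hasDerivWithinAt_extChartAt {f : ℝ → M} {s : Set ℝ} {t : ℝ}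
    (hf : MDifferentiableWithinAt 𝓘(ℝ, ℝ) (𝓡∂ 2) f s t) :
    HasDerivWithinAt (fun u => (chartAt (EuclideanHalfSpace 2) (f t)).extend (𝓡∂ 2) (f u))
      (mfderivWithin 𝓘(ℝ, ℝ) (𝓡∂ 2) f s t (1 : ℝ) : EuclideanSpace ℝ (Fin 2)) s t := by
  have h := hf.hasMFDerivWithinAt.2
  simp only [writtenInExtChartAt, mfld_simps] at h
  have h2 : HasFDerivWithinAt
      (fun u => (chartAt (EuclideanHalfSpace 2) (f t)).extend (𝓡∂ 2) (f u))
      (show ℝ →L[ℝ] EuclideanSpace ℝ (Fin 2) from mfderivWithin 𝓘(ℝ, ℝ) (𝓡∂ 2) f s t) s t := h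
  exact h2.hasDerivWithinAt

/-- The derivative of a path which is traversed at a constant speed `c`. -/
theorem mfderivWithin_scale {f f' : ℝ → M} {s : Set ℝ} {c : ℝ}
    (hf : MDifferentiableWithinAt 𝓘(ℝ, ℝ) (𝓡∂ 2) f s 0) (hs : MapsTo (fun u => c * u) s s)
    (hu : UniqueDiffWithinAt ℝ s 0) (h0 : f' 0 = f 0)
    (h : ∀ᶠ u in nhdsWithin 0 s, f' u = f (c * u)) :
    (mfderivWithin 𝓘(ℝ, ℝ) (𝓡∂ 2) f' s 0 (1 : ℝ) : EuclideanSpace ℝ (Fin 2)) =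
      c • (mfderivWithin 𝓘(ℝ, ℝ) (𝓡∂ 2) f s 0 (1 : ℝ) : EuclideanSpace ℝ (Fin 2)) := by
  have hsm : MDifferentiableWithinAt 𝓘(ℝ, ℝ) 𝓘(ℝ, ℝ) (fun u : ℝ => c * u) s 0 :=
    (by fun_prop : DifferentiableWithinAt ℝ (fun u : ℝ => c * u) s 0).mdifferentiableWithinAt
  have hc0 : (fun u : ℝ => c * u) 0 = 0 := mul_zero c
  have hf2 : MDifferentiableWithinAt 𝓘(ℝ, ℝ) (𝓡∂ 2) f s ((fun u : ℝ => c * u) 0) := by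
    rw [hc0]; exact hf
  have h1 : MDifferentiableWithinAt 𝓘(ℝ, ℝ) (𝓡∂ 2) f' s 0 := by
    refine MDifferentiableWithinAt.congr_of_eventuallyEq (f := f ∘ fun u => c * u)
      (hf2.comp 0 hsm hs) h ?_
    simp only [Function.comp_apply, mul_zero, h0]
  have h2 := hasDerivWithinAt_extChartAt h1
  have h3 := hasDerivWithinAt_extChartAt hf
  rw [h0] at h2
  have h4 : HasDerivWithinAt (fun u : ℝ => c * u) c s 0 := by
    simpa using (hasDerivWithinAt_id (0 : ℝ) s).const_mul c
  have h5 := HasDerivWithinAt.scomp (h := fun u : ℝ => c * u) (h' := c)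
    (g₁ := fun u => (chartAt (EuclideanHalfSpace 2) (f 0)).extend (𝓡∂ 2) (f u))
    (g₁' := (mfderivWithin 𝓘(ℝ, ℝ) (𝓡∂ 2) f s 0 (1 : ℝ) : EuclideanSpace ℝ (Fin 2))) (0 : ℝ)
    (by simpa only [mul_zero] using h3) h4 hs
  have h6 := h5.congr_of_eventuallyEq
    (f₁ := fun u => (chartAt (EuclideanHalfSpace 2) (f 0)).extend (𝓡∂ 2) (f' u))
    (h.mono fun u hu => by simp only [Function.comp_apply, hu])
    (by simp only [Function.comp_apply, h0, mul_zero])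
  exact UniqueDiffWithinAt.eq_deriv (F := EuclideanSpace ℝ (Fin 2)) s hu h2 h6

theorem contMDiffOn_scale {f f' : ℝ → M} {s t : Set ℝ} {c : ℝ}
    (hf : ContMDiffOn 𝓘(ℝ, ℝ) (𝓡∂ 2) ∞ f s) (hs : MapsTo (fun u => c * u) t s)
    (h : ∀ u ∈ t, f' u = f (c * u)) : ContMDiffOn 𝓘(ℝ, ℝ) (𝓡∂ 2) ∞ f' t := by
  have hsm : ContMDiffOn 𝓘(ℝ, ℝ) 𝓘(ℝ, ℝ) ∞ (fun u : ℝ => c * u) t :=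
    (by fun_prop : ContDiff ℝ ∞ (fun u : ℝ => c * u)).contMDiff.contMDiffOn
  exact (hf.comp hsm hs).congr h

end ScaledPaths

theorem mem_compl_cIoo_iff {a a' x : S1} (h : a ≠ a') :
    x ∈ (cIoo a' a)ᶜ ↔ pos a x ≤ pos a a' := by
  rw [mem_compl_iff, mem_cIoo, sbtw_iff_pos_base a, pos_self, ← not_lt, not_iff_not]
  constructor
  · rintro (h1 | h1 | h1)
    · exact h1.1
    · exact absurd h1.1 (not_lt.2 (pos_nonneg _ _))
    · exact h1.2
  · exact fun h1 => Or.inr (Or.inr ⟨pos_pos_iff.2 h.symm, h1⟩)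

/-- Collapsing the open arc from `a'` to `a`. -/
theorem exists_isCollapse_compl_cIoo {a a' : S1} (h : a ≠ a') :
    ∃ g : S1 → S1, IsCollapse (cIoo a' a)ᶜ g ∧
      (∀ x, pos a x < pos a a' → pos 0 (g x) = pos a x / pos a a') ∧
      ∀ x, pos a a' ≤ pos a x → g x = 0 := by
  set c := pos a a' with hc
  have hc0 : 0 < c := pos_pos_iff.2 h.symm
  have hc1 : c < 1 := pos_lt_one _ _
  have hA : ∀ x, x ∈ (cIoo a' a)ᶜ ↔ pos a x ≤ c := fun x => mem_compl_cIoo_iff h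
  have hone : ((1 : ℝ) : S1) = 0 := AddCircle.coe_period 1
  -- stretch the arc from `a` to `a'` to the whole circle and send the rest to `0`
  let f : ℝ → S1 := fun t => ((min t c / c : ℝ) : S1)
  let g : S1 → S1 := fun x => f (pos a x)
  have hg1 : ∀ x, pos a x < c → pos 0 (g x) = pos a x / c := by
    intro x hx
    refine pos_eq_of_add_eq (div_nonneg (pos_nonneg _ _) hc0.le) ((div_lt_one hc0).2 hx) ?_
    simp only [g, f, min_eq_left hx.le, zero_add]
  have hg2 : ∀ x, c ≤ pos a x → g x = 0 := by
    intro x hx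
    simp only [g, f, min_eq_right hx, div_self hc0.ne', hone]
  have hg2' : ∀ x, c ≤ pos a x → pos 0 (g x) = 0 := fun x hx => by rw [hg2 x hx, pos_self]
  have hcont : Continuous g := by
    have h1 : Continuous (AddCircle.liftIco (1 : ℝ) 0 f) := by
      refine AddCircle.liftIco_continuous ?_ ?_
      · simp only [f, zero_add, min_eq_left hc0.le, min_eq_right hc1.le, div_self hc0.ne', hone]
        simp
      · have : Continuous f := (AddCircle.continuous_mk' (1 : ℝ)).comp (by fun_prop)
        exact this.continuousOn
    have h2 : g = fun x => AddCircle.liftIco (1 : ℝ) 0 f (x - a) := by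
      funext x
      rfl
    rw [h2]
    exact h1.comp (continuous_id.sub continuous_const)
  have hsurj : Function.Surjective g := by
    intro y
    refine ⟨a + ((c * pos 0 y : ℝ) : S1), ?_⟩
    have h0 := pos_nonneg 0 y
    have h1 := pos_lt_one 0 y
    have hlt : c * pos 0 y < c := by nlinarith
    have hp := pos_add_coe a (mul_nonneg hc0.le h0) (hlt.trans hc1)
    have := hg1 _ (by rw [hp]; exact hlt)
    rw [hp, mul_div_cancel_left₀ _ hc0.ne'] at this
    exact pos_inj.1 this
  have hlt : ∀ u v, pos 0 (g u) < pos 0 (g v) →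
      pos a v < c ∧ (pos a u < pos a v ∨ c ≤ pos a u) := by
    intro u v huv
    have hv : pos a v < c := by
      by_contra hn
      rw [hg2' v (not_lt.1 hn)] at huv
      exact absurd huv (not_lt.2 (pos_nonneg _ _))
    refine ⟨hv, ?_⟩
    by_cases hu : pos a u < c
    · rw [hg1 u hu, hg1 v hv, div_lt_div_iff_of_pos_right hc0] at huv
      exact Or.inl huv
    · exact Or.inr (not_lt.1 hu)
  -- strict cyclic order of images comes from strict cyclic order
  have hkey : ∀ u v w, pos 0 (g u) < pos 0 (g v) → pos 0 (g v) < pos 0 (g w) → sbtw u v w := by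
    intro u v w h1 h2
    obtain ⟨hv, h1⟩ := hlt u v h1
    obtain ⟨hw, h2⟩ := hlt v w h2
    have h2' : pos a v < pos a w := h2.resolve_right (not_le.2 hv)
    rw [sbtw_iff_pos_base a]
    rcases h1 with h1 | h1
    · exact Or.inl ⟨h1, h2'⟩
    · exact Or.inr (Or.inl ⟨h2', hw.trans_le h1⟩)
  have hmono : ∀ x y z, btw x y z → btw (g x) (g y) (g z) := by
    intro x y z hb
    by_contra hn
    rw [← sbtw_iff_not_btw, sbtw_iff_pos_base 0] at hn
    refine absurd hb (sbtw_iff_not_btw.1 ?_)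
    rcases hn with hn | hn | hn
    · exact hkey _ _ _ hn.1 hn.2
    · exact sbtw_cyclic_right (hkey _ _ _ hn.1 hn.2)
    · exact sbtw_cyclic_left (hkey _ _ _ hn.1 hn.2)
  -- an arc without points on the arc from `a` to `a'` is collapsed
  have hfib1 : ∀ x y, x ≠ y → Disjoint (cIoo x y) (cIoo a' a)ᶜ → g x = 0 ∧ g y = 0 := by
    intro x y hxy hd
    rw [disjoint_left] at hd
    constructor
    · refine hg2 x ?_
      by_contra hn
      rw [not_le] at hn
      obtain ⟨t, ht, ht'⟩ := ((eventually_add_mem_cIoo hxy).and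
        (Ioo_mem_nhdsGT (sub_pos.2 hn))).exists
      refine hd ht ((hA _).2 ?_)
      have : pos a (x + (t : S1)) = pos a x + t := by
        refine pos_eq_of_add_eq (add_nonneg (pos_nonneg _ _) ht'.1.le) (by linarith [ht'.2]) ?_
        rw [AddCircle.coe_add, ← add_assoc, add_pos_coe]
      rw [this]; linarith [ht'.2]
    · rcases (pos_nonneg a y).eq_or_lt with h0 | h0
      · have hp := hg1 y (by rw [← h0]; exact hc0)
        rw [← h0, zero_div, pos_eq_zero_iff] at hp
        exact hp
      · refine hg2 y ?_
        by_contra hn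
        rw [not_le] at hn
        obtain ⟨t, ht, ht'⟩ := ((eventually_add_neg_mem_cIoo hxy.symm).and
          (Ioo_mem_nhdsGT h0)).exists
        refine hd ht ((hA _).2 ?_)
        have : pos a (y + ((-t : ℝ) : S1)) = pos a y - t := by
          refine pos_eq_of_add_eq (by linarith [ht'.2]) (by linarith [ht'.1]) ?_
          rw [sub_eq_add_neg, AddCircle.coe_add, ← add_assoc, add_pos_coe]
        rw [this]; linarith [ht'.1]
  -- conversely, distinct points with the same image bound such an arc
  have hfib2 : ∀ x y, g x = g y → pos a x < pos a y →
      Disjoint (cIoo x y) (cIoo a' a)ᶜ ∨ Disjoint (cIoo y x) (cIoo a' a)ᶜ := by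
    intro x y hxy hlt'
    have hy : c ≤ pos a y := by
      by_contra hn
      rw [not_le] at hn
      have h1 := hg1 x (hlt'.trans hn)
      rw [hxy, hg1 y hn, div_left_inj' hc0.ne'] at h1
      exact hlt'.ne' h1
    by_cases hx : c ≤ pos a x
    · left
      rw [disjoint_left]
      intro z hz hz'
      rw [hA] at hz'
      rw [mem_cIoo, sbtw_iff_pos_base a] at hz
      rcases hz with h | h | h <;> linarith
    · have hx0 : pos a x = 0 := by
        have h1 := hg1 x (not_le.1 hx)
        rw [hxy, hg2' y hy, eq_comm, div_eq_zero_iff] at h1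
        exact h1.resolve_right hc0.ne'
      right
      rw [disjoint_left]
      intro z hz hz'
      rw [hA] at hz'
      rw [mem_cIoo, sbtw_iff_pos_base a] at hz
      have := pos_nonneg a z
      rcases hz with h | h | h <;> linarith
  refine ⟨g, ⟨hcont, hsurj, hmono, fun x y => ⟨fun hxy => ?_, ?_⟩⟩, hg1, hg2⟩
  · rcases lt_trichotomy (pos a x) (pos a y) with h1 | h1 | h1
    · exact Or.inr (hfib2 x y hxy h1)
    · exact Or.inl (pos_inj.1 h1)
    · exact Or.inr (hfib2 y x hxy.symm h1).symm
  · rcases eq_or_ne x y with rfl | hne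
    · exact fun _ => rfl
    rintro (h1 | h1 | h1)
    · exact absurd h1 hne
    · rw [(hfib1 x y hne h1).1, (hfib1 x y hne h1).2]
    · rw [(hfib1 y x hne.symm h1).1, (hfib1 y x hne.symm h1).2]

/-! ### Closing up an arc -/

/-- The parametrization of the arc from `a` to `a'` at constant speed. -/
def arcParam (a a' y : S1) : S1 := a + ((pos a a' * pos 0 y : ℝ) : S1)

section ArcParam

variable {a a' : S1}

theorem pos_arcParam (h : a ≠ a') (y : S1) :
    pos a (arcParam a a' y) = pos a a' * pos 0 y ∧ pos a a' * pos 0 y < pos a a' := by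
  have h0 : 0 < pos a a' := pos_pos_iff.2 h.symm
  have h1 : pos a a' * pos 0 y < pos a a' :=
    mul_lt_of_lt_one_right h0 (pos_lt_one 0 y)
  exact ⟨pos_add_coe a (mul_nonneg h0.le (pos_nonneg _ _)) (h1.trans (pos_lt_one _ _)), h1⟩

theorem arcParam_injective (h : a ≠ a') : Function.Injective (arcParam a a') := fun y z e => by
  have h0 : 0 < pos a a' := pos_pos_iff.2 h.symm
  have := congrArg (pos a) e
  rw [(pos_arcParam h y).1, (pos_arcParam h z).1] at this
  exact pos_inj.1 (mul_left_cancel₀ h0.ne' this)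

theorem arcParam_ne (h : a ≠ a') (y : S1) : arcParam a a' y ≠ a' := fun e => by
  have := pos_arcParam h y
  rw [← this.1, e] at this
  exact lt_irrefl _ this.2

theorem arcParam_zero : arcParam a a' 0 = a := by simp [arcParam]

theorem arcParam_add_of_nonneg (y : S1) {u : ℝ} (h0 : 0 ≤ pos 0 y + u) (h1 : pos 0 y + u < 1) :
    arcParam a a' (y + (u : S1)) = arcParam a a' y + ((pos a a' * u : ℝ) : S1) := by
  have : pos 0 (y + (u : S1)) = pos 0 y + u := by
    refine pos_eq_of_add_eq h0 h1 ?_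
    rw [AddCircle.coe_add, ← add_assoc, add_pos_coe]
  rw [arcParam, arcParam, this, mul_add, AddCircle.coe_add, add_assoc]

theorem arcParam_neg {u : ℝ} (h0 : -1 ≤ u) (h1 : u < 0) :
    arcParam a a' ((0 : S1) + (u : S1)) = a' + ((pos a a' * u : ℝ) : S1) := by
  have : pos 0 ((0 : S1) + (u : S1)) = 1 + u := by
    refine pos_eq_of_add_eq (by linarith) (by linarith) ?_
    have h1 : ((1 : ℝ) : S1) = 0 := AddCircle.coe_period 1
    rw [AddCircle.coe_add, h1, zero_add]
  rw [arcParam, this, mul_add, mul_one, AddCircle.coe_add, ← add_assoc, add_pos_coe]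

end ArcParam

section ArcLoop

variable {M : Type*} {α : S1 → M} {a a' : S1}

theorem continuous_comp_arcParam [TopologicalSpace M] (hα : Continuous α) (h : α a = α a') :
    Continuous fun y => α (arcParam a a' y) := by
  let f : ℝ → M := fun t => α (a + ((pos a a' * t : ℝ) : S1))
  have h1 : Continuous (AddCircle.liftIco (1 : ℝ) 0 f) := by
    refine AddCircle.liftIco_continuous ?_ (Continuous.continuousOn ?_)
    · simp only [f, zero_add, mul_zero, mul_one, AddCircle.coe_zero, add_zero, add_pos_coe, h]
    · exact hα.comp ((continuous_add_coe a).comp (by fun_prop))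
  have h2 : (fun y => α (arcParam a a' y)) = AddCircle.liftIco (1 : ℝ) 0 f := by
    funext y
    conv_rhs => rw [← sub_zero y]
    rfl
  rw [h2]
  exact h1

/-- Just after `y` the loop along the arc follows `α` from the parameter of `y` on. -/
theorem pathAt_arc_right (y : S1) : ∃ δ > 0, ∀ u ∈ Icc 0 δ,
    pathAt (fun y => α (arcParam a a' y)) y u = pathAt α (arcParam a a' y) (pos a a' * u) := by
  have h1 := pos_lt_one 0 y
  have h0 := pos_nonneg 0 y
  refine ⟨(1 - pos 0 y) / 2, by linarith, fun u hu => ?_⟩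
  simp only [pathAt]
  rw [arcParam_add_of_nonneg y (by linarith [hu.1]) (by linarith [hu.2])]

theorem pathAt_arc (y : S1) (hy : y ≠ 0) : ∀ᶠ u in nhds (0 : ℝ),
    pathAt (fun y => α (arcParam a a' y)) y u = pathAt α (arcParam a a' y) (pos a a' * u) := by
  have h1 := pos_lt_one 0 y
  have h0 : 0 < pos 0 y := pos_pos_iff.2 hy
  filter_upwards [Ioo_mem_nhds (neg_lt_zero.2 h0) (sub_pos.2 h1)] with u hu
  simp only [pathAt]
  rw [arcParam_add_of_nonneg y (by linarith [hu.1]) (by linarith [hu.2])]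

/-- Just before `y` the loop along the arc follows `α` up to the parameter of `y`, which has to be
read as `a'` at the closing point. -/
theorem pathAt_arc_left (h : α a = α a') (y : S1) : ∃ δ > 0, ∀ u ∈ Icc (-δ) 0,
    pathAt (fun y => α (arcParam a a' y)) y u =
      pathAt α (if y = 0 then a' else arcParam a a' y) (pos a a' * u) := by
  by_cases hy : y = 0
  · subst hy
    refine ⟨1, one_pos, fun u hu => ?_⟩
    rw [if_pos rfl]
    rcases hu.2.eq_or_lt with rfl | hu2
    · rw [mul_zero, pathAt_zero, pathAt_zero, arcParam_zero, h]
    · simp only [pathAt]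
      rw [arcParam_neg hu.1 hu2]
  · rw [if_neg hy]
    obtain ⟨δ, hδ, hb⟩ :=
      Metric.eventually_nhds_iff.1 (pathAt_arc (α := α) (a := a) (a' := a') y hy)
    refine ⟨δ / 2, by linarith, fun u hu => hb ?_⟩
    rw [Real.dist_eq, sub_zero, abs_lt]
    constructor <;> linarith [hu.1, hu.2]

variable [TopologicalSpace M] [ChartedSpace (EuclideanHalfSpace 2) M]

theorem IsGeneric.mdifferentiableWithinAt_right (hα : IsGeneric α) (x : S1) :
    MDifferentiableWithinAt 𝓘(ℝ, ℝ) (𝓡∂ 2) (pathAt α x) (Ici 0) 0 := by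
  obtain ⟨δ, hδ, hs⟩ := hα.smooth_right x
  exact ((hs 0 (left_mem_Icc.2 hδ.le)).mdifferentiableWithinAt (by simp)).mono_of_mem_nhdsWithin
    (Icc_mem_nhdsGE hδ)

theorem IsGeneric.mdifferentiableWithinAt_left (hα : IsGeneric α) (x : S1) :
    MDifferentiableWithinAt 𝓘(ℝ, ℝ) (𝓡∂ 2) (pathAt α x) (Iic 0) 0 := by
  obtain ⟨δ, hδ, hs⟩ := hα.smooth_left x
  exact ((hs 0 (right_mem_Icc.2 (by linarith))).mdifferentiableWithinAt
    (by simp)).mono_of_mem_nhdsWithin (Icc_mem_nhdsLE (by linarith))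

theorem tangentRight_arc (hα : IsGeneric α) (y : S1) :
    tangentRight (fun y => α (arcParam a a' y)) y =
      pos a a' • tangentRight α (arcParam a a' y) := by
  obtain ⟨δ, hδ, hs⟩ := pathAt_arc_right (α := α) (a := a) (a' := a') y
  refine mfderivWithin_scale (hα.mdifferentiableWithinAt_right _)
    (fun u hu => mul_nonneg (pos_nonneg _ _) hu) (uniqueDiffOn_Ici 0 0 self_mem_Ici) ?_ ?_
  · rw [pathAt_zero, pathAt_zero]
  · filter_upwards [Icc_mem_nhdsGE hδ] with u hu using hs u hu

theorem tangentLeft_arc (hα : IsGeneric α) (h : α a = α a') (y : S1) :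
    tangentLeft (fun y => α (arcParam a a' y)) y =
      pos a a' • tangentLeft α (if y = 0 then a' else arcParam a a' y) := by
  obtain ⟨δ, hδ, hs⟩ := pathAt_arc_left h y
  refine mfderivWithin_scale (hα.mdifferentiableWithinAt_left _)
    (fun u hu => mul_nonpos_of_nonneg_of_nonpos (pos_nonneg _ _) hu)
    (uniqueDiffOn_Iic 0 0 self_mem_Iic) ?_ ?_
  · rw [hs 0 (right_mem_Icc.2 (by linarith)), mul_zero]
  · filter_upwards [Icc_mem_nhdsLE (show -δ < 0 by linarith)] with u hu using hs u hu

theorem tangent_arc (hα : MDifferentiableAt 𝓘(ℝ, ℝ) (𝓡∂ 2) (pathAt α (arcParam a a' y)) 0)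
    (hy : y ≠ 0) :
    tangent (fun y => α (arcParam a a' y)) y = pos a a' • tangent α (arcParam a a' y) := by
  have := mfderivWithin_scale (s := univ) (c := pos a a')
    (f' := pathAt (fun y => α (arcParam a a' y)) y) hα.mdifferentiableWithinAt
    (fun u _ => mem_univ _) uniqueDiffWithinAt_univ (by rw [pathAt_zero, pathAt_zero])
    (by rw [nhdsWithin_univ]; exact pathAt_arc y hy)
  rw [mfderivWithin_univ, mfderivWithin_univ] at this
  exact this

theorem tangentRight_eq_tangent {x : S1}
    (hα : MDifferentiableAt 𝓘(ℝ, ℝ) (𝓡∂ 2) (pathAt α x) 0) : tangentRight α x = tangent α x :=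
  congrArg (fun f : ℝ →L[ℝ] EuclideanSpace ℝ (Fin 2) => f 1)
    (mfderivWithin_eq_mfderiv (uniqueDiffOn_Ici 0 0 self_mem_Ici).uniqueMDiffWithinAt hα)

theorem tangentLeft_eq_tangent {x : S1}
    (hα : MDifferentiableAt 𝓘(ℝ, ℝ) (𝓡∂ 2) (pathAt α x) 0) : tangentLeft α x = tangent α x :=
  congrArg (fun f : ℝ →L[ℝ] EuclideanSpace ℝ (Fin 2) => f 1)
    (mfderivWithin_eq_mfderiv (uniqueDiffOn_Iic 0 0 self_mem_Iic).uniqueMDiffWithinAt hα)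

theorem det2_eq_zero_of_sameRay {v w : EuclideanSpace ℝ (Fin 2)} (h : SameRay ℝ v w) :
    det2 v w = 0 := by
  rcases h with rfl | rfl | ⟨r, s, hr, hs, e⟩
  · simp [det2]
  · simp [det2]
  · have h0 : r * v 0 = s * w 0 := by simpa using congrArg (fun x => x 0) e
    have h1 : r * v 1 = s * w 1 := by simpa using congrArg (fun x => x 1) e
    refine mul_left_cancel₀ (mul_pos hr hs).ne' ?_
    rw [det2]
    linear_combination s * w 1 * h0 - s * w 0 * h1

/-- The arc between the two preimages of a crossing, closed up with a corner at the crossing, is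
again a generic loop. -/
theorem IsGeneric.arc (hα : IsGeneric α) (hne : a ≠ a') (h : α a = α a') :
    IsGeneric fun y => α (arcParam a a' y) := by
  have hc0 : 0 < pos a a' := pos_pos_iff.2 hne.symm
  have hc1 : pos a a' < 1 := pos_lt_one _ _
  have hmd : ∀ x y, x ≠ y → α x = α y → MDifferentiableAt 𝓘(ℝ, ℝ) (𝓡∂ 2) (pathAt α x) 0 :=
    fun x y hxy e => (hα.smooth_crossing x y hxy e).mdifferentiableAt (by simp)
  have hinj := arcParam_injective hne
  -- no crossing of the new loop lies at the corner, as `α a` is only a double point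
  have hcr : ∀ y z, y ≠ z → α (arcParam a a' y) = α (arcParam a a' z) → y ≠ 0 := by
    rintro y z hyz e rfl
    rw [arcParam_zero] at e
    rcases hα.double a' a _ h.symm e with e' | e' | e'
    · exact hne e'.symm
    · exact hyz (hinj (arcParam_zero.trans e'))
    · exact arcParam_ne hne z e'.symm
  refine ⟨continuous_comp_arcParam hα.continuous h, fun y => hα.interior _, fun y => ?_,
    fun y => ?_, fun y hs => ?_, fun y z hyz e => ?_, fun y z hyz e => ?_,
    fun x y z e1 e2 => ?_, ?_⟩
  · obtain ⟨δ, hδ, hs⟩ := hα.smooth_right (arcParam a a' y)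
    obtain ⟨δ', hδ', hs'⟩ := pathAt_arc_right (α := α) (a := a) (a' := a') y
    refine ⟨min δ δ', lt_min hδ hδ', contMDiffOn_scale hs (fun u hu => ?_)
      fun u hu => hs' u ⟨hu.1, hu.2.trans (min_le_right _ _)⟩⟩
    exact ⟨mul_nonneg hc0.le hu.1, (mul_le_of_le_one_left hu.1 hc1.le).trans
      (hu.2.trans (min_le_left _ _))⟩
  · obtain ⟨δ, hδ, hs⟩ := hα.smooth_left (if y = 0 then a' else arcParam a a' y)
    obtain ⟨δ', hδ', hs'⟩ := pathAt_arc_left h y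
    refine ⟨min δ δ', lt_min hδ hδ', contMDiffOn_scale hs (fun u hu => ?_)
      fun u hu => hs' u ⟨by linarith [hu.1, min_le_right δ δ'], hu.2⟩⟩
    refine ⟨?_, mul_nonpos_of_nonneg_of_nonpos hc0.le hu.2⟩
    nlinarith [hu.1, hu.2, min_le_left δ δ']
  · rw [tangentRight_arc hα, tangentLeft_arc hα h, ← smul_neg] at hs
    have hs' := (hs.pos_smul_left (inv_pos.2 hc0)).pos_smul_right (inv_pos.2 hc0)
    rw [inv_smul_smul₀ hc0.ne', inv_smul_smul₀ hc0.ne'] at hs'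
    by_cases hy : y = 0
    · -- at the new corner the two tangents are those at the crossing, which is transversal
      rw [if_pos hy, hy, arcParam_zero, tangentRight_eq_tangent (hmd a a' hne h),
        tangentLeft_eq_tangent (hmd a' a hne.symm h.symm)] at hs'
      have h0 := det2_eq_zero_of_sameRay hs'
      refine hα.transversal a' a hne.symm h.symm ?_
      simp only [det2, PiLp.neg_apply] at h0 ⊢
      linear_combination -h0
    · rw [if_neg hy] at hs'
      exact hα.immersed _ hs'
  · have hs := hα.smooth_crossing _ _ (hinj.ne hyz) e
    have hs' : ContMDiffAt 𝓘(ℝ, ℝ) (𝓡∂ 2) ∞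
        (fun u => pathAt α (arcParam a a' y) (pos a a' * u)) 0 := by
      refine ContMDiffAt.comp (I' := 𝓘(ℝ, ℝ)) (0 : ℝ) (g := pathAt α (arcParam a a' y))
        (f := fun u : ℝ => pos a a' * u) (by rw [mul_zero]; exact hs) ?_
      exact (by fun_prop : ContDiff ℝ ∞ (fun u : ℝ => pos a a' * u)).contMDiff.contMDiffAt
    exact hs'.congr_of_eventuallyEq (pathAt_arc y (hcr y z hyz e))
  · rw [tangent_arc (hmd _ _ (hinj.ne hyz) e) (hcr y z hyz e),
      tangent_arc (hmd _ _ (hinj.ne hyz.symm) e.symm) (hcr z y hyz.symm e.symm)]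
    have h0 := hα.transversal _ _ (hinj.ne hyz) e
    have h1 : ∀ (c : ℝ) (v w : EuclideanSpace ℝ (Fin 2)),
        det2 (c • v) (c • w) = c * c * det2 v w := fun c v w => by
      simp only [det2, PiLp.smul_apply, smul_eq_mul]; ring
    rw [h1]
    exact mul_ne_zero (mul_pos hc0 hc0).ne' h0
  · rcases hα.double _ _ _ e1 e2 with e | e | e
    · exact Or.inl (hinj e)
    · exact Or.inr (Or.inl (hinj e))
    · exact Or.inr (Or.inr (hinj e))
  · exact (hα.finite.preimage (f := Prod.map (arcParam a a') (arcParam a a'))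
      ((hinj.prodMap hinj).injOn)).subset fun p hp => ⟨hinj.ne hp.1, hp.2⟩

/-- A collapse of the complementary arc, together with the pointed loop which follows the arc. -/
theorem exists_arc_loop {α : PointedLoop M} {a a' b : S1} (hne : a ≠ a')
    (h : α.toFun a = α.toFun a') (hb : b ∈ (cIoo a' a)ᶜ) (hba : b ≠ a')
    (hsimple : ∀ x, α.toFun x = α.toFun b → x = b ∨ x = a') :
    ∃ (β : PointedLoop M) (g : S1 → S1), IsCollapse (cIoo a' a)ᶜ g ∧
      (∀ x ∈ (cIoo a' a)ᶜ, β.toFun (g x) = α.toFun x) ∧ β.base = g b := by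
  have hc0 : 0 < pos a a' := pos_pos_iff.2 hne.symm
  obtain ⟨g, hg, hg1, hg2⟩ := exists_isCollapse_compl_cIoo hne
  have hψ : ∀ x, pos a x < pos a a' → arcParam a a' (g x) = x := fun x hx => by
    rw [arcParam, hg1 x hx, mul_div_cancel₀ _ hc0.ne', add_pos_coe]
  have hb' : pos a b < pos a a' :=
    lt_of_le_of_ne ((mem_compl_cIoo_iff hne).1 hb) fun e => hba (pos_inj.1 e)
  refine ⟨⟨⟨_, α.generic.arc hne h⟩, g b, fun x hx => ?_⟩, g, hg, fun x hx => ?_, rfl⟩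
  · simp only [hψ b hb'] at hx
    refine arcParam_injective hne ?_
    rw [hψ b hb']
    exact (hsimple _ hx).resolve_right (arcParam_ne hne x)
  · rcases ((mem_compl_cIoo_iff hne).1 hx).lt_or_eq with h1 | h1
    · simp only [hψ x h1]
    · have h2 := hg2 x h1.ge
      rw [pos_inj.1 h1] at h2 ⊢
      simp only [h2, arcParam_zero, h]

end ArcLoop

/-! ### Faces of a loop and faces of its face loops -/

section FaceLoops

variable {M : Type*} [TopologicalSpace M] [ChartedSpace (EuclideanHalfSpace 2) M]

theorem faceArcs_empty_none {α : PointedLoop M} : faceArcs (∅ : Finset (Crossing α)) none = univ :=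
  eq_univ_of_forall fun _ => mem_faceArcs_none.2 fun q hq => absurd hq (Finset.notMem_empty q)

theorem isSimpleCut_empty {α : PointedLoop M} : IsSimpleCut (∅ : Finset (Crossing α)) := by
  simp [IsSimpleCut, IsCut]

namespace Follows

variable {α β : PointedLoop M} {A : Set S1} {b : S1} {h : AmbientIsotopy M} {g : S1 → S1}
  {H : Finset (Crossing α)} {K : Finset (Crossing β)}

theorem preimage_faceArcs (s : Follows α β A b h g) {x : S1} (w : Option (Crossing β)) :
    g x ∈ faceArcs K w ↔ (∀ p ∈ w, x ∈ (s.pull p).closedArc) ∧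
      ∀ q ∈ K.map s.pullEmb, (∀ p ∈ w, q < s.pull p) → x ∉ q.arc := by
  have hmap : ∀ P : Crossing α → Prop, (∀ q ∈ K.map s.pullEmb, P q) ↔ ∀ r ∈ K, P (s.pull r) :=
    fun P => Finset.forall_mem_map
  rw [hmap]
  cases w with
  | none =>
    rw [mem_faceArcs_none]
    simp [s.mem_arc_pull_iff]
  | some p =>
    rw [mem_faceArcs_some]
    simp [s.mem_arc_pull_iff, s.mem_closedArc_pull_iff, s.pull_lt_iff]

/-- A face of a cut `H ⊇ c` on the root side of the simple cut `c`, seen from the root loop of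
`c`. -/
theorem faceArcs_root {c : Finset (Crossing α)} (s : Follows α β (faceArcs c none) b h g)
    (hH : IsCut H) (hcH : c ⊆ H)
    (hK : ∀ q, q ∈ K.map s.pullEmb ↔ q ∈ H ∧ ∀ e ∈ c, ¬ q ≤ e) (w : Option (Crossing β))
    (hw : ∀ r ∈ w, r ∈ K) :
    faceArcs H (w.map s.pull) = faceArcs c none ∩ g ⁻¹' faceArcs K w := by
  ext x
  rw [mem_inter_iff, mem_preimage, s.preimage_faceArcs, mem_faceArcs_none]
  cases w with
  | none =>
    simp only [Option.map_none, mem_faceArcs_none, hK, reduceCtorEq, Option.mem_def,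
      IsEmpty.forall_iff, implies_true, forall_const, true_and]
    refine ⟨fun hx => ⟨fun q hq => hx q (hcH hq), fun q hq => hx q hq.1⟩, fun hx q hq => ?_⟩
    by_cases hqc : ∀ e ∈ c, ¬ q ≤ e
    · exact hx.2 q ⟨hq, hqc⟩
    · push Not at hqc
      obtain ⟨e, he, hqe⟩ := hqc
      exact fun hxq => hx.1 e he (Crossing.arc_subset_of_le hqe hxq)
  | some p =>
    simp only [Option.map_some, mem_faceArcs_some, hK, Option.mem_def, Option.some.injEq,
      forall_eq']
    have hp := (hK (s.pull p)).1 (s.mem_map_pullEmb.2 (hw p rfl))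
    -- a chord of `c` that cuts off a point beyond the chord of `p` lies beyond `p` itself
    have hcomp : ∀ e ∈ c, x ∈ (s.pull p).closedArc → x ∈ e.arc → e < s.pull p := by
      intro e he hx hxe
      by_contra hn
      have h1 : e ≠ s.pull p := fun h => hp.2 e he h.ge
      refine disjoint_left.1 (Crossing.disjoint_closedArc (hH e (hcH he) _ hp.1 h1)
        (fun hle => hn (lt_of_le_of_ne hle h1)) (hp.2 e he))
        (Crossing.mem_closedArc_iff.2 (Or.inr (Or.inr hxe))) hx
    refine ⟨fun hx => ⟨fun e he hxe => ?_, hx.1, fun q hq hqp => hx.2 q hq.1 hqp⟩,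
      fun hx => ⟨hx.2.1, fun q hq hqp hxq => ?_⟩⟩
    · exact hx.2 e (hcH he) (hcomp e he hx.1 hxe) hxe
    · by_cases hqc : ∀ e ∈ c, ¬ q ≤ e
      · exact hx.2.2 q ⟨hq, hqc⟩ hqp hxq
      · push Not at hqc
        obtain ⟨e, he, hqe⟩ := hqc
        exact hx.1 e he (Crossing.arc_subset_of_le hqe hxq)

/-- A face of a cut `H` beyond the chord of `p`, seen from the loop along the arc of `p`. -/
theorem faceArcs_closedArc {p : Crossing α} (s : Follows α β p.closedArc b h g)
    (hK : ∀ q, q ∈ K.map s.pullEmb ↔ q ∈ H ∧ q < p) (w : Option (Crossing β))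
    (hw : ∀ r ∈ w, r ∈ K) :
    faceArcs H (some (w.elim p s.pull)) = p.closedArc ∩ g ⁻¹' faceArcs K w := by
  ext x
  rw [mem_inter_iff, mem_preimage, s.preimage_faceArcs, mem_faceArcs_some]
  cases w with
  | none => simp [hK]
  | some r =>
    have hr := ((hK (s.pull r)).1 (s.mem_map_pullEmb.2 (hw r rfl))).2
    simp only [Option.elim_some, hK, Option.mem_def, Option.some.injEq, forall_eq']
    refine ⟨fun hx => ⟨?_, hx.1, fun q hq hqr => hx.2 q hq.1 hqr⟩,
      fun hx => ⟨hx.2.1, fun q hq hqr => hx.2.2 q ⟨hq, hqr.trans hr⟩ hqr⟩⟩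
    exact Crossing.mem_closedArc_iff.2 (Or.inr (Or.inr (Crossing.closedArc_subset_arc hr hx.1)))

theorem map_faceBase (s : Follows α β A α.base h g) (w : Option (Crossing β)) :
    g (faceBase α (w.map s.pull)) = faceBase β w := by
  cases w with
  | none => exact s.base.symm
  | some r => exact s.map_pull_fst r

theorem map_faceBase_elim {p : Crossing α} (s : Follows α β A p.1.1 h g)
    (w : Option (Crossing β)) : g (faceBase α (some (w.elim p s.pull))) = faceBase β w := by
  cases w with
  | none => exact s.base.symm
  | some r => exact s.map_pull_fst r

theorem isFaceLoop (s : Follows α β A b (.refl M) g) {w : Option (Crossing β)}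
    (hw : ∀ p ∈ w, p ∈ K) {v : Option (Crossing α)}
    (hface : faceArcs H v = A ∩ g ⁻¹' faceArcs K w)
    (hbase : g (faceBase α v) = faceBase β w) {γ : PointedLoop M} (hγ : IsFaceLoop β K w γ) :
    IsFaceLoop α H v γ := by
  obtain ⟨g', hg', hγ, hb⟩ := hγ
  refine ⟨g' ∘ g, by rw [hface]; exact s.collapse_comp hw hg', fun x hx => ?_, ?_⟩
  · rw [hface] at hx
    exact (hγ _ hx.2).trans (s.follow x hx.1)
  · rw [hb, Function.comp_apply, hbase]

end Follows

section Existence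

variable {α : PointedLoop M}

theorem isSimpleCut_singleton (q : Crossing α) : IsSimpleCut {q} := by
  rw [isSimpleCut_iff]
  refine ⟨fun p hp r hr hpr => ?_, fun p hp r hr => ?_⟩
  · rw [Finset.mem_singleton] at hp hr
    exact absurd (hp.trans hr.symm) hpr
  · rw [Finset.mem_singleton] at hp hr
    rw [hp, hr]
    exact lt_irrefl q

/-- The loop along the arc from `q₁` to `q₂`. -/
theorem exists_follows_closedArc (q : Crossing α) :
    ∃ (β : PointedLoop M) (g : S1 → S1), Follows α β q.closedArc q.1.1 (.refl M) g := by
  obtain ⟨β, g, hg, hf, hb⟩ := exists_arc_loop (α := α) q.fst_ne_snd q.apply_eq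
    (by rw [← q.closedArc_eq_compl]; exact q.fst_mem_closedArc) q.fst_ne_snd fun x hx => by
      rcases α.generic.double x q.1.1 q.1.2 hx q.apply_eq with e | e | e
      · exact Or.inl e
      · exact absurd e q.fst_ne_snd
      · exact Or.inr e
  rw [← q.closedArc_eq_compl] at hg hf
  exact ⟨β, g, follows_closedArc hg hf hb⟩

/-- The loop which skips the arc from `q₁` to `q₂`. -/
theorem exists_follows_root_singleton (q : Crossing α) :
    ∃ (β : PointedLoop M) (g : S1 → S1),
      Follows α β (faceArcs {q} none) α.base (.refl M) g := by
  have hA : (cIoo q.1.1 q.1.2)ᶜ = faceArcs {q} none := by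
    ext x
    simp [mem_faceArcs_none, Crossing.arc]
  obtain ⟨β, g, hg, hf, hb⟩ := exists_arc_loop (α := α) (a := q.1.2) (a' := q.1.1) (b := α.base)
    q.fst_ne_snd.symm q.apply_eq.symm q.base_notMem_arc q.base_ne_fst
    fun x hx => Or.inl (α.base_simple x hx)
  rw [hA] at hg hf
  exact ⟨β, g, follows_root (isSimpleCut_singleton q) hg hf hb⟩

/-- The root loop of a cut exists, by induction on the number of chords. -/
theorem exists_isFaceLoop_none {H : Finset (Crossing α)} (hH : IsCut H) :
    ∃ β, IsFaceLoop α H none β := by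
  classical
  induction hn : H.card using Nat.strong_induction_on generalizing α with
  | _ n ih =>
    rcases H.eq_empty_or_nonempty with rfl | hne
    · refine ⟨α, id, ?_, fun x _ => rfl, rfl⟩
      rw [faceArcs_empty_none]
      exact .of_reparam .refl
    -- cut off an outermost chord `q` and treat the chords on the root side of `q`
    obtain ⟨q, hq⟩ := H.exists_maximal hne
    obtain ⟨β, g, s⟩ := exists_follows_root_singleton q
    obtain ⟨K, hK⟩ := s.exists_map_eq (G := H.filter fun r => ∀ e ∈ ({q} : Finset _), ¬ r ≤ e)
      fun r hr => by
        rw [Finset.mem_filter] at hr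
        refine (isInner_root_iff fun e he => ?_).2 hr.2
        have := hr.2 e he
        rw [Finset.mem_singleton] at he
        exact hH r hr.1 e (he ▸ hq.1) fun hre => this hre.le
    have hK' : ∀ r, r ∈ K.map s.pullEmb ↔ r ∈ H ∧ ∀ e ∈ ({q} : Finset _), ¬ r ≤ e := fun r => by
      rw [hK, Finset.mem_filter]
    have hKcut : IsCut K := s.isCut_map_iff.1 fun p hp r hr =>
      hH p ((hK' p).1 hp).1 r ((hK' r).1 hr).1
    have hlt : K.card < n := by
      rw [← hn, ← Finset.card_map s.pullEmb, hK]
      refine Finset.card_lt_card (Finset.filter_ssubset.2 ⟨q, hq.1, ?_⟩)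
      simp
    obtain ⟨γ, hγ⟩ := ih _ hlt hKcut rfl
    exact ⟨γ, s.isFaceLoop (by simp) (s.faceArcs_root hH (Finset.singleton_subset_iff.2 hq.1) hK'
      none (by simp)) (s.map_faceBase none) hγ⟩

/-- The loops associated with the faces of a cut exist. -/
theorem exists_isFaceLoop {H : Finset (Crossing α)} (hH : IsCut H) (v : Option (Crossing α)) :
    ∃ β, IsFaceLoop α H v β := by
  classical
  cases v with
  | none => exact exists_isFaceLoop_none hH
  | some p =>
    obtain ⟨β, g, s⟩ := exists_follows_closedArc p
    obtain ⟨K, hK⟩ := s.exists_map_eq (G := H.filter fun r => r < p) fun r hr =>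
      isInner_closedArc_iff.2 (Finset.mem_filter.1 hr).2
    have hK' : ∀ r, r ∈ K.map s.pullEmb ↔ r ∈ H ∧ r < p := fun r => by
      rw [hK, Finset.mem_filter]
    have hKcut : IsCut K := s.isCut_map_iff.1 fun p hp r hr =>
      hH p ((hK' p).1 hp).1 r ((hK' r).1 hr).1
    obtain ⟨γ, hγ⟩ := exists_isFaceLoop_none hKcut
    exact ⟨γ, s.isFaceLoop (by simp) (s.faceArcs_closedArc hK' none (by simp))
      (s.map_faceBase_elim none) hγ⟩

/-- The root loop of a simple cut, as a loop which follows `α`. -/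
theorem exists_follows_root {c : Finset (Crossing α)} (hc : IsSimpleCut c) :
    ∃ (β : PointedLoop M) (g : S1 → S1), faceClass α c none = ⟦β⟧ ∧
      Follows α β (faceArcs c none) α.base (.refl M) g := by
  obtain ⟨β, hβ⟩ := exists_isFaceLoop_none hc.1
  refine ⟨β, ?_⟩
  obtain ⟨g, hg, hf, hb⟩ := id hβ
  exact ⟨g, hβ.faceClass_eq, follows_root hc hg hf hb⟩

/-- The loops beyond the chords of a simple cut, as loops which follow `α`. -/
theorem exists_follows_branch {c : Finset (Crossing α)} (hc : IsSimpleCut c) {p : Crossing α}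
    (hp : p ∈ c) : ∃ (β : PointedLoop M) (g : S1 → S1), faceClass α c (some p) = ⟦β⟧ ∧
      Follows α β p.closedArc p.1.1 (.refl M) g := by
  obtain ⟨β, hβ⟩ := exists_isFaceLoop hc.1 (some p)
  refine ⟨β, ?_⟩
  obtain ⟨g, hg, hf, hb⟩ := id hβ
  rw [faceArcs_some_of_isSimpleCut hc hp] at hg hf
  exact ⟨g, hβ.faceClass_eq, follows_closedArc hg hf hb⟩

theorem faceClass_empty : faceClass α ∅ none = ⟦α⟧ := by
  refine IsFaceLoop.faceClass_eq ⟨id, ?_, fun x _ => rfl, rfl⟩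
  rw [faceArcs_empty_none]
  exact .of_reparam .refl

end Existence

end FaceLoops

/-! ### Products of sums over subsets -/

section Expansion

open Classical in
/-- The distributive law for sums over subsets of disjoint regions `D i`: choosing a subset in every
region is the same as choosing a subset of the union of the regions. -/
theorem prod_sum_subsets {ι P A : Type*} [Finite P] [CommSemiring A] (s : Finset ι)
    (D : ι → Set P) (hD : ∀ i ∈ s, ∀ j ∈ s, i ≠ j → Disjoint (D i) (D j))
    (𝒦 : ι → Finset (Finset P)) (h𝒦 : ∀ i ∈ s, ∀ K ∈ 𝒦 i, ∀ x ∈ K, x ∈ D i)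
    (F : ι → Finset P → A) (𝒞 : Finset (Finset P))
    (h𝒞 : ∀ C, C ∈ 𝒞 ↔ (∀ x ∈ C, ∃ i ∈ s, x ∈ D i) ∧ ∀ i ∈ s, (C.filter (· ∈ D i)) ∈ 𝒦 i) :
    ∏ i ∈ s, ∑ K ∈ 𝒦 i, F i K = ∑ C ∈ 𝒞, ∏ i ∈ s, F i (C.filter (· ∈ D i)) := by
  induction s using Finset.induction_on generalizing 𝒞 with
  | empty =>
    have : 𝒞 = {∅} := by
      ext C
      rw [h𝒞, Finset.mem_singleton, Finset.eq_empty_iff_forall_notMem]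
      simp
    simp [this]
  | insert i s hi ih =>
    let 𝒞' : Finset (Finset P) := (Set.toFinite {C : Finset P | (∀ x ∈ C, ∃ i ∈ s, x ∈ D i) ∧
      ∀ i ∈ s, (C.filter (· ∈ D i)) ∈ 𝒦 i}).toFinset
    have h𝒞' : ∀ C, C ∈ 𝒞' ↔ (∀ x ∈ C, ∃ i ∈ s, x ∈ D i) ∧
        ∀ i ∈ s, (C.filter (· ∈ D i)) ∈ 𝒦 i := fun C => by
      simp [𝒞']
    have hdis : ∀ j ∈ s, ∀ x ∈ D j, x ∉ D i := fun j hj x hx hx' =>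
      disjoint_left.1 (hD j (Finset.mem_insert_of_mem hj) i (Finset.mem_insert_self i s)
        (fun e => hi (e ▸ hj))) hx hx'
    have hdis' : ∀ C ∈ 𝒞', ∀ x ∈ C, x ∉ D i := fun C hC x hx => by
      obtain ⟨j, hj, hxj⟩ := ((h𝒞' C).1 hC).1 x hx
      exact hdis j hj x hxj
    have hKi := h𝒦 i (Finset.mem_insert_self i s)
    -- the two parts of `K ∪ C`
    have hpart : ∀ K ∈ 𝒦 i, ∀ C ∈ 𝒞', (K ∪ C).filter (· ∈ D i) = K := fun K hK C hC => by
      ext x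
      rw [Finset.mem_filter, Finset.mem_union]
      exact ⟨fun h => h.1.resolve_right fun hx => hdis' C hC x hx h.2,
        fun hx => ⟨Or.inl hx, hKi K hK x hx⟩⟩
    have hpart' : ∀ K ∈ 𝒦 i, ∀ C ∈ 𝒞', ∀ j ∈ s,
        (K ∪ C).filter (· ∈ D j) = C.filter (· ∈ D j) := fun K hK C _ j hj => by
      ext x
      rw [Finset.mem_filter, Finset.mem_union, Finset.mem_filter]
      refine and_congr_left fun hxj => or_iff_right fun hx => ?_
      exact hdis j hj x hxj (hKi K hK x hx)
    rw [Finset.prod_insert hi, ih (fun j hj k hk => hD j (Finset.mem_insert_of_mem hj) k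
      (Finset.mem_insert_of_mem hk)) (fun j hj => h𝒦 j (Finset.mem_insert_of_mem hj)) 𝒞' h𝒞',
      Finset.sum_mul_sum, ← Finset.sum_product']
    refine Finset.sum_nbij' (fun x => x.1 ∪ x.2)
      (fun C => (C.filter (· ∈ D i), C.filter fun x => ∃ j ∈ s, x ∈ D j)) ?_ ?_ ?_ ?_ ?_
    · rintro ⟨K, C⟩ hKC
      obtain ⟨hK, hC⟩ := Finset.mem_product.1 hKC
      refine (h𝒞 _).2 ⟨fun x hx => ?_, fun j hj => ?_⟩
      · rcases Finset.mem_union.1 hx with hx | hx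
        · exact ⟨i, Finset.mem_insert_self i s, hKi K hK x hx⟩
        · obtain ⟨j, hj, hxj⟩ := ((h𝒞' C).1 hC).1 x hx
          exact ⟨j, Finset.mem_insert_of_mem hj, hxj⟩
      · rcases Finset.mem_insert.1 hj with rfl | hj
        · rw [hpart K hK C hC]; exact hK
        · rw [hpart' K hK C hC j hj]; exact ((h𝒞' C).1 hC).2 j hj
    · intro C hC
      rw [h𝒞] at hC
      refine Finset.mem_product.2 ⟨hC.2 i (Finset.mem_insert_self i s), (h𝒞' _).2
        ⟨fun x hx => (Finset.mem_filter.1 hx).2, fun j hj => ?_⟩⟩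
      have : ((C.filter fun x => ∃ j ∈ s, x ∈ D j).filter (· ∈ D j)) = C.filter (· ∈ D j) := by
        ext x
        simp only [Finset.mem_filter]
        exact ⟨fun h => ⟨h.1.1, h.2⟩, fun h => ⟨⟨h.1, j, hj, h.2⟩, h.2⟩⟩
      rw [this]
      exact hC.2 j (Finset.mem_insert_of_mem hj)
    · rintro ⟨K, C⟩ hKC
      obtain ⟨hK, hC⟩ := Finset.mem_product.1 hKC
      refine Prod.ext (hpart K hK C hC) ?_
      ext x
      simp only [Finset.mem_filter, Finset.mem_union]
      refine ⟨fun h => h.1.resolve_left fun hx => ?_, fun hx => ⟨Or.inr hx, ((h𝒞' C).1 hC).1 x hx⟩⟩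
      obtain ⟨j, hj, hxj⟩ := h.2
      exact hdis j hj x hxj (hKi K hK x hx)
    · intro C hC
      rw [h𝒞] at hC
      ext x
      simp only [Finset.mem_filter, Finset.mem_union]
      refine ⟨fun h => h.elim And.left And.left, fun hx => ?_⟩
      obtain ⟨j, hj, hxj⟩ := hC.1 x hx
      rcases Finset.mem_insert.1 hj with rfl | hj
      · exact Or.inl ⟨hx, hxj⟩
      · exact Or.inr ⟨hx, j, hj, hxj⟩
    · rintro ⟨K, C⟩ hKC
      obtain ⟨hK, hC⟩ := Finset.mem_product.1 hKC
      rw [Finset.prod_insert hi, hpart K hK C hC]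
      exact congrArg _ (Finset.prod_congr rfl fun j hj => by rw [hpart' K hK C hC j hj])

end Expansion

/-- The antichains which are contained in `s`. -/
def antichains {E : Type*} [Finite E] [PartialOrder E] (s : Set E) : Finset (Finset E) :=
  (Set.toFinite {K : Finset E | (∀ e ∈ K, e ∈ s) ∧ ∀ e ∈ K, ∀ f ∈ K, ¬ e < f}).toFinset

theorem mem_antichains {E : Type*} [Finite E] [PartialOrder E] {s : Set E} {K : Finset E} :
    K ∈ antichains s ↔ (∀ e ∈ K, e ∈ s) ∧ ∀ e ∈ K, ∀ f ∈ K, ¬ e < f := by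
  simp [antichains]

/-! ### Subtrees -/

namespace PlanarTree

variable {Λ : Type*}

theorem isSimpleCut_iff {T : PlanarTree Λ} {c : Finset T.Edge} :
    T.IsSimpleCut c ↔ ∀ e ∈ c, ∀ f ∈ c, ¬ e < f := by
  constructor
  · exact fun h e he f hf hef => hef.ne (h e e he f hf le_rfl hef.le)
  · intro h f e he e' he' h1 h2
    rcases T.chain f e e' h1 h2 with h3 | h3
    · exact h3.eq_of_not_lt (h e he e' he')
    · exact (h3.eq_of_not_lt (h e' he' e he)).symm

/-- `T'` is (by means of the map `φ` of edges) a subtree of `T` with root `r`: all vertices are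
below `r`, and with an edge also the path from it to `r` belongs to the subtree. -/
structure IsSubtree (T' T : PlanarTree Λ) (φ : T'.Edge ↪o T.Edge) (r : Option T.Edge) : Prop where
  below : ∀ e, ∀ p ∈ r, φ e < p
  convex : ∀ e f, φ e ≤ f → (∀ p ∈ r, f < p) → f ∈ range φ
  sign : ∀ e, T.sign (φ e) = T'.sign e
  label : ∀ v : Option T'.Edge, T.label (v.elim r fun e => some (φ e)) = T'.label v
  cyc : ∀ v : Option T'.Edge, ∀ a ∈ incident v, ∀ b ∈ incident v, ∀ c ∈ incident v,
    T.cyc (v.elim r fun e => some (φ e)) (φ a) (φ b) (φ c) ↔ T'.cyc v a b c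

namespace IsSubtree

variable {T T' T'' : PlanarTree Λ} {φ : T'.Edge ↪o T.Edge} {r : Option T.Edge}

theorem map_mem_incident (s : IsSubtree T' T φ r) {v : Option T'.Edge} {a : T'.Edge}
    (ha : a ∈ incident v) : φ a ∈ incident (v.elim r fun e => some (φ e)) := by
  cases v with
  | none =>
    have hmax : ∀ f, φ a ≤ f → (∀ p ∈ r, f < p) → f ≤ φ a := by
      intro f haf hf
      obtain ⟨x, rfl⟩ := s.convex a f haf hf
      exact φ.le_iff_le.2 (ha (φ.le_iff_le.1 haf))
    cases r with
    | none => exact fun f hf => hmax f hf (by simp)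
    | some p =>
      refine Or.inr ⟨s.below a p rfl, fun f haf hfp => ?_⟩
      exact haf.not_ge (hmax f haf.le (by simpa using hfp))
  | some e =>
    rcases ha with rfl | ha
    · exact Or.inl rfl
    · refine Or.inr ⟨φ.lt_iff_lt.2 ha.lt, fun f haf hfe => ?_⟩
      obtain ⟨x, rfl⟩ := s.convex a f haf.le fun p hp => hfe.trans (s.below e p hp)
      exact ha.2 (φ.lt_iff_lt.1 haf) (φ.lt_iff_lt.1 hfe)

theorem trans {ψ : T''.Edge ↪o T'.Edge} {r' : Option T'.Edge} (s' : IsSubtree T'' T' ψ r')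
    (s : IsSubtree T' T φ r) :
    IsSubtree T'' T (ψ.trans φ) (r'.elim r fun e => some (φ e)) where
  below e := by
    cases r' with
    | none => exact s.below (ψ e)
    | some e' =>
      rintro p ⟨⟩
      exact φ.lt_iff_lt.2 (s'.below e e' rfl)
  convex e f hef hf := by
    have hf' : ∀ p ∈ r, f < p := by
      cases r' with
      | none => exact hf
      | some e' => exact fun p hp => (hf _ rfl).trans (s.below e' p hp)
    obtain ⟨x, rfl⟩ := s.convex (ψ e) f hef hf'
    obtain ⟨y, rfl⟩ := s'.convex e x (φ.le_iff_le.1 hef) fun p hp => by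
      subst hp
      exact φ.lt_iff_lt.1 (hf _ rfl)
    exact ⟨y, rfl⟩
  sign e := (s.sign _).trans (s'.sign e)
  label v := by
    rw [← s'.label, ← s.label]
    cases v <;> rfl
  cyc v a ha b hb c hc := by
    rw [← s'.cyc v a ha b hb c hc, ← s.cyc _ _ (s'.map_mem_incident ha) _
      (s'.map_mem_incident hb) _ (s'.map_mem_incident hc)]
    cases v <;> rfl

/-- A subtree is determined by its edges and its root. -/
theorem mk_eq {T₁ T₂ : PlanarTree Λ} {φ₁ : T₁.Edge ↪o T.Edge} {φ₂ : T₂.Edge ↪o T.Edge}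
    (s₁ : IsSubtree T₁ T φ₁ r) (s₂ : IsSubtree T₂ T φ₂ r) (h : range φ₁ = range φ₂) :
    (⟦T₁⟧ : TreeClass Λ) = ⟦T₂⟧ := by
  have h1 : ∀ e, ∃ f, φ₂ f = φ₁ e := fun e => by
    have : φ₁ e ∈ range φ₂ := h ▸ mem_range_self e
    exact this
  have h2 : ∀ f, ∃ e, φ₁ e = φ₂ f := fun f => by
    have : φ₂ f ∈ range φ₁ := h ▸ mem_range_self f
    exact this
  -- match the edges with the same image in the ambient tree
  choose σ hσ using h1
  choose τ hτ using h2
  let σ' : T₁.Edge ≃o T₂.Edge :=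
    { toFun := σ
      invFun := τ
      left_inv := fun e => φ₁.injective (by rw [hτ, hσ])
      right_inv := fun f => φ₂.injective (by rw [hσ, hτ])
      map_rel_iff' := fun {a b} => by
        change σ a ≤ σ b ↔ _
        rw [← φ₂.le_iff_le, hσ, hσ, φ₁.le_iff_le] }
  have hlift : ∀ v : Option T₁.Edge,
      ((v.map σ').elim r fun e => some (φ₂ e)) = v.elim r fun e => some (φ₁ e) := by
    intro v
    cases v with
    | none => rfl
    | some e => exact congrArg some (hσ e)
  refine Quotient.sound ⟨σ', fun e => ?_, fun v => ?_, fun v a ha b hb c hc => ?_⟩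
  · rw [← s₂.sign, ← s₁.sign]
    exact congrArg T.sign (hσ e)
  · rw [← s₂.label, ← s₁.label, hlift]
  · rw [← s₂.cyc _ _ ((PlanarTree.map_mem_incident σ' v a).2 ha) _
      ((PlanarTree.map_mem_incident σ' v b).2 hb) _ ((PlanarTree.map_mem_incident σ' v c).2 hc),
      ← s₁.cyc v a ha b hb c hc, hlift]
    change T.cyc _ (φ₂ (σ a)) (φ₂ (σ b)) (φ₂ (σ c)) ↔ _
    rw [hσ, hσ, hσ]

theorem of_homeo {T' T : PlanarTree Λ} (h : Homeo T' T) :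
    ∃ φ, IsSubtree T' T φ none ∧ range φ = univ := by
  obtain ⟨σ, hs, hl, hc⟩ := h
  refine ⟨σ.toOrderEmbedding, ⟨by simp, fun e f _ _ => σ.surjective f, hs, fun v => ?_,
    fun v a ha b hb c hc' => ?_⟩, σ.surjective.range_eq⟩
  · rw [← hl]; cases v <;> rfl
  · rw [← hc v a ha b hb c hc']; cases v <;> rfl

theorem branch (T : PlanarTree Λ) (e : T.Edge) :
    IsSubtree (T.branch e) T (OrderEmbedding.subtype fun f => f < e) (some e) where
  below f p hp := by
    cases hp
    exact f.2
  convex f f' _ h := ⟨⟨f', h e rfl⟩, rfl⟩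
  sign _ := rfl
  label v := by cases v <;> rfl
  cyc v _ _ _ _ _ _ := by cases v <;> rfl

theorem trunk (T : PlanarTree Λ) (c : Finset T.Edge) :
    IsSubtree (T.trunk c) T (OrderEmbedding.subtype fun f => ∀ e ∈ c, ¬ f ≤ e) none where
  below _ _ hp := by cases hp
  convex f f' hff _ := ⟨⟨f', fun e he hle => f.2 e he (hff.trans hle)⟩, rfl⟩
  sign _ := rfl
  label v := by cases v <;> rfl
  cyc v _ _ _ _ _ _ := by cases v <;> rfl

end IsSubtree

open Classical in
/-- The class of the subtree of `T` with the edges in `s` and the root `r`; the value in the `else`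
branch is never used. -/
def sub (T : PlanarTree Λ) (s : Set T.Edge) (r : Option T.Edge) : TreeClass Λ :=
  if h : ∃ T' φ, IsSubtree T' T φ r ∧ range φ = s then ⟦h.choose⟧ else ⟦T⟧

theorem IsSubtree.sub_eq {T' T : PlanarTree Λ} {φ : T'.Edge ↪o T.Edge} {r : Option T.Edge}
    (h : IsSubtree T' T φ r) {s : Set T.Edge} (hs : range φ = s) : T.sub s r = ⟦T'⟧ := by
  have hex : ∃ T' φ, IsSubtree T' T φ r ∧ range φ = s := ⟨T', φ, h, hs⟩
  rw [sub, dif_pos hex]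
  obtain ⟨ψ, h', hr⟩ := hex.choose_spec
  exact h'.mk_eq h (hr.trans hs.symm)

variable (R : Type*) [CommRing R]

/-- The comultiplication of a subtree, in terms of the ambient tree. -/
theorem IsSubtree.treeCoproduct_eq {T' T : PlanarTree Λ} {φ : T'.Edge ↪o T.Edge}
    {r : Option T.Edge} (h : IsSubtree T' T φ r) {s : Set T.Edge} (hs : range φ = s) :
    treeCoproduct R T' = gen R (T.sub s r) ⊗ₜ[R] 1 +
      ∑ K ∈ antichains s, (∏ e ∈ K, gen R (T.sub {f | f ∈ s ∧ f < e} (some e))) ⊗ₜ[R]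
        gen R (T.sub {f | f ∈ s ∧ ∀ e ∈ K, ¬ f ≤ e} r) := by
  classical
  rw [treeCoproduct, h.sub_eq hs]
  congr 1
  -- `φ` identifies the simple cuts of the subtree with the antichains in its set of edges
  refine Finset.sum_nbij (fun c => c.1.map φ.toEmbedding) ?_ ?_ ?_ ?_
  · rintro ⟨c, hc⟩ -
    rw [isSimpleCut_iff] at hc
    rw [mem_antichains]
    simp only [Finset.forall_mem_map]
    exact ⟨fun e _ => hs ▸ mem_range_self e, fun e he f hf hef =>
      hc e he f hf (φ.lt_iff_lt.1 hef)⟩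
  · rintro ⟨c, hc⟩ - ⟨c', hc'⟩ - hcc
    exact Subtype.ext (Finset.map_injective _ hcc)
  · intro K hK
    rw [Finset.mem_coe, mem_antichains] at hK
    obtain ⟨c, rfl⟩ : ∃ c : Finset T'.Edge, c.map φ.toEmbedding = K := by
      refine ⟨K.preimage φ φ.injective.injOn, ?_⟩
      ext e
      simp only [Finset.mem_map, Finset.mem_preimage]
      refine ⟨fun ⟨x, hx, hxe⟩ => hxe ▸ hx, fun he => ?_⟩
      have := hK.1 e he
      rw [← hs] at this
      obtain ⟨x, rfl⟩ := this
      exact ⟨x, he, rfl⟩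
    refine ⟨⟨c, isSimpleCut_iff.2 fun e he f hf hef => ?_⟩, by simp, rfl⟩
    exact hK.2 _ (Finset.mem_map_of_mem _ he) _ (Finset.mem_map_of_mem _ hf)
      (φ.lt_iff_lt.2 hef)
  · rintro ⟨c, hc⟩ -
    congr 1
    · rw [Finset.prod_map]
      refine Finset.prod_congr rfl fun e _ => congrArg _ (Eq.symm ?_)
      refine ((IsSubtree.branch T' e).trans h).sub_eq ?_
      ext f
      subst hs
      constructor
      · rintro ⟨x, rfl⟩
        exact ⟨mem_range_self x.1, φ.lt_iff_lt.2 x.2⟩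
      · rintro ⟨⟨x, rfl⟩, hx⟩
        exact ⟨⟨x, φ.lt_iff_lt.1 hx⟩, rfl⟩
    · refine congrArg _ (Eq.symm ?_)
      refine ((IsSubtree.trunk T' c).trans h).sub_eq ?_
      ext f
      subst hs
      simp only [Finset.forall_mem_map]
      constructor
      · rintro ⟨x, rfl⟩
        exact ⟨mem_range_self x.1, fun e he hle => x.2 e he (φ.le_iff_le.1 hle)⟩
      · rintro ⟨⟨x, rfl⟩, hx⟩
        exact ⟨⟨x, fun e he hle => hx e he (φ.le_iff_le.2 hle)⟩, rfl⟩

theorem Homeo.treeCoproduct_eq {T' T : PlanarTree Λ} (h : Homeo T' T) :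
    treeCoproduct R T' = treeCoproduct R T := by
  obtain ⟨φ, s, hφ⟩ := IsSubtree.of_homeo h
  obtain ⟨ψ, s', hψ⟩ := IsSubtree.of_homeo ((setoid Λ).refl T)
  rw [s.treeCoproduct_eq R hφ, s'.treeCoproduct_eq R hψ]

end PlanarTree

/-- The formula for the Connes-Kreimer comultiplication holds for all representatives. -/
theorem treeComul_gen (R : Type*) [CommRing R] {Λ : Type*} (T : PlanarTree Λ) :
    treeComul R Λ (gen R (⟦T⟧ : TreeClass Λ)) = treeCoproduct R T := by
  rw [treeComul, extendAlg_gen]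
  exact PlanarTree.Homeo.treeCoproduct_eq R (Quotient.mk_out (s := PlanarTree.setoid Λ) T)

/-! ### Coassociativity of the Connes-Kreimer comultiplication -/

namespace PlanarTree

variable {Λ : Type*} (R : Type*) [CommRing R] (T : PlanarTree Λ)

/-- The generator `T_e`. -/
def branchGen (e : T.Edge) : FreeSym R (TreeClass Λ) := gen R (T.sub {f | f < e} (some e))

/-- The generator given by the subtree of `T_e` which contains the root after the removal of the
edges in `K`. -/
def middleGen (e : T.Edge) (K : Finset T.Edge) : FreeSym R (TreeClass Λ) :=
  gen R (T.sub {f | f < e ∧ ∀ k ∈ K, ¬ f ≤ k} (some e))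

/-- The generator `T_0`. -/
def trunkGen (K : Finset T.Edge) : FreeSym R (TreeClass Λ) :=
  gen R (T.sub {f | ∀ k ∈ K, ¬ f ≤ k} none)

theorem sub_univ : T.sub univ none = ⟦T⟧ := by
  obtain ⟨φ, s, hφ⟩ := IsSubtree.of_homeo ((setoid Λ).refl T)
  exact s.sub_eq hφ

theorem sub_branch (e : T.Edge) : T.sub {f | f < e} (some e) = ⟦T.branch e⟧ :=
  (IsSubtree.branch T e).sub_eq Subtype.range_coe

theorem sub_trunk (c : Finset T.Edge) : T.sub {f | ∀ e ∈ c, ¬ f ≤ e} none = ⟦T.trunk c⟧ :=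
  (IsSubtree.trunk T c).sub_eq Subtype.range_coe

theorem treeComul_gen_eq : treeComul R Λ (gen R ⟦T⟧) = gen R ⟦T⟧ ⊗ₜ[R] 1 +
    ∑ K ∈ antichains (univ : Set T.Edge), (∏ e ∈ K, T.branchGen R e) ⊗ₜ[R] T.trunkGen R K := by
  obtain ⟨φ, s, hφ⟩ := IsSubtree.of_homeo ((setoid Λ).refl T)
  rw [treeComul_gen, s.treeCoproduct_eq R hφ, sub_univ]
  simp only [branchGen, trunkGen, mem_univ, true_and]

open Classical in
/-- In the comultiplication of `T_e`, the term `T_e ⊗ 1` corresponds to the antichain `{e}`. -/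
theorem treeComul_branchGen (e : T.Edge) : treeComul R Λ (T.branchGen R e) =
    ∑ K ∈ antichains {f | f ≤ e}, (∏ f ∈ K, T.branchGen R f) ⊗ₜ[R]
      (if e ∈ K then 1 else T.middleGen R e K) := by
  -- an antichain below `e` is `{e}` or lies strictly below `e`
  have h1 : antichains {f | f ≤ e} = insert {e} (antichains {f | f < e}) := by
    ext K
    rw [Finset.mem_insert, mem_antichains, mem_antichains]
    constructor
    · rintro ⟨h1, h2⟩
      by_cases he : e ∈ K
      · left
        ext f
        rw [Finset.mem_singleton]
        exact ⟨fun hf => (h1 f hf : f ≤ e).eq_of_not_lt (h2 f hf e he), fun h => h ▸ he⟩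
      · exact Or.inr ⟨fun f hf => lt_of_le_of_ne (h1 f hf) fun h => he (h ▸ hf), h2⟩
    · rintro (rfl | ⟨h1, h2⟩)
      · simp
      · exact ⟨fun f hf => (h1 f hf : f < e).le, h2⟩
  have h2 : ({e} : Finset T.Edge) ∉ antichains {f | f < e} := by
    simp [mem_antichains]
  have h3 : T.branchGen R e = gen R ⟦T.branch e⟧ := by rw [branchGen, sub_branch]
  rw [h1, Finset.sum_insert h2, h3, treeComul_gen,
    (IsSubtree.branch T e).treeCoproduct_eq R Subtype.range_coe]
  congr 1
  · simp [branchGen]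
  · refine Finset.sum_congr rfl fun K hK => ?_
    rw [mem_antichains] at hK
    have he : e ∉ K := fun he => lt_irrefl e (hK.1 e he)
    rw [if_neg he]
    congr 1
    refine Finset.prod_congr rfl fun f hf => ?_
    rw [branchGen]
    congr 2
    ext g
    exact ⟨fun h => h.2, fun h => ⟨lt_trans h (hK.1 f hf), h⟩⟩

theorem treeComul_trunkGen (C : Finset T.Edge) : treeComul R Λ (T.trunkGen R C) =
    T.trunkGen R C ⊗ₜ[R] 1 + ∑ K ∈ antichains {f | ∀ k ∈ C, ¬ f ≤ k},
      (∏ e ∈ K, T.middleGen R e C) ⊗ₜ[R]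
        gen R (T.sub {f | (∀ k ∈ C, ¬ f ≤ k) ∧ ∀ k ∈ K, ¬ f ≤ k} none) := by
  have h3 : T.trunkGen R C = gen R ⟦T.trunk C⟧ := by rw [trunkGen, sub_trunk]
  rw [h3, treeComul_gen, (IsSubtree.trunk T C).treeCoproduct_eq R Subtype.range_coe, ← sub_trunk]
  congr 1
  refine Finset.sum_congr rfl fun K hK => ?_
  congr 1
  refine Finset.prod_congr rfl fun f hf => ?_
  rw [middleGen]
  congr 2
  ext g
  exact and_comm

variable {T} in
theorem disjoint_lower {d : Finset T.Edge} (hd : ∀ e ∈ d, ∀ f ∈ d, ¬ e < f) :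
    ∀ e ∈ d, ∀ f ∈ d, e ≠ f → Disjoint {g | g ≤ e} {g | g ≤ f} := by
  intro e he f hf hne
  rw [disjoint_left]
  intro g hge hgf
  rcases T.chain g e f hge hgf with h | h
  · exact hd e he f hf (lt_of_le_of_ne h hne)
  · exact hd f hf e he (lt_of_le_of_ne h hne.symm)

variable {T} in
open Classical in
/-- The comultiplication of the forest beyond a simple cut `d` is a sum over the antichains of edges
of `d` or beyond `d`. -/
theorem prod_treeComul_branchGen {d : Finset T.Edge} (hd : ∀ e ∈ d, ∀ f ∈ d, ¬ e < f) :
    ∏ e ∈ d, treeComul R Λ (T.branchGen R e) =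
      ∑ C ∈ antichains {f | ∃ e ∈ d, f ≤ e}, (∏ f ∈ C, T.branchGen R f) ⊗ₜ[R]
        ∏ e ∈ d \ C, T.middleGen R e C := by
  simp only [treeComul_branchGen]
  have hdis := disjoint_lower hd
  rw [prod_sum_subsets d (fun e => {f | f ≤ e}) hdis _ (fun e _ K hK => (mem_antichains.1 hK).1) _
    (antichains {f | ∃ e ∈ d, f ≤ e})]
  · refine Finset.sum_congr rfl fun C hC => ?_
    rw [mem_antichains] at hC
    have h1 : ∀ (s : Finset T.Edge) (F G : T.Edge → FreeSym R (TreeClass Λ)),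
        ∏ e ∈ s, (F e ⊗ₜ[R] G e) = (∏ e ∈ s, F e) ⊗ₜ[R] ∏ e ∈ s, G e := by
      intro s F G
      induction s using Finset.induction_on with
      | empty => simp [Algebra.TensorProduct.one_def]
      | insert a s ha ih =>
        rw [Finset.prod_insert ha, Finset.prod_insert ha, Finset.prod_insert ha, ih,
          Algebra.TensorProduct.tmul_mul_tmul]
    rw [h1]
    congr 1
    · -- the parts of `C` below the edges of `d` partition `C`
      rw [← Finset.prod_biUnion]
      · refine Finset.prod_congr ?_ fun _ _ => rfl
        ext f
        simp only [Finset.mem_biUnion, Finset.mem_filter, mem_ofPred_eq]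
        exact ⟨fun ⟨e, _, hf, _⟩ => hf, fun hf => (hC.1 f hf).imp fun e he => ⟨he.1, hf, he.2⟩⟩
      · intro e he f hf hne
        rw [Function.onFun, Finset.disjoint_left]
        intro g hg hg'
        exact disjoint_left.1 (hdis e he f hf hne) (Finset.mem_filter.1 hg).2
          (Finset.mem_filter.1 hg').2
    · rw [Finset.sdiff_eq_filter, Finset.prod_filter]
      refine Finset.prod_congr rfl fun e he => ?_
      by_cases heC : e ∈ C
      · rw [if_pos (Finset.mem_filter.2 ⟨heC, show e ∈ {f | f ≤ e} from le_refl e⟩),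
          if_neg (not_not.2 heC)]
      · rw [if_neg fun h => heC (Finset.mem_filter.1 h).1, if_pos heC, middleGen, middleGen]
        congr 2
        ext g
        refine and_congr_right fun hge => ⟨fun h k hk hgk => ?_, fun h k hk => ?_⟩
        · obtain ⟨f, hf, hkf⟩ := hC.1 k hk
          have hef : e = f := by
            by_contra hne
            exact disjoint_left.1 (hdis e he f hf hne) hge.le (hgk.trans hkf)
          exact h k (Finset.mem_filter.2 ⟨hk, by rw [hef]; exact hkf⟩) hgk
        · exact h k (Finset.mem_filter.1 hk).1
  · intro C
    simp only [mem_antichains, Finset.mem_filter]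
    refine and_congr_right fun hC => ⟨fun h e he => ⟨fun f hf => hf.2, fun f hf g hg =>
      h f hf.1 g hg.1⟩, fun h e he f hf hef => ?_⟩
    obtain ⟨g, hg, hfg⟩ := hC f hf
    exact (h g hg).2 e ⟨he, hef.le.trans hfg⟩ f ⟨hf, hfg⟩ hef

/-- A pair of nested simple cuts: an outer cut `d` together with an antichain `C` below it, or,
equivalently, an inner cut `C` together with a simple cut of what remains. -/
theorem sum_antichains_comm {A : Type*} [AddCommMonoid A]
    (F : Finset T.Edge → Finset T.Edge → Set T.Edge → A) : open Classical in
    ∑ d ∈ antichains (univ : Set T.Edge), ∑ C ∈ antichains {f | ∃ e ∈ d, f ≤ e},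
      F C (d \ C) {f | ∀ k ∈ d, ¬ f ≤ k} =
    ∑ C ∈ antichains (univ : Set T.Edge), ∑ K ∈ antichains {f | ∀ k ∈ C, ¬ f ≤ k},
      F C K {f | (∀ k ∈ C, ¬ f ≤ k) ∧ ∀ k ∈ K, ¬ f ≤ k} := by
  classical
  rw [Finset.sum_sigma', Finset.sum_sigma']
  -- `(d, C) ↦ (C, d \ C)`; conversely `d` consists of `K` and the edges of `C` not below `K`
  refine Finset.sum_nbij' (fun x => ⟨x.2, x.1 \ x.2⟩)
    (fun x => ⟨x.2 ∪ x.1.filter fun e => ∀ f ∈ x.2, ¬ e < f, x.1⟩) ?_ ?_ ?_ ?_ ?_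
  · rintro ⟨d, C⟩ h
    simp only [Finset.mem_sigma, mem_antichains, Finset.mem_sdiff] at h ⊢
    obtain ⟨⟨-, hd⟩, hC, hC'⟩ := h
    refine ⟨⟨fun _ _ => trivial, hC'⟩, fun f hf k hk hfk => ?_,
      fun e he f hf => hd e he.1 f hf.1⟩
    obtain ⟨e, he, hke⟩ := hC k hk
    have h1 : f = e := (hfk.trans hke).eq_of_not_lt (hd f hf.1 e he)
    exact hf.2 (by rw [le_antisymm hfk (h1 ▸ hke)]; exact hk)
  · rintro ⟨C, K⟩ h
    simp only [Finset.mem_sigma, mem_antichains, Finset.mem_union, Finset.mem_filter] at h ⊢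
    obtain ⟨⟨-, hC⟩, hK, hK'⟩ := h
    refine ⟨⟨fun _ _ => trivial, ?_⟩, fun e he => ?_, hC⟩
    · rintro e (he | he) f (hf | hf) hef
      · exact hK' e he f hf hef
      · exact hK e he f hf.1 hef.le
      · exact he.2 f hf hef
      · exact hC e he.1 f hf.1 hef
    · by_cases h1 : ∀ f ∈ K, ¬ e < f
      · exact ⟨e, Or.inr ⟨he, h1⟩, le_rfl⟩
      · push Not at h1
        obtain ⟨f, hf, hef⟩ := h1
        exact ⟨f, Or.inl hf, hef.le⟩
  · rintro ⟨d, C⟩ h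
    simp only [Finset.mem_sigma, mem_antichains] at h
    obtain ⟨⟨-, hd⟩, hC, hC'⟩ := h
    refine Sigma.ext ?_ HEq.rfl
    ext e
    simp only [Finset.mem_union, Finset.mem_sdiff, Finset.mem_filter]
    constructor
    · rintro (h | ⟨heC, h⟩)
      · exact h.1
      · obtain ⟨f, hf, hef⟩ := hC e heC
        rcases hef.eq_or_lt with rfl | hlt
        · exact hf
        · exact absurd hlt (h f ⟨hf, fun hfC => hC' e heC f hfC hlt⟩)
    · intro he
      by_cases heC : e ∈ C
      · exact Or.inr ⟨heC, fun f hf => hd e he f hf.1⟩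
      · exact Or.inl ⟨he, heC⟩
  · rintro ⟨C, K⟩ h
    simp only [Finset.mem_sigma, mem_antichains] at h
    obtain ⟨⟨-, hC⟩, hK, hK'⟩ := h
    refine Sigma.ext rfl (heq_of_eq ?_)
    ext e
    simp only [Finset.mem_union, Finset.mem_sdiff, Finset.mem_filter]
    constructor
    · rintro ⟨h | h, h'⟩
      · exact h
      · exact absurd h.1 h'
    · exact fun he => ⟨Or.inl he, fun heC => hK e he e heC le_rfl⟩
  · rintro ⟨d, C⟩ h
    simp only [Finset.mem_sigma, mem_antichains] at h
    obtain ⟨⟨-, hd⟩, hC, hC'⟩ := h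
    congr 1
    ext f
    constructor
    · refine fun h => ⟨fun k hk hfk => ?_, fun k hk => h k (Finset.mem_sdiff.1 hk).1⟩
      obtain ⟨e, he, hke⟩ := hC k hk
      exact h e he (hfk.trans hke)
    · rintro ⟨h1, h2⟩ k hk
      by_cases hkC : k ∈ C
      · exact h1 k hkC
      · exact h2 k (Finset.mem_sdiff.2 ⟨hk, hkC⟩)

end PlanarTree

open PlanarTree in
/-- Both sides are sums over pairs of nested simple cuts. -/
theorem treeComul_coassoc (R : Type*) [CommRing R] (Λ : Type*) :
    (Algebra.TensorProduct.assoc R R R (FreeSym R (TreeClass Λ)) (FreeSym R (TreeClass Λ))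
        (FreeSym R (TreeClass Λ))).toAlgHom.comp
      ((Algebra.TensorProduct.map (treeComul R Λ) (.id R _)).comp (treeComul R Λ)) =
    (Algebra.TensorProduct.map (.id R _) (treeComul R Λ)).comp (treeComul R Λ) := by
  classical
  refine freeSym_algHom_ext (A := FreeSym R (TreeClass Λ) ⊗[R]
    (FreeSym R (TreeClass Λ) ⊗[R] FreeSym R (TreeClass Λ))) fun t => ?_
  induction t using Quotient.inductionOn with
  | _ T =>
  simp only [AlgHom.comp_apply, treeComul_gen_eq, map_add, map_sum,
    Algebra.TensorProduct.map_tmul, AlgHom.id_apply, map_prod, treeComul_trunkGen,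
    map_one, TensorProduct.tmul_add, TensorProduct.add_tmul, TensorProduct.tmul_sum,
    TensorProduct.sum_tmul]
  have h := sum_antichains_comm T (fun C K s => (∏ e ∈ C, T.branchGen R e) ⊗ₜ[R]
    ((∏ e ∈ K, T.middleGen R e C) ⊗ₜ[R] gen R (T.sub s none)))
  rw [Finset.sum_add_distrib, ← h, ← add_assoc]
  congr 1
  refine Finset.sum_congr rfl fun d hd => ?_
  rw [prod_treeComul_branchGen R (mem_antichains.1 hd).2, TensorProduct.sum_tmul, map_sum]
  rfl

theorem genProd_map (R : Type*) [CommRing R] {X E : Type*} (K : Finset E) (F : E → X) :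
    genProd R (K.val.map F) = ∏ e ∈ K, gen R (F e) := by
  rw [genProd, Multiset.map_map]
  rfl

/-- The number of edges of a tree. -/
def edgeNumber {Λ : Type*} (t : TreeClass Λ) : ℕ := Nat.card t.out.Edge

theorem edgeNumber_mk {Λ : Type*} (T : PlanarTree Λ) :
    edgeNumber (⟦T⟧ : TreeClass Λ) = Nat.card T.Edge := by
  obtain ⟨σ, -⟩ := Quotient.mk_out (s := PlanarTree.setoid Λ) T
  exact Nat.card_congr σ.toEquiv

open PlanarTree in
/-- Nontrivial simple cuts split a tree into trees with fewer edges. -/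
theorem treeComul_isConnected (R : Type*) [CommRing R] (Λ : Type*) :
    IsConnected edgeNumber (treeComul R Λ) := by
  classical
  intro t
  induction t using Quotient.inductionOn with
  | _ T =>
  have h0 : (∅ : Finset T.Edge) ∈ antichains (univ : Set T.Edge) := by simp [mem_antichains]
  -- the empty antichain gives the term `1 ⊗ T`
  refine ⟨{K // K ∈ (antichains (univ : Set T.Edge)).erase ∅}, inferInstance, fun _ => 1,
    fun K => K.1.val.map fun e => T.sub {f | f < e} (some e),
    fun K => T.sub {f | ∀ k ∈ K.1, ¬ f ≤ k} none, ?_, ?_⟩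
  · simp only [one_smul, genProd_map]
    rw [Finset.sum_coe_sort ((antichains (univ : Set T.Edge)).erase ∅) fun K =>
      (∏ e ∈ K, gen R (T.sub {f | f < e} (some e))) ⊗ₜ[R]
        gen R (T.sub {f | ∀ k ∈ K, ¬ f ≤ k} none), treeComul_gen_eq, ← Finset.add_sum_erase _ _ h0,
      add_assoc]
    congr 2
    simp [trunkGen, sub_univ]
  · rintro ⟨K, hK⟩
    obtain ⟨hne, hK⟩ := Finset.mem_erase.1 hK
    obtain ⟨e, he⟩ := Finset.nonempty_iff_ne_empty.2 hne
    refine ⟨by simpa using hne, fun z hz => ?_, ?_⟩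
    · obtain ⟨f, -, rfl⟩ := Multiset.mem_map.1 hz
      rw [sub_branch, edgeNumber_mk, edgeNumber_mk]
      exact Finite.card_subtype_lt (x := f) (lt_irrefl f)
    · simp only [sub_trunk, edgeNumber_mk]
      exact Finite.card_subtype_lt (x := e) fun h => h e he le_rfl

/-! ### The trees of faces -/

section FaceTrees

variable {M : Type*} [TopologicalSpace M] [ChartedSpace (EuclideanHalfSpace 2) M] {Λ : Type*}

theorem isCut_empty {α : PointedLoop M} : IsCut (∅ : Finset (Crossing α)) :=
  isSimpleCut_empty.1

/-- The tree dual to the splitting of the disk into the faces of a cut, where the vertices are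
labeled with the images of the pointed loops of the faces under an arbitrary map `φ`. -/
def faceTree (φ : PointedClass M → Λ) (α : PointedLoop M) (H : Finset (Crossing α))
    (hH : IsCut H) : PlanarTree Λ where
  Edge := {p // p ∈ H}
  chain := (cutTree α H hH).chain
  sign := (cutTree α H hH).sign
  label v := φ (faceClass α H (v.map Subtype.val))
  cyc := (cutTree α H hH).cyc
  isCyclicOrder := (cutTree α H hH).isCyclicOrder

/-- The edges of the tree of a loop `β` which follows `α`, as edges of a tree of `α`. -/
def Follows.edgeEmb {α β : PointedLoop M} {A : Set S1} {b : S1} {h : AmbientIsotopy M}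
    {g : S1 → S1} (s : Follows α β A b h g) {H : Finset (Crossing α)} {K : Finset (Crossing β)}
    (hK : ∀ r ∈ K, s.pull r ∈ H) : {r // r ∈ K} ↪o {q // q ∈ H} where
  toFun r := ⟨s.pull r.1, hK r.1 r.2⟩
  inj' _ _ e := Subtype.ext (s.pull_injective (congrArg Subtype.val e))
  map_rel_iff' := s.pull_le_iff

namespace Follows

variable {α β : PointedLoop M} {A : Set S1} {b : S1} {h : AmbientIsotopy M} {g : S1 → S1}
  {H : Finset (Crossing α)} {K : Finset (Crossing β)}

theorem isSubtree [OrientedSurface M] (s : Follows α β A b h g) (φ : PointedClass M → Λ)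
    (hH : IsCut H)
    (hK : IsCut K) (hKH : ∀ r ∈ K, s.pull r ∈ H) (ρ : Option {q // q ∈ H})
    (below : ∀ r ∈ K, ∀ p ∈ ρ, s.pull r < p.1)
    (convex : ∀ r ∈ K, ∀ q ∈ H, s.pull r ≤ q → (∀ p ∈ ρ, q < p.1) → q ∈ K.map s.pullEmb)
    (face : ∀ w : Option {r // r ∈ K},
      faceClass α H ((w.elim ρ fun r => some (s.edgeEmb hKH r)).map Subtype.val) =
        faceClass β K (w.map Subtype.val)) :
    (faceTree φ β K hK).IsSubtree (faceTree φ α H hH) (s.edgeEmb hKH) ρ where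
  below r p hp := below r.1 r.2 p hp
  convex r q hrq hq := by
    obtain ⟨r', hr', e⟩ := Finset.mem_map.1 (convex r.1 r.2 q.1 q.2 hrq hq)
    exact ⟨⟨r', hr'⟩, Subtype.ext e⟩
  sign r := s.sign_pull r.1
  label w := congrArg φ (face w)
  cyc _ _ _ _ _ _ _ := s.sbtw_pull_iff

/-- The tree of a loop beyond a chord `p` of the cut `H`. -/
theorem sub_branch [OrientedSurface M] {p : Crossing α} (s : Follows α β p.closedArc p.1.1 h g)
    (φ : PointedClass M → Λ) (hH : IsCut H) (hp : p ∈ H) (hK : IsCut K)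
    (hKH : ∀ q, q ∈ K.map s.pullEmb ↔ q ∈ H ∧ q < p) :
    (faceTree φ α H hH).sub {q | q.1 < p} (some ⟨p, hp⟩) = ⟦faceTree φ β K hK⟧ := by
  have hKH' : ∀ r ∈ K, s.pull r ∈ H ∧ s.pull r < p := fun r hr =>
    (hKH _).1 (s.mem_map_pullEmb.2 hr)
  refine (s.isSubtree φ hH hK (fun r hr => (hKH' r hr).1) (some ⟨p, hp⟩) ?_ ?_ ?_).sub_eq ?_
  · rintro r hr _ ⟨⟩
    exact (hKH' r hr).2
  · intro r _ q hq _ h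
    exact (hKH q).2 ⟨hq, h _ rfl⟩
  · intro w
    have h1 : ((w.elim (some ⟨p, hp⟩) fun r => some (s.edgeEmb (H := H)
        (fun r hr => (hKH' r hr).1) r)).map Subtype.val) =
        some ((w.map Subtype.val).elim p s.pull) := by cases w <;> rfl
    have hw : ∀ r ∈ w.map Subtype.val, r ∈ K := by
      intro r hr
      obtain ⟨r', -, rfl⟩ := Option.mem_map.1 hr
      exact r'.2
    rw [h1]
    exact s.faceClass_eq hw (s.faceArcs_closedArc hKH _ hw) (s.map_faceBase_elim _)
      (exists_isFaceLoop hH _) (exists_isFaceLoop hK _)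
  · ext q
    constructor
    · rintro ⟨r, rfl⟩
      exact (hKH' r.1 r.2).2
    · intro hq
      obtain ⟨r, hr, e⟩ := Finset.mem_map.1 ((hKH q.1).2 ⟨q.2, hq⟩)
      exact ⟨⟨r, hr⟩, Subtype.ext e⟩

/-- The tree of a root loop of a simple cut `c ⊆ H`. -/
theorem sub_trunk [OrientedSurface M] {c : Finset (Crossing α)}
    (s : Follows α β (faceArcs c none) α.base h g)
    (φ : PointedClass M → Λ) (hH : IsCut H) (hcH : c ⊆ H) (hK : IsCut K)
    (hKH : ∀ q, q ∈ K.map s.pullEmb ↔ q ∈ H ∧ ∀ e ∈ c, ¬ q ≤ e) :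
    (faceTree φ α H hH).sub {q | ∀ e ∈ c, ¬ q.1 ≤ e} none = ⟦faceTree φ β K hK⟧ := by
  have hKH' : ∀ r ∈ K, s.pull r ∈ H ∧ ∀ e ∈ c, ¬ s.pull r ≤ e := fun r hr =>
    (hKH _).1 (s.mem_map_pullEmb.2 hr)
  refine (s.isSubtree φ hH hK (fun r hr => (hKH' r hr).1) none ?_ ?_ ?_).sub_eq ?_
  · simp
  · intro r hr q hq hrq _
    exact (hKH q).2 ⟨hq, fun e he hqe => (hKH' r hr).2 e he (hrq.trans hqe)⟩
  · intro w
    have h1 : ((w.elim none fun r => some (s.edgeEmb (H := H)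
        (fun r hr => (hKH' r hr).1) r)).map Subtype.val) =
        (w.map Subtype.val).map s.pull := by cases w <;> rfl
    have hw : ∀ r ∈ w.map Subtype.val, r ∈ K := by
      intro r hr
      obtain ⟨r', -, rfl⟩ := Option.mem_map.1 hr
      exact r'.2
    rw [h1]
    exact s.faceClass_eq hw (s.faceArcs_root hH hcH hKH _ hw) (s.map_faceBase _)
      (exists_isFaceLoop hH _) (exists_isFaceLoop hK _)
  · ext q
    constructor
    · rintro ⟨r, rfl⟩
      exact (hKH' r.1 r.2).2
    · intro hq
      obtain ⟨r, hr, e⟩ := Finset.mem_map.1 ((hKH q.1).2 ⟨q.2, hq⟩)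
      exact ⟨⟨r, hr⟩, Subtype.ext e⟩

end Follows

section Classes

variable (φ : PointedClass M → Λ) (α : PointedLoop M)

open Classical in
/-- The class of the tree of a cut; the value for sets which are not cuts is never used. -/
def faceTreeClass (H : Finset (Crossing α)) : TreeClass Λ :=
  if h : IsCut H then ⟦faceTree φ α H h⟧ else ⟦faceTree φ α ∅ isCut_empty⟧

open Classical in
/-- The class of the branch at `p` of the tree of a cut. -/
def branchClass (H : Finset (Crossing α)) (p : Crossing α) : TreeClass Λ :=
  if h : IsCut H ∧ p ∈ H then (faceTree φ α H h.1).sub {q | q.1 < p} (some ⟨p, h.2⟩)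
  else ⟦faceTree φ α ∅ isCut_empty⟧

open Classical in
/-- The class of the trunk of the tree of a cut `H`, after the removal of the edges in `c`. -/
def trunkClass (H c : Finset (Crossing α)) : TreeClass Λ :=
  if h : IsCut H then (faceTree φ α H h).sub {q | ∀ e ∈ c, ¬ q.1 ≤ e} none
  else ⟦faceTree φ α ∅ isCut_empty⟧

variable {φ α} {H : Finset (Crossing α)}

/-- The crossing which is an edge of the tree of a cut. -/
def edgeCrossing (hH : IsCut H) : (faceTree φ α H hH).Edge ↪o Crossing α :=
  OrderEmbedding.subtype fun p => p ∈ H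

theorem range_edgeCrossing (hH : IsCut H) : range (edgeCrossing (φ := φ) hH) = {p | p ∈ H} :=
  Subtype.range_coe

theorem faceTreeClass_eq (hH : IsCut H) : faceTreeClass φ α H = ⟦faceTree φ α H hH⟧ := dif_pos hH

theorem Follows.branchClass_eq [OrientedSurface M] {β : PointedLoop M} {h : AmbientIsotopy M}
    {g : S1 → S1}
    {K : Finset (Crossing β)} {p : Crossing α} (s : Follows α β p.closedArc p.1.1 h g)
    (hH : IsCut H) (hp : p ∈ H) (hKH : ∀ q, q ∈ K.map s.pullEmb ↔ q ∈ H ∧ q < p) :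
    branchClass φ α H p = faceTreeClass φ β K := by
  have hK : IsCut K := s.isCut_map_iff.1 fun q hq r hr =>
    hH q ((hKH q).1 hq).1 r ((hKH r).1 hr).1
  rw [branchClass, dif_pos ⟨hH, hp⟩, s.sub_branch φ hH hp hK hKH, faceTreeClass_eq hK]

theorem Follows.trunkClass_eq [OrientedSurface M] {β : PointedLoop M} {h : AmbientIsotopy M}
    {g : S1 → S1}
    {K : Finset (Crossing β)} {c : Finset (Crossing α)}
    (s : Follows α β (faceArcs c none) α.base h g) (hH : IsCut H) (hcH : c ⊆ H)
    (hKH : ∀ q, q ∈ K.map s.pullEmb ↔ q ∈ H ∧ ∀ e ∈ c, ¬ q ≤ e) :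
    trunkClass φ α H c = faceTreeClass φ β K := by
  have hK : IsCut K := s.isCut_map_iff.1 fun q hq r hr =>
    hH q ((hKH q).1 hq).1 r ((hKH r).1 hr).1
  rw [trunkClass, dif_pos hH, s.sub_trunk φ hH hcH hK hKH, faceTreeClass_eq hK]

/-- The branch at `p` depends only on the part of the cut which lies beyond `p`. -/
theorem branchClass_congr [OrientedSurface M] {G : Finset (Crossing α)} {p : Crossing α}
    (hH : IsCut H) (hG : IsCut G) (hpH : p ∈ H) (hpG : p ∈ G) (h : ∀ q, q < p → (q ∈ H ↔ q ∈ G)) :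
    branchClass φ α H p = branchClass φ α G p := by
  classical
  obtain ⟨β, g, s⟩ := exists_follows_closedArc p
  obtain ⟨K, hK⟩ := s.exists_map_eq (G := H.filter fun r => r < p) fun r hr =>
    isInner_closedArc_iff.2 (Finset.mem_filter.1 hr).2
  rw [s.branchClass_eq (K := K) hH hpH fun q => by rw [hK, Finset.mem_filter],
    s.branchClass_eq (K := K) hG hpG fun q => by
      rw [hK, Finset.mem_filter]; exact and_congr_left fun hq => h q hq]

/-- The trunk depends only on the part of the cut which lies on the root side of `c`. -/
theorem trunkClass_congr [OrientedSurface M] {G c : Finset (Crossing α)}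
    (hc : IsSimpleCut c) (hH : IsCut H) (hG : IsCut G) (hcH : c ⊆ H) (hcG : c ⊆ G)
    (h : ∀ q, (∀ e ∈ c, ¬ q ≤ e) → (q ∈ H ↔ q ∈ G)) :
    trunkClass φ α H c = trunkClass φ α G c := by
  classical
  obtain ⟨β, g, -, s⟩ := exists_follows_root hc
  obtain ⟨K, hK⟩ := s.exists_map_eq (G := H.filter fun r => ∀ e ∈ c, ¬ r ≤ e) fun r hr => by
    rw [Finset.mem_filter] at hr
    exact (isInner_root_iff fun e he => hH r hr.1 e (hcH he) fun h => hr.2 e he h.le).2 hr.2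
  rw [s.trunkClass_eq (K := K) hH hcH fun q => by rw [hK, Finset.mem_filter],
    s.trunkClass_eq (K := K) hG hcG fun q => by
      rw [hK, Finset.mem_filter]; exact and_congr_left fun hq => h q hq]

theorem trunkClass_empty (hH : IsCut H) : trunkClass φ α H ∅ = faceTreeClass φ α H := by
  rw [trunkClass, dif_pos hH, faceTreeClass_eq hH, ← PlanarTree.sub_univ]
  congr 1
  exact eq_univ_of_forall fun q e he => absurd he (Finset.notMem_empty e)

/-- The comultiplication of the tree of a cut. -/
theorem treeComul_faceTreeClass (R : Type*) [CommRing R] (hH : IsCut H) :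
    treeComul R Λ (gen R (faceTreeClass φ α H)) = gen R (faceTreeClass φ α H) ⊗ₜ[R] 1 +
      ∑ c ∈ antichains {p | p ∈ H}, (∏ p ∈ c, gen R (branchClass φ α H p)) ⊗ₜ[R]
        gen R (trunkClass φ α H c) := by
  classical
  rw [faceTreeClass_eq hH, PlanarTree.treeComul_gen_eq]
  congr 1
  have hmem : ∀ e, edgeCrossing hH e ∈ H := fun e =>
    (range_edgeCrossing (φ := φ) hH).subset (mem_range_self e)
  -- identify sets of edges of the tree with sets of crossings in `H`
  refine Finset.sum_nbij (fun c => c.map (edgeCrossing hH).toEmbedding) ?_ ?_ ?_ ?_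
  · intro c hc
    rw [mem_antichains] at hc ⊢
    simp only [Finset.forall_mem_map]
    exact ⟨fun p _ => hmem p, fun p hp q hq h =>
      hc.2 p hp q hq ((edgeCrossing hH).lt_iff_lt.1 h)⟩
  · exact (Finset.map_injective _).injOn
  · intro c hc
    rw [Finset.mem_coe, mem_antichains] at hc
    refine ⟨c.preimage (edgeCrossing hH) (edgeCrossing hH).injective.injOn, ?_, ?_⟩
    · rw [Finset.mem_coe, mem_antichains]
      exact ⟨fun _ _ => trivial, fun p hp q hq h => hc.2 _ (Finset.mem_preimage.1 hp) _
        (Finset.mem_preimage.1 hq) ((edgeCrossing hH).lt_iff_lt.2 h)⟩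
    · ext p
      simp only [Finset.mem_map, Finset.mem_preimage]
      refine ⟨fun ⟨e, he, hep⟩ => hep ▸ he, fun hp => ?_⟩
      obtain ⟨e, rfl⟩ := (range_edgeCrossing (φ := φ) hH).superset (hc.1 p hp)
      exact ⟨e, hp, rfl⟩
  · intro c _
    congr 1
    · rw [Finset.prod_map]
      refine Finset.prod_congr rfl fun p _ => ?_
      change _ = gen R (branchClass φ α H (edgeCrossing hH p))
      rw [PlanarTree.branchGen, branchClass, dif_pos ⟨hH, hmem p⟩]
      rfl
    · rw [PlanarTree.trunkGen, trunkClass, dif_pos hH]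
      simp only [Finset.forall_mem_map]
      rfl

end Classes

end FaceTrees

/-! ### The expansion of a loop into trees -/

section CutExpansion

variable {M : Type*} [TopologicalSpace M] [ChartedSpace (EuclideanHalfSpace 2) M] {Λ : Type*}

section CutCombinatorics

variable {α : PointedLoop M}

namespace Crossing

theorem not_linked_of_le {p q : Crossing α} (h : p ≤ q) : ¬ Linked p q := by
  rcases h with rfl | h
  · rintro (h | h) <;> exact lt_irrefl _ h.1
  · rintro (h' | h')
    · exact lt_asymm h.1 h'.1
    · exact lt_asymm h.2 h'.2.2

theorem not_linked_of_disjoint {p q : Crossing α} (h : Disjoint p.closedArc q.closedArc) :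
    ¬ Linked p q := by
  rw [disjoint_left] at h
  rintro (h' | h')
  · exact h (show q.1.1 ∈ p.closedArc from ⟨h'.1.le, h'.2.1.le⟩) q.fst_mem_closedArc
  · exact h p.fst_mem_closedArc (show p.1.1 ∈ q.closedArc from ⟨h'.1.le, h'.2.1.le⟩)

theorem closedArc_subset {p q : Crossing α} (h : p ≤ q) : p.closedArc ⊆ q.closedArc := by
  rcases h with rfl | h
  · exact Subset.rfl
  · exact fun x hx => ⟨h.1.le.trans hx.1, hx.2.trans h.2.le⟩

/-- A chord beyond `p` is not linked with any chord on the root side of `p`. -/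
theorem not_linked_of_le_of_not_le {p q r : Crossing α} (hpq : p ≤ q) (hqr : ¬ Linked q r)
    (hrq : ¬ r ≤ q) : ¬ Linked p r := by
  by_cases h : q ≤ r
  · exact not_linked_of_le (hpq.trans h)
  · exact not_linked_of_disjoint ((disjoint_closedArc hqr h hrq).mono_left (closedArc_subset hpq))

/-- Two chords beyond which there is a common chord are nested or linked. -/
theorem le_or_le_of_le {p q r : Crossing α} (hq : p ≤ q) (hr : p ≤ r) (h : ¬ Linked q r) :
    q ≤ r ∨ r ≤ q := by
  by_contra hn
  rw [not_or] at hn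
  exact disjoint_left.1 (disjoint_closedArc h hn.1 hn.2)
    (closedArc_subset hq p.fst_mem_closedArc) (closedArc_subset hr p.fst_mem_closedArc)

end Crossing

theorem IsCut.subset {G H : Finset (Crossing α)} (hG : IsCut G) (h : H ⊆ G) : IsCut H :=
  fun p hp q hq => hG p (h hp) q (h hq)

/-- The crossings on the side of the face `v` of a simple cut `c`. -/
def region (c : Finset (Crossing α)) : Option (Crossing α) → Set (Crossing α)
  | none => {q | ∀ e ∈ c, ¬ Crossing.Linked q e ∧ ¬ q ≤ e}
  | some p => {q | q < p}

variable {c : Finset (Crossing α)}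

theorem disjoint_region (hc : IsSimpleCut c) : ∀ v ∈ c.insertNone, ∀ w ∈ c.insertNone, v ≠ w →
    Disjoint (region c v) (region c w) := by
  rw [isSimpleCut_iff] at hc
  have h1 : ∀ p ∈ c, Disjoint (region c none) (region c (some p)) := fun p hp =>
    disjoint_left.2 fun q hq hqp => (hq p hp).2 (le_of_lt hqp)
  rintro (_ | p) hv (_ | q) hw hne
  · exact absurd rfl hne
  · exact h1 q (Finset.some_mem_insertNone.1 hw)
  · exact (h1 p (Finset.some_mem_insertNone.1 hv)).symm
  · rw [Finset.some_mem_insertNone] at hv hw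
    have hne : p ≠ q := fun h => hne (congrArg some h)
    refine disjoint_left.2 fun r (hr : r < p) (hr' : r < q) => ?_
    rcases Crossing.le_or_le_of_le hr.le hr'.le (hc.1 p hv q hw hne) with h | h
    · exact hc.2 p hv q hw (lt_of_le_of_ne h hne)
    · exact hc.2 q hw p hv (lt_of_le_of_ne h hne.symm)

/-- The crossings of a cut `G ⊇ c` other than those of `c` are distributed over the faces of `c`. -/
theorem exists_mem_region {G : Finset (Crossing α)} (hG : IsCut G) (hcG : c ⊆ G) {q : Crossing α}
    (hq : q ∈ G) (hqc : q ∉ c) : ∃ v ∈ c.insertNone, q ∈ region c v := by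
  by_cases h : ∃ e ∈ c, q ≤ e
  · obtain ⟨e, he, hqe⟩ := h
    exact ⟨some e, Finset.some_mem_insertNone.2 he, lt_of_le_of_ne hqe fun h => hqc (h ▸ he)⟩
  · push Not at h
    exact ⟨none, Finset.none_mem_insertNone, fun e he =>
      ⟨hG q hq e (hcG he) fun h => hqc (h ▸ he), h e he⟩⟩

theorem notMem_of_mem_region (hc : IsSimpleCut c) {v : Option (Crossing α)}
    (hv : v ∈ c.insertNone) {q : Crossing α} (hq : q ∈ region c v) : q ∉ c := by
  intro hqc
  cases v with
  | none => exact (hq q hqc).2 le_rfl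
  | some p => exact (isSimpleCut_iff.1 hc).2 q hqc p (Finset.some_mem_insertNone.1 hv) hq

open Classical in
/-- Cuts of the faces of a simple cut `c` fit together to a cut containing `c`. -/
theorem isCut_union (hc : IsSimpleCut c) {C : Finset (Crossing α)}
    (h1 : ∀ q ∈ C, ∃ v ∈ c.insertNone, q ∈ region c v)
    (h2 : ∀ v ∈ c.insertNone, IsCut (C.filter (· ∈ region c v))) : IsCut (c ∪ C) := by
  -- chords of `C` are not linked with those of `c`, nor with those in other faces of `c`
  have hcC : ∀ e ∈ c, ∀ q ∈ C, ¬ Crossing.Linked q e := by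
    intro e he q hq
    obtain ⟨v, hv, hqv⟩ := h1 q hq
    cases v with
    | none => exact (hqv e he).1
    | some p =>
      rw [Finset.some_mem_insertNone] at hv
      rcases eq_or_ne p e with rfl | hne
      · exact Crossing.not_linked_of_le (le_of_lt hqv)
      · refine Crossing.not_linked_of_le_of_not_le (le_of_lt hqv) (hc.1 p hv e he hne) fun h => ?_
        exact (isSimpleCut_iff.1 hc).2 e he p hv (lt_of_le_of_ne h hne.symm)
  have hroot : ∀ q r, q ∈ region c none → (∃ p ∈ c, r < p) → ¬ Crossing.Linked r q := by
    rintro q r hq ⟨p, hp, hrp⟩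
    exact Crossing.not_linked_of_le_of_not_le hrp.le
      (fun h => (hq p hp).1 (Crossing.linked_symm.1 h)) (hq p hp).2
  intro q hq r hr hne
  rcases Finset.mem_union.1 hq with hq | hq <;> rcases Finset.mem_union.1 hr with hr | hr
  · exact hc.1 q hq r hr hne
  · exact fun h => hcC q hq r hr (Crossing.linked_symm.1 h)
  · exact hcC r hr q hq
  · obtain ⟨v, hv, hqv⟩ := h1 q hq
    obtain ⟨w, hw, hrw⟩ := h1 r hr
    rcases eq_or_ne v w with rfl | hvw
    · exact h2 v hv q (Finset.mem_filter.2 ⟨hq, hqv⟩) r (Finset.mem_filter.2 ⟨hr, hrw⟩) hne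
    rcases v with _ | p <;> rcases w with _ | p'
    · exact absurd rfl hvw
    · exact fun h => hroot q r hqv ⟨p', Finset.some_mem_insertNone.1 hw, hrw⟩
        (Crossing.linked_symm.1 h)
    · exact hroot r q hrw ⟨p, Finset.some_mem_insertNone.1 hv, hqv⟩
    · rw [Finset.some_mem_insertNone] at hv hw
      have hne' : p ≠ p' := fun h => hvw (congrArg some h)
      have hl := hc.1 p hv p' hw hne'
      have h3 := (isSimpleCut_iff.1 hc).2
      have h4 : ¬ p ≤ p' := fun h => h3 p hv p' hw (lt_of_le_of_ne h hne')
      have h5 : ¬ p' ≤ p := fun h => h3 p' hw p hv (lt_of_le_of_ne h hne'.symm)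
      exact Crossing.not_linked_of_disjoint ((Crossing.disjoint_closedArc hl h4 h5).mono
        (Crossing.closedArc_subset (le_of_lt hqv)) (Crossing.closedArc_subset (le_of_lt hrw)))

end CutCombinatorics

theorem isInner_root_iff_mem_region {α : PointedLoop M} {c : Finset (Crossing α)}
    (q : Crossing α) : q.IsInner (faceArcs c none) ↔ q ∈ region c none := by
  constructor
  · intro h
    have hl : ∀ e ∈ c, ¬ Crossing.Linked q e := fun e he => by
      have h1 := mem_faceArcs_none.1 (mem_of_mem_nhds h.1) e he
      have h2 := mem_faceArcs_none.1 (mem_of_mem_nhds h.2) e he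
      rw [Crossing.mem_arc_iff] at h1 h2
      rintro (h' | h')
      · exact h2 h'.2
      · exact h1 ⟨h'.1, h'.2.1⟩
    exact fun e he => ⟨hl e he, (isInner_root_iff hl).1 h e he⟩
  · exact fun h => (isInner_root_iff fun e he => (h e he).1).2 fun e he => (h e he).2

section Eta

variable (R : Type*) [CommRing R] (φ : PointedClass M → Λ)

/-- The sign of a cut as an element of the ring of coefficients. -/
def cutCoeff {α : PointedLoop M} (H : Finset (Crossing α)) : R := ((cutSign H : ℤ) : R)

theorem cutCoeff_union {α : PointedLoop M} [DecidableEq (Crossing α)] {G H : Finset (Crossing α)}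
    (h : Disjoint G H) : cutCoeff R (G ∪ H) = cutCoeff R G * cutCoeff R H := by
  simp only [cutCoeff, cutSign, Finset.prod_union h]
  push_cast
  rfl

theorem cutCoeff_biUnion {α : PointedLoop M} [DecidableEq (Crossing α)] {ι : Type*} {s : Finset ι}
    {t : ι → Finset (Crossing α)} (h : (s : Set ι).PairwiseDisjoint t) :
    cutCoeff R (s.biUnion t) = ∏ i ∈ s, cutCoeff R (t i) := by
  simp only [cutCoeff, cutSign, Finset.prod_biUnion h]
  push_cast
  rfl

/-- The cuts of a loop all of whose crossings belong to `s`. -/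
def cutsIn {α : PointedLoop M} (s : Set (Crossing α)) : Finset (Finset (Crossing α)) :=
  (Set.toFinite {H | IsCut H ∧ ∀ q ∈ H, q ∈ s}).toFinset

theorem mem_cutsIn {α : PointedLoop M} {s : Set (Crossing α)} {H : Finset (Crossing α)} :
    H ∈ cutsIn s ↔ IsCut H ∧ ∀ q ∈ H, q ∈ s := by
  simp [cutsIn]

theorem loopCoproduct_eq (α : PointedLoop M)
    (S : Finset (Finset (Crossing α))) (hS : ∀ c, c ∈ S ↔ IsSimpleCut c) :
    loopCoproduct R α = gen R (⟦α⟧ : PointedClass M) ⊗ₜ[R] 1 + ∑ c ∈ S, cutCoeff R c •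
      ((∏ p ∈ c, gen R (faceClass α c (some p))) ⊗ₜ[R] gen R (faceClass α c none)) := by
  rw [loopCoproduct, Finset.sum_subtype S hS]
  congr 1

/-- The sum of `ε_H T_H` over all cuts `H` of a pointed loop. -/
def expansion (α : PointedLoop M) : FreeSym R (TreeClass Λ) :=
  ∑ H ∈ cutsIn (univ : Set (Crossing α)), cutCoeff R H • gen R (faceTreeClass φ α H)

variable {R φ} {α β : PointedLoop M} [OrientedSurface M]

/-- The expansion of a loop which follows `α` is a sum over cuts of `α`. -/
theorem Follows.expansion_eq {A : Set S1} {b : S1} {h : AmbientIsotopy M} {g : S1 → S1}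
    (s : Follows α β A b h g) {D : Set (Crossing α)} (hD : ∀ q, q.IsInner A ↔ q ∈ D)
    {F : Finset (Crossing α) → TreeClass Λ}
    (hF : ∀ K, IsCut K → (∀ r ∈ K, s.pull r ∈ D) →
      F (K.map s.pullEmb) = faceTreeClass φ β K) :
    expansion R φ β = ∑ K ∈ cutsIn D, cutCoeff R K • gen R (F K) := by
  refine Finset.sum_nbij (fun K => K.map s.pullEmb) ?_ (Finset.map_injective _).injOn ?_ ?_
  · intro K hK
    rw [mem_cutsIn] at hK ⊢
    exact ⟨s.isCut_map_iff.2 hK.1, fun q hq => (hD q).1 (s.isInner_of_mem_map hq)⟩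
  · intro H hH
    rw [Finset.mem_coe, mem_cutsIn] at hH
    obtain ⟨K, rfl⟩ := s.exists_map_eq fun q hq => (hD q).2 (hH.2 q hq)
    exact ⟨K, mem_cutsIn.2 ⟨s.isCut_map_iff.1 hH.1, fun _ _ => trivial⟩, rfl⟩
  · intro K hK
    rw [hF K (mem_cutsIn.1 hK).1 fun r _ => (hD _).1 (s.pull_isInner r), cutCoeff, cutCoeff,
      s.cutSign_map]

theorem expansion_eq_of_isotopic (h : PointedLoop.Isotopic α β) :
    expansion R φ β = expansion R φ α := by
  obtain ⟨h, g, s⟩ := exists_follows_of_isotopic h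
  rw [← faceArcs_empty_none (α := α)] at s
  refine s.expansion_eq (D := univ) (fun q => ?_) fun K hK _ => ?_
  · simp [Crossing.IsInner, faceArcs_empty_none]
  · rw [← trunkClass_empty (s.isCut_map_iff.2 hK)]
    exact s.trunkClass_eq (s.isCut_map_iff.2 hK) (Finset.empty_subset _) (by simp)

variable (R φ) in
/-- The expansion of a class of loops. -/
def expansionClass (x : PointedClass M) : FreeSym R (TreeClass Λ) := expansion R φ x.out

theorem expansionClass_mk : expansionClass R φ (⟦α⟧ : PointedClass M) = expansion R φ α :=
  expansion_eq_of_isotopic ((pointedSetoid M).symm (Quotient.mk_out α))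

open Classical in
theorem expansion_branch {c : Finset (Crossing α)} (hc : IsSimpleCut c) {p : Crossing α}
    (hp : p ∈ c) : expansionClass R φ (faceClass α c (some p)) =
      ∑ K ∈ cutsIn (region c (some p)), cutCoeff R K • gen R (branchClass φ α (insert p K) p) := by
  obtain ⟨β, g, hβ, s⟩ := exists_follows_branch hc hp
  rw [hβ, expansionClass_mk]
  refine s.expansion_eq (D := region c (some p)) (fun q => isInner_closedArc_iff)
    (F := fun K => branchClass φ α (insert p K) p) fun K hK hKD => ?_
  have hlt : ∀ q ∈ K.map s.pullEmb, q < p := fun q hq =>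
    isInner_closedArc_iff.1 (s.isInner_of_mem_map hq)
  refine s.branchClass_eq (fun q hq r hr hqr => ?_) (Finset.mem_insert_self _ _) fun q => ?_
  · rcases Finset.mem_insert.1 hq with rfl | hq <;> rcases Finset.mem_insert.1 hr with rfl | hr
    · exact absurd rfl hqr
    · exact fun h => Crossing.not_linked_of_le (hlt r hr).le (Crossing.linked_symm.1 h)
    · exact Crossing.not_linked_of_le (hlt q hq).le
    · exact s.isCut_map_iff.2 hK q hq r hr hqr
  · rw [Finset.mem_insert]
    exact ⟨fun hq => ⟨Or.inr hq, hlt q hq⟩, fun hq => hq.1.resolve_left hq.2.ne⟩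

open Classical in
theorem expansion_root {c : Finset (Crossing α)} (hc : IsSimpleCut c) :
    expansionClass R φ (faceClass α c none) =
      ∑ K ∈ cutsIn (region c none), cutCoeff R K • gen R (trunkClass φ α (c ∪ K) c) := by
  obtain ⟨β, g, hβ, s⟩ := exists_follows_root hc
  rw [hβ, expansionClass_mk]
  refine s.expansion_eq (D := region c none) isInner_root_iff_mem_region
    (F := fun K => trunkClass φ α (c ∪ K) c) fun K hK hKD => ?_
  have hD : ∀ q ∈ K.map s.pullEmb, q ∈ region c none := fun q hq =>
    (isInner_root_iff_mem_region q).1 (s.isInner_of_mem_map hq)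
  refine s.trunkClass_eq (isCut_union hc (fun q hq => ⟨none, Finset.none_mem_insertNone, hD q hq⟩)
    fun v hv => (s.isCut_map_iff.2 hK).subset (Finset.filter_subset _ _))
    Finset.subset_union_left fun q => ?_
  rw [Finset.mem_union]
  exact ⟨fun hq => ⟨Or.inr hq, fun e he => (hD q hq e he).2⟩,
    fun hq => hq.1.resolve_left fun hqc => hq.2 q hqc le_rfl⟩

/-- The contribution of a simple cut `c` of a loop is a sum over all cuts which contain `c`. -/
theorem expansion_simpleCut {c : Finset (Crossing α)} (hc : IsSimpleCut c)
    (𝒢 : Finset (Finset (Crossing α))) (h𝒢 : ∀ G, G ∈ 𝒢 ↔ IsCut G ∧ c ⊆ G) :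
    cutCoeff R c • ((∏ p ∈ c, expansionClass R φ (faceClass α c (some p))) ⊗ₜ[R]
      expansionClass R φ (faceClass α c none)) =
    ∑ G ∈ 𝒢, cutCoeff R G • ((∏ p ∈ c, gen R (branchClass φ α G p)) ⊗ₜ[R]
      gen R (trunkClass φ α G c)) := by
  classical
  -- the factor of the face `v`, as a function of the part of the cut in this face
  let T : Option (Crossing α) → Finset (Crossing α) →
      FreeSym R (TreeClass Λ) ⊗[R] FreeSym R (TreeClass Λ) := fun v K =>
    v.elim (1 ⊗ₜ[R] gen R (trunkClass φ α (c ∪ K) c))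
      fun p => gen R (branchClass φ α (insert p K) p) ⊗ₜ[R] 1
  have hprod : ∀ F : Option (Crossing α) → FreeSym R (TreeClass Λ) ⊗[R] FreeSym R (TreeClass Λ),
      ∏ v ∈ c.insertNone, F v = (∏ p ∈ c, F (some p)) * F none := fun F => by
    rw [Finset.prod_insertNone, mul_comm]
  have htmul : ∀ (f : Crossing α → FreeSym R (TreeClass Λ)) (x : FreeSym R (TreeClass Λ)),
      (∏ p ∈ c, f p) ⊗ₜ[R] x = (∏ p ∈ c, f p ⊗ₜ[R] (1 : FreeSym R (TreeClass Λ))) *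
        (1 ⊗ₜ[R] x) := fun f x => by
    have h1 := map_prod (Algebra.TensorProduct.includeLeft (R := R) (S := R)
      (A := FreeSym R (TreeClass Λ)) (B := FreeSym R (TreeClass Λ))) f c
    simp only [Algebra.TensorProduct.includeLeft_apply] at h1
    rw [← h1, Algebra.TensorProduct.tmul_mul_tmul, mul_one, one_mul]
  -- the root face contributes the second tensor factor, the other faces contribute the first
  have hLHS : (∏ p ∈ c, expansionClass R φ (faceClass α c (some p))) ⊗ₜ[R]
      expansionClass R φ (faceClass α c none) =
      ∏ v ∈ c.insertNone, ∑ K ∈ cutsIn (region c v), cutCoeff R K • T v K := by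
    rw [hprod, htmul, expansion_root hc]
    congr 1
    · refine Finset.prod_congr rfl fun p hp => ?_
      rw [expansion_branch hc hp, TensorProduct.sum_tmul]
      exact Finset.sum_congr rfl fun K _ => TensorProduct.smul_tmul' _ _ _
    · rw [TensorProduct.tmul_sum]
      exact Finset.sum_congr rfl fun K _ => TensorProduct.tmul_smul _ _ _
  have hinj : Set.InjOn (fun G => G \ c) (𝒢 : Set (Finset (Crossing α))) := by
    intro G hG G' hG' h
    have h1 : ∀ {G}, G ∈ 𝒢 → G \ c ∪ c = G := fun hG =>
      Finset.sdiff_union_of_subset ((h𝒢 _).1 hG).2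
    rw [← h1 hG, ← h1 hG']
    exact congrArg (· ∪ c) h
  have hnot : ∀ v ∈ c.insertNone, ∀ q ∈ region c v, q ∉ c := fun v hv q hq =>
    notMem_of_mem_region hc hv hq
  -- choosing a cut in every face of `c` amounts to choosing a cut `G ⊇ c`, through `G \ c`
  rw [hLHS, prod_sum_subsets c.insertNone (region c) (disjoint_region hc) _
    (fun v _ K hK => (mem_cutsIn.1 hK).2) _ (𝒢.image fun G => G \ c), Finset.sum_image hinj,
    Finset.smul_sum]
  · refine Finset.sum_congr rfl fun G hG => ?_
    obtain ⟨hGcut, hcG⟩ := (h𝒢 G).1 hG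
    have hfil : ∀ v ∈ c.insertNone, ∀ q, q ∈ (G \ c).filter (· ∈ region c v) ↔
        q ∈ G ∧ q ∈ region c v := fun v hv q => by
      rw [Finset.mem_filter, Finset.mem_sdiff]
      exact ⟨fun h => ⟨h.1.1, h.2⟩, fun h => ⟨⟨h.1, hnot v hv q h.2⟩, h.2⟩⟩
    have hT : ∀ p ∈ c, T (some p) ((G \ c).filter (· ∈ region c (some p))) =
        gen R (branchClass φ α G p) ⊗ₜ[R] 1 := fun p hp => by
      have hm := hfil (some p) (Finset.some_mem_insertNone.2 hp)
      refine congrArg (fun x => gen R x ⊗ₜ[R] (1 : FreeSym R (TreeClass Λ)))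
        (branchClass_congr (hGcut.subset ?_) hGcut (Finset.mem_insert_self _ _) (hcG hp) ?_)
      · exact Finset.insert_subset (hcG hp) fun q hq => ((hm q).1 hq).1
      · intro q hq
        rw [Finset.mem_insert, hm]
        exact ⟨fun h => h.elim (fun e => absurd hq e.not_lt) And.left, fun h => Or.inr ⟨h, hq⟩⟩
    have hT0 : T none ((G \ c).filter (· ∈ region c none)) =
        1 ⊗ₜ[R] gen R (trunkClass φ α G c) := by
      have hm := hfil none Finset.none_mem_insertNone
      refine congrArg (fun x => (1 : FreeSym R (TreeClass Λ)) ⊗ₜ[R] gen R x)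
        (trunkClass_congr hc (hGcut.subset ?_) hGcut Finset.subset_union_left hcG ?_)
      · exact Finset.union_subset hcG fun q hq => ((hm q).1 hq).1
      · intro q hq
        rw [Finset.mem_union, hm]
        refine ⟨fun h => h.elim (fun h => hcG h) And.left, fun h => Or.inr ⟨h, fun e he =>
          ⟨hGcut q h e (hcG he) fun h => hq e he h.le, hq e he⟩⟩⟩
    have hsign : cutCoeff R G = cutCoeff R c *
        ∏ v ∈ c.insertNone, cutCoeff R ((G \ c).filter (· ∈ region c v)) := by
      rw [← cutCoeff_biUnion, ← cutCoeff_union]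
      · congr 1
        ext q
        simp only [Finset.mem_union, Finset.mem_biUnion, Finset.mem_filter, Finset.mem_sdiff]
        constructor
        · intro hq
          by_cases hqc : q ∈ c
          · exact Or.inl hqc
          · obtain ⟨v, hv, hqv⟩ := exists_mem_region hGcut hcG hq hqc
            exact Or.inr ⟨v, hv, ⟨hq, hqc⟩, hqv⟩
        · rintro (h | ⟨v, -, h, -⟩)
          exacts [hcG h, h.1]
      · refine Finset.disjoint_left.2 fun q hq hq' => ?_
        obtain ⟨v, -, h⟩ := Finset.mem_biUnion.1 hq'
        exact (Finset.mem_sdiff.1 (Finset.mem_filter.1 h).1).2 hq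
      · intro v hv w hw hne
        refine Finset.disjoint_left.2 fun q hq hq' => ?_
        exact disjoint_left.1 (disjoint_region hc v hv w hw hne) (Finset.mem_filter.1 hq).2
          (Finset.mem_filter.1 hq').2
    rw [Finset.prod_smul, smul_smul, ← hsign, hprod, Finset.prod_congr rfl hT, hT0, htmul]
  · intro C
    simp only [Finset.mem_image, h𝒢, mem_cutsIn]
    constructor
    · rintro ⟨G, ⟨hG, hcG⟩, rfl⟩
      refine ⟨fun q hq => ?_, fun v hv => ⟨hG.subset ?_, fun q hq => (Finset.mem_filter.1 hq).2⟩⟩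
      · exact exists_mem_region hG hcG (Finset.mem_sdiff.1 hq).1 (Finset.mem_sdiff.1 hq).2
      · exact (Finset.filter_subset _ _).trans Finset.sdiff_subset
    · rintro ⟨h1, h2⟩
      refine ⟨c ∪ C, ⟨isCut_union hc h1 fun v hv => (h2 v hv).1, Finset.subset_union_left⟩, ?_⟩
      rw [Finset.union_sdiff_cancel_left]
      refine Finset.disjoint_left.2 fun q hq hqC => ?_
      obtain ⟨v, hv, hqv⟩ := h1 q hqC
      exact hnot v hv q hqv hq

/-- Expanding loops into trees turns the comultiplication of loops into the Connes-Kreimer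
comultiplication. Both sides are sums over pairs of a cut and a simple cut contained in it. -/
theorem map_expansion_loopCoproduct (α : PointedLoop M) :
    Algebra.TensorProduct.map (extendAlg R (expansionClass R φ))
        (extendAlg R (expansionClass R φ)) (loopCoproduct R α) =
      treeComul R Λ (expansion R φ α) := by
  classical
  let S : Finset (Finset (Crossing α)) := (Set.toFinite {c | IsSimpleCut c}).toFinset
  have hS : ∀ c, c ∈ S ↔ IsSimpleCut c := fun c => by simp [S]
  rw [loopCoproduct_eq R α S hS]
  simp only [map_add, map_sum, map_smul, Algebra.TensorProduct.map_tmul, map_prod, extendAlg_gen,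
    map_one, expansionClass_mk]
  rw [Finset.sum_congr rfl fun c hc => expansion_simpleCut ((hS c).1 hc)
    ((cutsIn univ).filter (c ⊆ ·)) fun G => by simp [mem_cutsIn]]
  have hR : treeComul R Λ (expansion R φ α) = expansion R φ α ⊗ₜ[R] 1 +
      ∑ G ∈ cutsIn (univ : Set (Crossing α)), ∑ c ∈ antichains {p | p ∈ G}, cutCoeff R G •
        ((∏ p ∈ c, gen R (branchClass φ α G p)) ⊗ₜ[R] gen R (trunkClass φ α G c)) := by
    rw [expansion, map_sum, TensorProduct.sum_tmul, ← Finset.sum_add_distrib]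
    refine Finset.sum_congr rfl fun G hG => ?_
    rw [map_smul, treeComul_faceTreeClass R (mem_cutsIn.1 hG).1, smul_add, Finset.smul_sum,
      TensorProduct.smul_tmul']
  rw [hR]
  congr 1
  -- simple cuts contained in a cut `G` are the antichains in `G`
  refine Finset.sum_comm' fun c G => ?_
  rw [hS, Finset.mem_filter, mem_cutsIn, mem_antichains, isSimpleCut_iff]
  constructor
  · rintro ⟨h1, h2, h3⟩
    exact ⟨⟨h3, h1.2⟩, h2⟩
  · rintro ⟨⟨h1, h2⟩, h3⟩
    exact ⟨⟨h3.1.subset h1, h2⟩, h3, h1⟩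

end Eta

end CutExpansion

/-! ### Transfer of coassociativity -/

section Transfer

variable {R : Type*} [CommRing R]

/-- The degree `1` part can be read off with the homomorphism to the trivial square-zero
extension. -/
theorem symmetricAlgebra_ι_injective {X : Type*} :
    Function.Injective (SymmetricAlgebra.ι R (X →₀ R)) := by
  let f : SymmetricAlgebra R (X →₀ R) →ₐ[R] TrivSqZeroExt R (X →₀ R) :=
    SymmetricAlgebra.lift (TrivSqZeroExt.inrHom R (X →₀ R))
  have h : ∀ x, (f (SymmetricAlgebra.ι R (X →₀ R) x)).snd = x := fun x => by
    simp only [f, SymmetricAlgebra.lift_ι_apply]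
    rfl
  exact fun x y hxy => by rw [← h x, hxy, h y]

variable {A B : Type*} [CommRing A] [Algebra R A] [CommRing B] [Algebra R B]

theorem map_retract {f : A →ₐ[R] B} {ρ : B →ₐ[R] A} (h : ρ.comp f = .id R A) :
    Function.Injective (Algebra.TensorProduct.map f f) := by
  have h1 : (Algebra.TensorProduct.map ρ ρ).comp (Algebra.TensorProduct.map f f) =
      .id R (A ⊗[R] A) := by
    rw [← Algebra.TensorProduct.map_comp, h, Algebra.TensorProduct.map_id]
  exact Function.LeftInverse.injective (g := Algebra.TensorProduct.map ρ ρ) fun x =>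
    congrArg (fun g : A ⊗[R] A →ₐ[R] A ⊗[R] A => g x) h1

/-- Coassociativity is inherited by retracts. -/
theorem coassoc_of_retract {Δ : A →ₐ[R] A ⊗[R] A} {Δ' : B →ₐ[R] B ⊗[R] B}
    {f : A →ₐ[R] B} {ρ : B →ₐ[R] A} (hρ : ρ.comp f = .id R A)
    (hf : (Algebra.TensorProduct.map f f).comp Δ = Δ'.comp f)
    (h : (Algebra.TensorProduct.assoc R R R B B B).toAlgHom.comp
      ((Algebra.TensorProduct.map Δ' (.id R B)).comp Δ') =
      (Algebra.TensorProduct.map (.id R B) Δ').comp Δ') :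
    (Algebra.TensorProduct.assoc R R R A A A).toAlgHom.comp
      ((Algebra.TensorProduct.map Δ (.id R A)).comp Δ) =
      (Algebra.TensorProduct.map (.id R A) Δ).comp Δ := by
  have hinj : Function.Injective
      (Algebra.TensorProduct.map f (Algebra.TensorProduct.map f f)) := by
    have h1 : (Algebra.TensorProduct.map ρ (Algebra.TensorProduct.map ρ ρ)).comp
        (Algebra.TensorProduct.map f (Algebra.TensorProduct.map f f)) =
        .id R (A ⊗[R] (A ⊗[R] A)) := by
      rw [← Algebra.TensorProduct.map_comp, ← Algebra.TensorProduct.map_comp, hρ,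
        Algebra.TensorProduct.map_id, Algebra.TensorProduct.map_id]
    exact Function.LeftInverse.injective
      (g := Algebra.TensorProduct.map ρ (Algebra.TensorProduct.map ρ ρ)) fun x =>
      congrArg (fun g : A ⊗[R] (A ⊗[R] A) →ₐ[R] A ⊗[R] (A ⊗[R] A) => g x) h1
  have hassoc : ∀ x, Algebra.TensorProduct.map f (Algebra.TensorProduct.map f f)
      (Algebra.TensorProduct.assoc R R R A A A x) =
      Algebra.TensorProduct.assoc R R R B B B
        (Algebra.TensorProduct.map (Algebra.TensorProduct.map f f) f x) := fun x => by
    induction x using TensorProduct.induction_on with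
    | zero => simp
    | add x y hx hy => simp only [map_add, hx, hy]
    | tmul x c =>
      induction x using TensorProduct.induction_on with
      | zero => simp
      | add x y hx hy => simp only [TensorProduct.add_tmul, map_add, hx, hy]
      | tmul a b => rfl
  have hf' : ∀ x, Algebra.TensorProduct.map f f (Δ x) = Δ' (f x) := fun x =>
    congrArg (fun g : A →ₐ[R] B ⊗[R] B => g x) hf
  have hl : ∀ x, Algebra.TensorProduct.map (Algebra.TensorProduct.map f f) f
      (Algebra.TensorProduct.map Δ (.id R A) x) =
      Algebra.TensorProduct.map Δ' (.id R B) (Algebra.TensorProduct.map f f x) := fun x => by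
    induction x using TensorProduct.induction_on with
    | zero => simp
    | add x y hx hy => simp only [map_add, hx, hy]
    | tmul a b => simp [hf']
  have hr : ∀ x, Algebra.TensorProduct.map f (Algebra.TensorProduct.map f f)
      (Algebra.TensorProduct.map (.id R A) Δ x) =
      Algebra.TensorProduct.map (.id R B) Δ' (Algebra.TensorProduct.map f f x) := fun x => by
    induction x using TensorProduct.induction_on with
    | zero => simp
    | add x y hx hy => simp only [map_add, hx, hy]
    | tmul a b => simp [hf']
  -- compare both sides in `B ⊗ B ⊗ B`, where `f ⊗ f ⊗ f` is injective
  refine AlgHom.ext fun x => hinj ?_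
  have h2 := congrArg (fun g : B →ₐ[R] B ⊗[R] (B ⊗[R] B) => g (f x)) h
  change Algebra.TensorProduct.assoc R R R B B B (Algebra.TensorProduct.map Δ' (.id R B)
    (Δ' (f x))) = Algebra.TensorProduct.map (.id R B) Δ' (Δ' (f x)) at h2
  change Algebra.TensorProduct.map f (Algebra.TensorProduct.map f f)
    (Algebra.TensorProduct.assoc R R R A A A (Algebra.TensorProduct.map Δ (.id R A) (Δ x))) =
    Algebra.TensorProduct.map f (Algebra.TensorProduct.map f f)
      (Algebra.TensorProduct.map (.id R A) Δ (Δ x))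
  rw [hassoc, hl, hf', h2, hr, hf']

end Transfer

/-! ### The Hopf algebra of pointed loops -/

section Loops

variable {R : Type*} [CommRing R] {M : Type*} [TopologicalSpace M]
  [ChartedSpace (EuclideanHalfSpace 2) M] {Λ : Type*}

/-- The label of the root of a tree. -/
def rootLabel : TreeClass Λ → Λ :=
  Quotient.lift (fun T => T.label none) fun _ _ ⟨_, _, hl, _⟩ => (hl none).symm

variable (R Λ) in
/-- The projection of trees onto single vertices. -/
def vertexProjection : FreeSym R (TreeClass Λ) →ₐ[R] FreeSym R Λ :=
  extendAlg R fun t => if edgeNumber t = 0 then gen R (rootLabel t) else 0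

theorem vertexProjection_expansion (α : PointedLoop M) :
    vertexProjection R (PointedClass M) (expansion R id α) = gen R (⟦α⟧ : PointedClass M) := by
  rw [expansion, map_sum, Finset.sum_eq_single (∅ : Finset (Crossing α))]
  · rw [map_smul, faceTreeClass_eq isCut_empty, vertexProjection, extendAlg_gen, edgeNumber_mk,
      if_pos (Finite.card_eq_zero_iff.2 ⟨fun e => Finset.notMem_empty _ e.2⟩)]
    have h1 : rootLabel (⟦faceTree id α ∅ isCut_empty⟧ : TreeClass (PointedClass M)) = ⟦α⟧ :=
      faceClass_empty
    rw [h1]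
    simp [cutCoeff, cutSign]
  · intro H hH hne
    obtain ⟨q, hq⟩ := Finset.nonempty_iff_ne_empty.2 hne
    rw [map_smul, faceTreeClass_eq (mem_cutsIn.1 hH).1, vertexProjection, extendAlg_gen,
      edgeNumber_mk, if_neg fun h => (Finite.card_eq_zero_iff.1 h).elim ⟨q, hq⟩, smul_zero]
  · exact fun h => absurd (mem_cutsIn.2 ⟨isCut_empty, by simp⟩) h

theorem vertexProjection_comp_expansion :
    (vertexProjection R (PointedClass M)).comp (extendAlg R (expansionClass R id)) =
      .id R (FreeSym R (PointedClass M)) := by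
  refine freeSym_algHom_ext fun x => ?_
  rw [AlgHom.comp_apply, extendAlg_gen, expansionClass, vertexProjection_expansion,
    Quotient.out_eq]
  rfl

theorem augmentation_expansion (φ : PointedClass M → Λ) (α : PointedLoop M) :
    augmentation R (TreeClass Λ) (expansion R φ α) = 0 := by
  rw [expansion, map_sum]
  exact Finset.sum_eq_zero fun H _ => by rw [map_smul, augmentation_gen, smul_zero]

/-- The number of crossings of a class of loops. -/
def crossingNumber (x : PointedClass M) : ℕ := Nat.card (Crossing x.out)

theorem Follows.card_lt {α β : PointedLoop M} {A : Set S1} {b : S1} {h : AmbientIsotopy M}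
    {g : S1 → S1} (s : Follows α β A b h g) {q : Crossing α} (hq : ¬ q.IsInner A) :
    Nat.card (Crossing β) < Nat.card (Crossing α) := by
  let f : Crossing β → {p : Crossing α // p ≠ q} := fun r =>
    ⟨s.pull r, fun e => hq (e ▸ s.pull_isInner r)⟩
  have hf : Function.Injective f := fun r r' e => s.pull_injective (congrArg Subtype.val e)
  exact (Nat.card_le_card_of_injective f hf).trans_lt (Finite.card_subtype_lt (x := q) (by simp))

theorem crossingNumber_mk (α : PointedLoop M) :
    crossingNumber (⟦α⟧ : PointedClass M) = Nat.card (Crossing α) := by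
  have hle : ∀ {α β : PointedLoop M}, PointedLoop.Isotopic α β →
      Nat.card (Crossing β) ≤ Nat.card (Crossing α) := fun h => by
    obtain ⟨_, _, s⟩ := exists_follows_of_isotopic h
    exact Nat.card_le_card_of_injective _ s.pull_injective
  have h := Quotient.mk_out (s := pointedSetoid M) α
  exact le_antisymm (hle ((pointedSetoid M).symm h)) (hle h)

variable (R) in
theorem ι_etaLoop (α : PointedLoop M) :
    SymmetricAlgebra.ι R _ (etaLoop R α) = expansion R forgetBase α := by
  classical
  rw [etaLoop, expansion, map_sum]
  refine (Finset.sum_congr rfl fun H _ => ?_).trans (Finset.sum_subtype (cutsIn univ) (p := IsCut)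
    (fun H => by simp [mem_cutsIn]) fun H => cutCoeff R H •
      gen R (faceTreeClass forgetBase α H)).symm
  rw [map_smul, faceTreeClass_eq H.2]
  rfl

variable [OrientedSurface M]

/-- The formula for the comultiplication of loops holds for all representatives, since the expansion
into trees with vertices labeled by pointed loops is injective and isotopy invariant. -/
theorem loopComul_gen (α : PointedLoop M) :
    loopComul M R (gen R (⟦α⟧ : PointedClass M)) = loopCoproduct R α := by
  apply map_retract (vertexProjection_comp_expansion (R := R) (M := M))
  rw [loopComul, extendAlg_gen, map_expansion_loopCoproduct, map_expansion_loopCoproduct,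
    ← expansionClass, expansionClass_mk]

theorem map_expansion_comp_loopComul (φ : PointedClass M → Λ) :
    (Algebra.TensorProduct.map (extendAlg R (expansionClass R φ))
      (extendAlg R (expansionClass R φ))).comp (loopComul M R) =
      (treeComul R Λ).comp (extendAlg R (expansionClass R φ)) := by
  refine freeSym_algHom_ext fun x => ?_
  rw [AlgHom.comp_apply, AlgHom.comp_apply, loopComul, extendAlg_gen, extendAlg_gen,
    map_expansion_loopCoproduct, expansionClass]

variable (R M) in
theorem loopComul_coassoc :
    (Algebra.TensorProduct.assoc R R R (FreeSym R (PointedClass M)) (FreeSym R (PointedClass M))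
        (FreeSym R (PointedClass M))).toAlgHom.comp
      ((Algebra.TensorProduct.map (loopComul M R) (.id R _)).comp (loopComul M R)) =
    (Algebra.TensorProduct.map (.id R _) (loopComul M R)).comp (loopComul M R) :=
  coassoc_of_retract vertexProjection_comp_expansion (map_expansion_comp_loopComul id)
    (treeComul_coassoc R (PointedClass M))

variable (R M) in
/-- Nontrivial simple cuts split a loop into loops with fewer crossings, since their chords
disappear. -/
theorem loopComul_isConnected : IsConnected crossingNumber (loopComul M R) := by
  classical
  intro x
  induction x using Quotient.inductionOn with
  | _ α =>
  let S : Finset (Finset (Crossing α)) := (Set.toFinite {c | IsSimpleCut c}).toFinset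
  have hS : ∀ c, c ∈ S ↔ IsSimpleCut c := fun c => by simp [S]
  -- the empty cut gives the term `1 ⊗ α`
  refine ⟨{c // c ∈ S.erase ∅}, inferInstance, fun c => cutCoeff R c.1,
    fun c => c.1.val.map fun p => faceClass α c.1 (some p), fun c => faceClass α c.1 none, ?_, ?_⟩
  · simp only [genProd_map]
    rw [Finset.sum_coe_sort (S.erase ∅) fun c => cutCoeff R c •
      ((∏ p ∈ c, gen R (faceClass α c (some p))) ⊗ₜ[R] gen R (faceClass α c none)),
      loopComul_gen, loopCoproduct_eq R α S hS, ← Finset.add_sum_erase S _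
        ((hS ∅).2 isSimpleCut_empty), add_assoc, faceClass_empty]
    congr 2
    simp [cutCoeff, cutSign]
  · rintro ⟨c, hc⟩
    obtain ⟨hne, hc⟩ := Finset.mem_erase.1 hc
    rw [hS] at hc
    refine ⟨by simpa using hne, fun z hz => ?_, ?_⟩
    · obtain ⟨p, hp, rfl⟩ := Multiset.mem_map.1 hz
      obtain ⟨β, g, hβ, s⟩ := exists_follows_branch hc hp
      rw [hβ, crossingNumber_mk, crossingNumber_mk]
      exact s.card_lt (q := p) fun h => lt_irrefl p (isInner_closedArc_iff.1 h)
    · obtain ⟨q, hq⟩ := Finset.nonempty_iff_ne_empty.2 hne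
      obtain ⟨β, g, hβ, s⟩ := exists_follows_root hc
      simp only [hβ, crossingNumber_mk]
      exact s.card_lt (q := q) fun h =>
        (isInner_root_iff_mem_region q).1 h q hq |>.2 le_rfl

/-! ### The map `η` -/

variable (R) in
theorem etaLin_single (α : PointedLoop M) :
    etaLin M R (Finsupp.single (⟦α⟧ : PointedClass M) 1) = etaLoop R α := by
  apply symmetricAlgebra_ι_injective
  rw [etaLin, Finsupp.linearCombination_single, one_smul, ι_etaLoop, ι_etaLoop, ← expansionClass,
    expansionClass_mk]

variable (R M) in
theorem eta_eq : eta M R = extendAlg R (expansionClass R forgetBase) := by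
  refine freeSym_algHom_ext fun x => ?_
  rw [extendAlg_gen, expansionClass, ← ι_etaLoop, ← etaLin_single, Quotient.out_eq, eta, gen,
    SymmetricAlgebra.lift_ι_apply]
  rfl

end Loops

end LoopTree

end

open LoopTree in
theorem mainTheorem2 (R : Type*) [CommRing R]
    (M : Type*) [TopologicalSpace M] [T2Space M] [SecondCountableTopology M]
    [ChartedSpace (EuclideanHalfSpace 2) M] [OrientedSurface M] :
    -- the loops associated with the faces of a cut exist and are unique up to isotopy
    (∀ (α : PointedLoop M) (H : Finset (Crossing α)), IsCut H →
      ∀ v : Option (Crossing α), (∀ p ∈ v, p ∈ H) →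
        (∃ β, IsFaceLoop α H v β) ∧
          ∀ β, IsFaceLoop α H v β → faceClass α H v = (⟦β⟧ : PointedClass M)) ∧
    -- the formulas for the two comultiplications and for `η` hold for all representatives
    (∀ α : PointedLoop M, loopComul M R (gen R (⟦α⟧ : PointedClass M)) = loopCoproduct R α) ∧
    (∀ T : PlanarTree (LoopClass M),
      treeComul R (LoopClass M) (gen R (⟦T⟧ : TreeClass (LoopClass M))) = treeCoproduct R T) ∧
    (∀ α : PointedLoop M, etaLin M R (Finsupp.single (⟦α⟧ : PointedClass M) 1) = etaLoop R α) ∧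
    -- both algebras are Hopf algebras and `η` is a Hopf algebra homomorphism
    ∃ (sL : FreeSym R (PointedClass M) →ₗ[R] FreeSym R (PointedClass M))
      (sT : FreeSym R (TreeClass (LoopClass M)) →ₗ[R] FreeSym R (TreeClass (LoopClass M))),
      IsHopfAlgebra (loopComul M R) (augmentation R (PointedClass M)) sL ∧
      IsHopfAlgebra (treeComul R (LoopClass M)) (augmentation R (TreeClass (LoopClass M))) sT ∧
      IsHopfHom (loopComul M R) (augmentation R (PointedClass M)) sL
        (treeComul R (LoopClass M)) (augmentation R (TreeClass (LoopClass M))) sT (eta M R) := by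
  obtain ⟨sL, hL⟩ := (loopComul_isConnected R M).exists_isHopfAlgebra (loopComul_coassoc R M)
  obtain ⟨sT, hT⟩ := (treeComul_isConnected R (LoopClass M)).exists_isHopfAlgebra
    (treeComul_coassoc R (LoopClass M))
  refine ⟨fun α H hH v _ => ⟨exists_isFaceLoop hH v, fun β hβ => hβ.faceClass_eq⟩, loopComul_gen,
    treeComul_gen R, etaLin_single R, sL.toLinearMap, sT.toLinearMap, hL, hT,
    isHopfHom_of_bialgHom hL hT ?_ ?_⟩
  · rw [eta_eq]
    exact map_expansion_comp_loopComul forgetBase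
  · refine freeSym_algHom_ext fun x => ?_
    rw [AlgHom.comp_apply, eta_eq, extendAlg_gen, expansionClass, augmentation_expansion,
      augmentation_gen]
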